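/- Let $k$ be a field. A *pretannakian category* over $k$ is an essentially small $k$-linear abelian symmetric monoidal category $(\mathcal C,\otimes,\mathbb 1)$ with $k$-bilinear tensor product such that $k\to\mathrm{End}(\mathbb 1)$ is an isomorphism, every object has a monoidal dual, and every object has finite length. A *tensor functor* is a $k$-linear exact (strong) symmetric monoidal functor. A pretannakian category $\mathcal C$ is *MN* (maximally nilpotent) if 1. for every simple object $L\not\cong\mathbb 1$ of $\mathcal C$ there is $n\in\mathbb N$ with $\mathrm{Sym}^nL=0$, and 2. for every non-split monomorphism $\alpha:\mathbb 1\hookrightarrow X$ in $\mathcal C$ there is $n\in\mathbb N$ such that $\alpha^n:=\mathrm{Sym}^n(\alpha):\mathbb 1\to\mathrm{Sym}^nX$ is zero. Here $\mathrm{Sym}^nX$ denotes the coinvariants of the symmetric group $S_n$ acting on $X^{\otimes n}$. Let $A$ be a commutative algebra in the ind-completion $\mathrm{Ind}\,\mathcal C$, with its induced tensor product. An *ideal* of $A$ is a subobject $I\subset A$ with $IA\subset I$. An ideal $\mathfrak p\neq A$ is *prime* if for all subobjects $X,Y\subset A$ that belong to $\mathcal C$, $XY\subset\mathfrak p$ implies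 $X\subset\mathfrak p$ or $Y\subset\mathfrak p$. An algebra is *simple* if it has precisely two ideals, $0$ and itself. A prime ideal of $A$ is *visible* if it is the kernel of an algebra morphism $A\to S$ to a simple commutative algebra $S$ in $\mathrm{Ind}\,\mathcal C$. For a tensor functor $F:\mathcal C\to\mathcal D$ of pretannakian categories over $k$, denote by $F_*:\mathrm{Ind}\,\mathcal D\to\mathrm{Ind}\,\mathcal C$ the right adjoint of the extension $\mathrm{Ind}\,\mathcal C\to\mathrm{Ind}\,\mathcal D$ of $F$ that preserves filtered colimits. **Theorem.** Let $\mathcal C$ be a pretannakian category over $k$. Every prime ideal of every commutative algebra in $\mathrm{Ind}\,\mathcal C$ is visible whenever one of the following assumptions is satisfied: 1. $\mathcal C$ is MN; 2. there exists a tensor functor $F:\mathcal C\to\mathcal D$ to a semisimple MN pretannakian category $\mathcal D$ over $k$; 3. there exists a tensor functor $F:\mathcal C\to\mathcal D$ to an MN pretannakian category $\mathcal D$ over $k$ for which $F_*$ is faithful and exact. -/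

import Mathlib

open CategoryTheory Limits MonoidalCategory Opposite
open scoped MonoidalCategory.ExternalProduct

universe w v u u₁ u₂

noncomputable section

namespace TensorCat

/-! ## The symmetric monoidal structure on ind-objects

For an essentially small symmetric monoidal category `C`, the category `Ind C` of ind-objects,
a full subcategory of the category of presheaves on `C`, is closed under Day convolution:
`colim X_i ⊗ colim Y_j = colim (X_i ⊗ Y_j)` for filtered colimits of representables. This is
the usual tensor product of ind-objects. -/
variable {C : Type u} [Category.{v} C]

section Presentation
variable {A : Cᵒᵖ ⥤ Type v} (P : IndObjectPresentation A)

/-- The element of the presheaf given by the `i`-th leg of a presentation. -/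
def elt (i : P.I) : A.obj (op (P.F.obj i)) := yonedaEquiv (P.ι.app i)

theorem elt_map {i j : P.I} (f : i ⟶ j) : A.map (P.F.map f).op (elt P j) = elt P i := by
  unfold elt
  rw [yonedaEquiv_naturality]
  congr 1
  simpa using P.ι.naturality f

theorem hom_ext {H : Cᵒᵖ ⥤ Type v} {f g : A ⟶ H}
    (h : ∀ i, f.app _ (elt P i) = g.app _ (elt P i)) : f = g :=
  P.isColimit.hom_ext fun i => yonedaEquiv.injective (h i)

/-- Compatible families of elements define morphisms out of an ind-object. -/
theorem exists_desc {H : Cᵒᵖ ⥤ Type v} (h : ∀ i, H.obj (op (P.F.obj i)))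
    (hh : ∀ {i j : P.I} (f : i ⟶ j), H.map (P.F.map f).op (h j) = h i) :
    ∃ f : A ⟶ H, ∀ i, f.app _ (elt P i) = h i := by
  let s : Cocone (P.F ⋙ yoneda) :=
    { pt := H
      ι :=
        { app i := yonedaEquiv.symm (h i)
          naturality i j f := by
            have := yonedaEquiv_symm_naturality_left (P.F.map f) H (h j)
            simpa [hh f] using this } }
  refine ⟨P.isColimit.desc s, fun i => ?_⟩
  have := congrArg yonedaEquiv (P.isColimit.fac s i)
  rw [yonedaEquiv_comp] at this
  simpa [s] using! this

end Presentation

theorem essImage_inclusion {A : Cᵒᵖ ⥤ Type v} (h : IsIndObject A) :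
    (Ind.inclusion C).essImage A :=
  ⟨(Ind.equivalence C).inverse.obj ⟨A, h⟩,
    ⟨(ObjectProperty.ι _).mapIso ((Ind.equivalence C).counitIso.app ⟨A, h⟩)⟩⟩

variable [MonoidalCategory C]

section
variable {A B : Cᵒᵖ ⥤ Type v} (P : IndObjectPresentation A) (Q : IndObjectPresentation B)
  {H : Cᵒᵖ ⥤ Type v}

theorem congr_app {D : Type*} [Category* D] {F G : D ⥤ Type v} {f g : F ⟶ G} (h : f = g)
    (a : D) (x : F.obj a) : f.app a x = g.app a x := by rw [h]

/-- A pair of elements of two presheaves, as an element of their external product. -/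
def pair {a b : Cᵒᵖ} (x : A.obj a) (y : B.obj b) : (A ⊠ B).obj (a, b) := (x, y)

theorem naturality₂ (φ : A ⊠ B ⟶ tensor Cᵒᵖ ⋙ H) {a a' b b' : Cᵒᵖ} (f : a ⟶ a') (g : b ⟶ b')
    (x : A.obj a) (y : B.obj b) :
    φ.app (a', b') (pair (A.map f x) (B.map g y)) =
      H.map (f ⊗ₘ g) (φ.app (a, b) (pair x y)) :=
  NatTrans.naturality_apply φ (X := (a, b)) (Y := (a', b')) (Prod.mkHom f g) (pair x y)


/-- Fix the second argument of a transformation in two variables. -/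
def fixRight (φ : A ⊠ B ⟶ tensor Cᵒᵖ ⋙ H) (b : Cᵒᵖ) (y : B.obj b) :
    A ⟶ tensorRight b ⋙ H where
  app a := TypeCat.ofHom fun x => φ.app (a, b) (pair x y)
  naturality a a' f := by
    ext x
    have := naturality₂ φ f (𝟙 b) x y
    rw [Functor.map_id_apply, tensorHom_id] at this
    exact this

/-- Fix the first argument of a transformation in two variables. -/
def fixLeft (φ : A ⊠ B ⟶ tensor Cᵒᵖ ⋙ H) (a : Cᵒᵖ) (x : A.obj a) :
    B ⟶ tensorLeft a ⋙ H where
  app b := TypeCat.ofHom fun y => φ.app (a, b) (pair x y)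
  naturality b b' f := by
    ext y
    have := naturality₂ φ (𝟙 a) f x y
    rw [Functor.map_id_apply, id_tensorHom] at this
    exact this

theorem hom_ext₂ {φ ψ : A ⊠ B ⟶ tensor Cᵒᵖ ⋙ H}
    (h : ∀ i j, φ.app (op (P.F.obj i), op (Q.F.obj j)) (pair (elt P i) (elt Q j)) =
      ψ.app (op (P.F.obj i), op (Q.F.obj j)) (pair (elt P i) (elt Q j))) : φ = ψ := by
  have h₁ : ∀ j, fixRight φ _ (elt Q j) = fixRight ψ _ (elt Q j) :=
    fun j => hom_ext P fun i => h i j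
  have h₂ : ∀ a x, fixLeft φ a x = fixLeft ψ a x := fun a x => hom_ext Q fun j =>
    congr_app (h₁ j) a x
  ext ⟨a, b⟩ ⟨x, y⟩
  exact congr_app (h₂ a x) b y

theorem exists_desc₂ (h : ∀ i j, H.obj (op (P.F.obj i) ⊗ op (Q.F.obj j)))
    (h₁ : ∀ {i i' : P.I} (f : i ⟶ i') (j : Q.I),
      H.map ((P.F.map f).op ▷ op (Q.F.obj j)) (h i' j) = h i j)
    (h₂ : ∀ (i : P.I) {j j' : Q.I} (f : j ⟶ j'),
      H.map (op (P.F.obj i) ◁ (Q.F.map f).op) (h i j') = h i j) :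
    ∃ φ : A ⊠ B ⟶ tensor Cᵒᵖ ⋙ H,
      ∀ i j, φ.app (op (P.F.obj i), op (Q.F.obj j)) (pair (elt P i) (elt Q j)) = h i j := by
  choose α hα using fun j : Q.I =>
    exists_desc P (H := tensorRight (op (Q.F.obj j)) ⋙ H) (fun i => h i j) (fun f => h₁ f j)
  have hα' : ∀ {j j' : Q.I} (f : j ⟶ j') (a : Cᵒᵖ) (x : A.obj a),
      H.map (a ◁ (Q.F.map f).op) ((α j').app a x) = (α j).app a x := by
    intro j j' f a x
    let τ : tensorRight (op (Q.F.obj j')) ⋙ H ⟶ tensorRight (op (Q.F.obj j)) ⋙ H :=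
      Functor.whiskerRight ((curriedTensor Cᵒᵖ).flip.map (Q.F.map f).op) H
    have : α j' ≫ τ = α j := hom_ext P fun i => by
      have := h₂ i f
      rw [← hα, ← hα] at this
      exact this
    exact congr_app this a x
  choose β hβ using fun (a : Cᵒᵖ) (x : A.obj a) =>
    exists_desc Q (H := tensorLeft a ⋙ H) (fun j => (α j).app a x) (fun f => hα' f a x)
  have hβ' : ∀ {a a' : Cᵒᵖ} (f : a ⟶ a') (x : A.obj a) (b : Cᵒᵖ) (y : B.obj b),
      H.map (f ▷ b) ((β a x).app b y) = (β a' (A.map f x)).app b y := by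
    intro a a' f x b y
    let τ : tensorLeft a ⋙ H ⟶ tensorLeft a' ⋙ H :=
      Functor.whiskerRight ((curriedTensor Cᵒᵖ).map f) H
    have : β a x ≫ τ = β a' (A.map f x) := hom_ext Q fun j => by
      have := ConcreteCategory.congr_hom ((α j).naturality f) x
      rw [hβ]
      change τ.app _ ((β a x).app _ (elt Q j)) = _
      rw [hβ]
      exact this.symm
    exact congr_app this b y
  refine ⟨{ app := fun p => TypeCat.ofHom fun z => (β p.1 z.1).app p.2 z.2
            naturality := ?_ }, fun i j => ?_⟩
  · rintro ⟨a, b⟩ ⟨a', b'⟩ ⟨f, g⟩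
    ext ⟨x, y⟩
    change (β a' (A.map f x)).app b' (B.map g y) = H.map (f ⊗ₘ g) ((β a x).app b y)
    rw [← hβ']
    have := ConcreteCategory.congr_hom ((β a x).naturality g) y
    rw [tensorHom_def', Functor.map_comp]
    exact congrArg (H.map (f ▷ b')) this
  · change (β _ (elt P i)).app _ (elt Q j) = _
    rw [hβ, hα]

end

/-- The Day convolution of two ind-objects is an ind-object. -/
theorem isIndObject_of_isLeftKanExtension {A B E : Cᵒᵖ ⥤ Type v} (hA : IsIndObject A)
    (hB : IsIndObject B) (η : A ⊠ B ⟶ tensor Cᵒᵖ ⋙ E) [E.IsLeftKanExtension η] :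
    IsIndObject E := by
  obtain ⟨⟨P⟩⟩ := hA
  obtain ⟨⟨Q⟩⟩ := hB
  let z (i : P.I) (j : Q.I) : E.obj (op (P.F.obj i) ⊗ op (Q.F.obj j)) :=
    η.app (op (P.F.obj i), op (Q.F.obj j)) (pair (elt P i) (elt Q j))
  have hz {i i' : P.I} {j j' : Q.I} (f : i ⟶ i') (g : j ⟶ j') :
      E.map ((P.F.map f).op ⊗ₘ (Q.F.map g).op) (z i' j') = z i j := by
    have := naturality₂ η (P.F.map f).op (Q.F.map g).op (elt P i') (elt Q j')
    rw [elt_map, elt_map] at this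
    exact this.symm
  have nat {H : Cᵒᵖ ⥤ Type v} (s : Cocone ((P.F.prod Q.F ⋙ tensor C) ⋙ yoneda))
      {p q : P.I × Q.I} (f : p ⟶ q) :
      s.pt.map ((P.F.map f.1).op ⊗ₘ (Q.F.map f.2).op) (yonedaEquiv (s.ι.app q)) =
        yonedaEquiv (s.ι.app p) := by
    have h := yonedaEquiv_naturality (s.ι.app q) ((P.F.prod Q.F ⋙ tensor C).map f)
    refine Eq.trans h ?_
    congr 1
    simpa using s.ι.naturality f
  refine ⟨⟨{ I := P.I × Q.I, F := P.F.prod Q.F ⋙ tensor C,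
             ι := { app := fun p => yonedaEquiv.symm (z p.1 p.2), naturality := ?_ },
             isColimit := ?_ }⟩⟩
  · intro p q f
    have := yonedaEquiv_symm_naturality_left ((P.F.prod Q.F ⋙ tensor C).map f) E (z q.1 q.2)
    refine Eq.trans this ?_
    have h := hz f.1 f.2
    refine Eq.trans ?_ (Category.comp_id _).symm
    exact congrArg yonedaEquiv.symm h
  · have key (s : Cocone ((P.F.prod Q.F ⋙ tensor C) ⋙ yoneda)) :
        ∃ m : E ⟶ s.pt, ∀ i j, m.app _ (z i j) = yonedaEquiv (s.ι.app (i, j)) := by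
      obtain ⟨φ, hφ⟩ := exists_desc₂ P Q (H := s.pt) (fun i j => yonedaEquiv (s.ι.app (i, j)))
        (fun {i i'} f j => by
          have := nat (H := s.pt) s (p := (i, j)) (q := (i', j)) (Prod.mkHom f (𝟙 j))
          simpa using! this)
        (fun i {j j'} f => by
          have := nat (H := s.pt) s (p := (i, j)) (q := (i, j')) (Prod.mkHom (𝟙 i) f)
          simpa using! this)
      refine ⟨E.descOfIsLeftKanExtension η s.pt φ, fun i j => ?_⟩
      have := ConcreteCategory.congr_hom (E.descOfIsLeftKanExtension_fac_app η s.pt φ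
        (op (P.F.obj i), op (Q.F.obj j))) (pair (elt P i) (elt Q j))
      exact this.trans (hφ i j)
    choose m hm using key
    refine { desc := m, fac := fun s p => ?_, uniq := fun s n hn => ?_ }
    · apply yonedaEquiv.injective
      rw [yonedaEquiv_comp]
      simpa using hm s p.1 p.2
    · apply E.hom_ext_of_isLeftKanExtension η
      refine hom_ext₂ P Q fun i j => ?_
      have h := congrArg yonedaEquiv (hn (i, j))
      rw [yonedaEquiv_comp] at h
      change n.app _ (z i j) = (m s).app _ (z i j)
      rw [hm]
      simpa using! h

section Monoidal
variable [EssentiallySmall.{v} C]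

instance (D : Type*) [Category* D] [EssentiallySmall.{v} D] :
    EssentiallySmall.{v} (Cᵒᵖ × D) :=
  EssentiallySmall.mk' ((equivSmallModel.{v} Cᵒᵖ).prod (equivSmallModel.{v} D))

instance (F : Cᵒᵖ × Cᵒᵖ ⥤ Type v) : (tensor Cᵒᵖ).HasPointwiseLeftKanExtension F :=
  fun d => (hasColimitsOfShape_of_essentiallySmall.{v} (CostructuredArrow (tensor Cᵒᵖ) d)
    (Type v)).has_colimit _

theorem tensor_mem (X Y : Ind C) : (Ind.inclusion C).essImage
    ((tensor Cᵒᵖ).pointwiseLeftKanExtension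
      ((Ind.inclusion C).obj X ⊠ (Ind.inclusion C).obj Y)) :=
  essImage_inclusion <| isIndObject_of_isLeftKanExtension X.isIndObject_inclusion_obj
    Y.isIndObject_inclusion_obj ((tensor Cᵒᵖ).pointwiseLeftKanExtensionUnit _)

/-- The unit for Day convolution is represented by the tensor unit. -/
theorem unit_mem : (Ind.inclusion C).essImage
    ((Functor.fromPUnit.{0} (𝟙_ Cᵒᵖ)).pointwiseLeftKanExtension
      (Functor.fromPUnit.{0} (𝟙_ (Type v)))) := by
  set L := Functor.fromPUnit.{0} (𝟙_ Cᵒᵖ)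
  set F := Functor.fromPUnit.{0} (𝟙_ (Type v))
  set E := L.pointwiseLeftKanExtension F
  let ν : F ⟶ L ⋙ E := L.pointwiseLeftKanExtensionUnit F
  let z : E.obj (op (𝟙_ C)) := ν.app ⟨PUnit.unit⟩ PUnit.unit
  let g : E ⟶ yoneda.obj (𝟙_ C) := E.descOfIsLeftKanExtension ν _
    { app _ := TypeCat.ofHom fun _ => 𝟙 (𝟙_ C) }
  have hg : g.app _ z = 𝟙 (𝟙_ C) :=
    ConcreteCategory.congr_hom (E.descOfIsLeftKanExtension_fac_app ν (yoneda.obj (𝟙_ C))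
      { app _ := TypeCat.ofHom fun _ => 𝟙 (𝟙_ C) } ⟨PUnit.unit⟩) PUnit.unit
  let e : yoneda.obj (𝟙_ C) ≅ E :=
    { hom := yonedaEquiv.symm z
      inv := g
      hom_inv_id := by
        apply yonedaEquiv.injective
        rw [yonedaEquiv_comp, Equiv.apply_symm_apply]
        exact hg
      inv_hom_id := by
        apply E.hom_ext_of_isLeftKanExtension ν
        ext ⟨⟨⟩⟩ ⟨⟩
        change (yonedaEquiv.symm z).app _ (g.app _ z) = z
        rw [hg]
        exact Functor.map_id_apply E _ z }
  exact essImage_inclusion (ObjectProperty.prop_of_iso _ e (isIndObject_yoneda (𝟙_ C)))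

instance (T : Type v) : (tensorRight T).IsLeftAdjoint :=
  Functor.isLeftAdjoint_of_iso (BraidedCategory.tensorLeftIsoTensorRight T)

/-- The tensor product of ind-objects is Day convolution. -/
instance : MonoidalCategory (Ind C) :=
  monoidalOfHasDayConvolutions (Ind.inclusion C) Ind.inclusion.fullyFaithful tensor_mem unit_mem

instance : LawfulDayConvolutionMonoidalCategoryStruct Cᵒᵖ (Type v) (Ind C) :=
  lawfulDayConvolutionMonoidalCategoryStructOfHasDayConvolutions (Ind.inclusion C)
    Ind.inclusion.fullyFaithful tensor_mem unit_mem

end Monoidal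

section Symmetric
variable [EssentiallySmall.{v} C]
open LawfulDayConvolutionMonoidalCategoryStruct
attribute [local instance] convolution convolution₂ convolution₂'

theorem incl_whiskerLeft (X : Ind C) {Y Z : Ind C} (f : Y ⟶ Z) :
    (ι Cᵒᵖ (Type v) (Ind C)).map (X ◁ f) =
      DayConvolution.map (𝟙 ((ι Cᵒᵖ (Type v) (Ind C)).obj X)) ((ι Cᵒᵖ (Type v) (Ind C)).map f) := by
  rw [← id_tensorHom, ι_map_tensorHom_hom_eq_tensorHom, CategoryTheory.Functor.map_id]

theorem incl_whiskerRight (X : Ind C) {Y Z : Ind C} (f : Y ⟶ Z) :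
    (ι Cᵒᵖ (Type v) (Ind C)).map (f ▷ X) =
      DayConvolution.map ((ι Cᵒᵖ (Type v) (Ind C)).map f)
      (𝟙 ((ι Cᵒᵖ (Type v) (Ind C)).obj X)) := by
  rw [← tensorHom_id, ι_map_tensorHom_hom_eq_tensorHom, CategoryTheory.Functor.map_id]

theorem incl_associator_inv (X Y Z : Ind C) :
    (ι Cᵒᵖ (Type v) (Ind C)).map (α_ X Y Z).inv = (DayConvolution.associator
      ((ι Cᵒᵖ (Type v) (Ind C)).obj X) ((ι Cᵒᵖ (Type v) (Ind C)).obj Y)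
      ((ι Cᵒᵖ (Type v) (Ind C)).obj Z)).inv := by
  have h := ι_map_associator_hom_eq_associator_hom Cᵒᵖ (Type v) (Ind C) X Y Z
  rw [← cancel_epi ((ι Cᵒᵖ (Type v) (Ind C)).map (α_ X Y Z).hom), ← Functor.map_comp,
    Iso.hom_inv_id, CategoryTheory.Functor.map_id, h]
  exact (Iso.hom_inv_id _).symm

variable [SymmetricCategory C]

instance : SymmetricCategory Cᵒᵖ where
  symmetry X Y := Quiver.Hom.unop_inj (by simp)

/-- The braiding of the Day convolution of two ind-objects. -/
def braidingAux (X Y : Ind C) : (ι Cᵒᵖ (Type v) (Ind C)).obj (X ⊗ Y) ≅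
    (ι Cᵒᵖ (Type v) (Ind C)).obj (Y ⊗ X) :=
  DayConvolution.braiding ((ι Cᵒᵖ (Type v) (Ind C)).obj X) ((ι Cᵒᵖ (Type v) (Ind C)).obj Y)

/-- The inclusion of ind-objects into presheaves is fully faithful. -/
def ffι : (ι Cᵒᵖ (Type v) (Ind C)).FullyFaithful := Ind.inclusion.fullyFaithful

theorem map_preimage (X Y : Ind C) :
   (ι Cᵒᵖ (Type v) (Ind C)).map (ffι.preimageIso (braidingAux X Y)).hom =
     (DayConvolution.braiding ((ι Cᵒᵖ (Type v) (Ind C)).obj X) ((ι Cᵒᵖ (Type v) (Ind C)).obj Y)).hom := by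
  simp [braidingAux]

/-- The symmetry of the tensor product of ind-objects. -/
instance : SymmetricCategory (Ind C) where
  braiding X Y := ffι.preimageIso (braidingAux X Y)
  braiding_naturality_right X {Y Z} f := by
    apply (ι Cᵒᵖ (Type v) (Ind C)).map_injective
    rw [Functor.map_comp, Functor.map_comp, map_preimage, map_preimage, incl_whiskerLeft,
      incl_whiskerRight]
    exact DayConvolution.braiding_naturality_right _ _
  braiding_naturality_left {X Y} f Z := by
    apply (ι Cᵒᵖ (Type v) (Ind C)).map_injective
    rw [Functor.map_comp, Functor.map_comp, map_preimage, map_preimage, incl_whiskerLeft,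
      incl_whiskerRight]
    exact DayConvolution.braiding_naturality_left _ _
  hexagon_forward X Y Z := by
    apply (ι Cᵒᵖ (Type v) (Ind C)).map_injective
    simp only [Functor.map_comp, map_preimage, incl_whiskerLeft, incl_whiskerRight,
      ι_map_associator_hom_eq_associator_hom]
    exact DayConvolution.hexagon_forward _ _ _
  hexagon_reverse X Y Z := by
    apply (ι Cᵒᵖ (Type v) (Ind C)).map_injective
    simp only [Functor.map_comp, map_preimage, incl_whiskerLeft, incl_whiskerRight,
      incl_associator_inv]
    exact DayConvolution.hexagon_reverse _ _ _
  symmetry X Y := by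
    apply (ι Cᵒᵖ (Type v) (Ind C)).map_injective
    rw [Functor.map_comp, map_preimage, map_preimage, CategoryTheory.Functor.map_id]
    exact DayConvolution.symmetry _ _

end Symmetric
/-! ## The additive structure on ind-objects -/

section Preadditive
variable {C : Type u} [Category.{v} C]

theorem preservesFiniteLimits_of_isIndObject {A : Cᵒᵖ ⥤ Type v} (h : IsIndObject A) :
    PreservesFiniteLimits A := by
  obtain ⟨⟨P⟩⟩ := h
  have hf : PreservesFiniteLimits (P.F ⋙ yoneda).flip :=
    ⟨fun J _ _ => preservesLimitsOfShape_of_evaluation _ _ fun i =>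
      inferInstanceAs (PreservesLimitsOfShape J (yoneda.obj (P.F.obj i)))⟩
  have e : (P.F ⋙ yoneda).flip ⋙ colim ≅ A :=
    (colimitIsoFlipCompColim (P.F ⋙ yoneda)).symm ≪≫
      (colimit.isColimit _).coconePointUniqueUpToIso P.isColimit
  exact preservesFiniteLimits_of_natIso e

variable [Abelian C]

/-- Ind-objects as left exact presheaves. -/
def toLeftExact : Ind C ⥤ LeftExactFunctor Cᵒᵖ (Type v) :=
  ObjectProperty.lift _ (Ind.inclusion C)
    fun X => preservesFiniteLimits_of_isIndObject X.isIndObject_inclusion_obj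

def fullyFaithfulToLeftExact : (toLeftExact (C := C)).FullyFaithful :=
  Functor.FullyFaithful.ofCompFaithful (G := ObjectProperty.ι _) Ind.inclusion.fullyFaithful

attribute [local instance] HasFiniteBiproducts.of_hasFiniteCoproducts in
/-- Addition of morphisms of ind-objects, through the values of ind-objects in abelian groups. -/
instance : Preadditive (Ind C) :=
  .ofFullyFaithful ((fullyFaithfulToLeftExact.comp
    (AddCommGrpCat.leftExactFunctorForgetEquivalence Cᵒᵖ).symm.fullyFaithfulFunctor).comp
      (ObjectProperty.fullyFaithfulι _))

instance : HasFiniteBiproducts (Ind C) := HasFiniteBiproducts.of_hasFiniteCoproducts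

instance : HasZeroObject (Ind C) := hasZeroObject_of_hasFiniteBiproducts _

end Preadditive

/-! ## Pretannakian categories -/

section Pretannakian
attribute [local instance] Abelian.hasFiniteBiproducts

/-- Together with `Abelian C`, `Linear k C`, `SymmetricCategory C` and `EssentiallySmall C`, this
says that `C` is a pretannakian category over the field `k`: the tensor product is bilinear,
`k ⟶ End 𝟙` is bijective, every object has a dual, and every object has finite length. -/
class IsPretannakian (k : Type w) [Field k] (C : Type u) [Category.{v} C] [Abelian C]
    [Linear k C] [MonoidalCategory C] [SymmetricCategory C] : Prop where
  monoidalPreadditive : MonoidalPreadditive C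
  monoidalLinear : MonoidalLinear k C
  bijective_smul_id : Function.Bijective fun a : k => a • 𝟙 (𝟙_ C)
  exists_dual : ∀ X : C, ∃ Y : C, Nonempty (ExactPairing X Y)
  noetherian : ∀ X : C, IsNoetherianObject X
  artinian : ∀ X : C, IsArtinianObject X

/-- Every object is a finite direct sum of simple objects. -/
def IsSemisimple (C : Type u) [Category.{v} C] [Abelian C] : Prop :=
  ∀ X : C, ∃ (n : ℕ) (S : Fin n → C), (∀ i, Simple (S i)) ∧ Nonempty (X ≅ ⨁ S)

end Pretannakian

/-! ## Symmetric powers and maximal nilpotency -/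

section SymmetricPowers
attribute [local instance] Abelian.hasFiniteBiproducts
variable {C : Type u} [Category.{v} C] [Abelian C] [MonoidalCategory C] [SymmetricCategory C]

/-- The `n`-th tensor power of `X`. -/
def tensorPow (X : C) : ℕ → C
  | 0 => 𝟙_ C
  | n + 1 => X ⊗ tensorPow X n

/-- The transposition of the tensor factors `i` and `i + 1` (counted from `0`) of `X ^ ⊗ n`. -/
def transposition (X : C) : (n i : ℕ) → (tensorPow X n ⟶ tensorPow X n)
  | 0, _ => 𝟙 _
  | 1, _ => 𝟙 _
  | n + 2, 0 =>
      (α_ X X (tensorPow X n)).inv ≫ ((β_ X X).hom ▷ tensorPow X n) ≫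
        (α_ X X (tensorPow X n)).hom
  | n + 2, i + 1 => X ◁ transposition X (n + 1) i

/-- The morphism from `n - 1` copies of `X ^ ⊗ n` to `X ^ ⊗ n` with components `1 - s`, for the
`n - 1` adjacent transpositions `s`. -/
def symRel (X : C) (n : ℕ) : (⨁ fun _ : Fin (n - 1) => tensorPow X n) ⟶ tensorPow X n :=
  biproduct.desc fun i : Fin (n - 1) => 𝟙 (tensorPow X n) - transposition X n i

/-- The `n`-th symmetric power of `X`: the coinvariants of the symmetric group on `X ^ ⊗ n`, that
is, the quotient by the images of `1 - s` for the `n - 1` adjacent transpositions `s`. -/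
def symPow (X : C) (n : ℕ) : C :=
  cokernel (symRel X n)

/-- The quotient map from the tensor power to the symmetric power. -/
def symPowπ (X : C) (n : ℕ) : tensorPow X n ⟶ symPow X n :=
  cokernel.π (symRel X n)

/-- The tensor power `𝟙 ≅ 𝟙 ^ ⊗ n ⟶ X ^ ⊗ n` of a morphism `α : 𝟙 ⟶ X`. -/
def unitTensorPow {X : C} (α : 𝟙_ C ⟶ X) : (n : ℕ) → (𝟙_ C ⟶ tensorPow X n)
  | 0 => 𝟙 _
  | n + 1 => (λ_ (𝟙_ C)).inv ≫ (α ⊗ₘ unitTensorPow α n)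

/-- The symmetric power `α ^ n : 𝟙 ≅ Sym ^ n 𝟙 ⟶ Sym ^ n X` of a morphism `α : 𝟙 ⟶ X`. -/
def unitSymPow {X : C} (α : 𝟙_ C ⟶ X) (n : ℕ) : 𝟙_ C ⟶ symPow X n :=
  unitTensorPow α n ≫ symPowπ X n

variable (C)

/-- A maximally nilpotent (MN) category: the symmetric algebra of every simple object other than
the unit is finite, and every non-split inclusion of the unit has a vanishing symmetric power. -/
structure IsMN : Prop where
  isZero_symPow : ∀ L : C, Simple L → ¬ Nonempty (L ≅ 𝟙_ C) → ∃ n, IsZero (symPow L n)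
  unitSymPow_eq_zero : ∀ (X : C) (α : 𝟙_ C ⟶ X), Mono α → ¬ IsSplitMono α →
    ∃ n, unitSymPow α n = 0

end SymmetricPowers

/-! ## Commutative algebras in ind-objects, ideals and visibility -/

section Algebras
open scoped MonObj
variable {C : Type u} [Category.{v} C] [EssentiallySmall.{v} C] [Abelian C]
  [MonoidalCategory C] [SymmetricCategory C]

/-- An ideal of a commutative algebra `A`: a subobject `I` with `I A ⊆ I`. -/
def IsIdeal (A : CommMon (Ind C)) (I : Subobject A.X) : Prop :=
  I.Factors ((I.arrow ▷ A.X) ≫ μ[A.X])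

/-- Prime ideals: proper ideals `I` such that for subobjects `X` and `Y` of `A` which belong to
`C`, if `X Y ⊆ I` then `X ⊆ I` or `Y ⊆ I`. -/
structure IsPrimeIdeal (A : CommMon (Ind C)) (I : Subobject A.X) : Prop where
  isIdeal : IsIdeal A I
  ne_top : I ≠ ⊤
  factors_or_factors : ∀ (X Y : C) (i : Ind.yoneda.obj X ⟶ A.X) (j : Ind.yoneda.obj Y ⟶ A.X),
    Mono i → Mono j → I.Factors ((i ⊗ₘ j) ≫ μ[A.X]) → I.Factors i ∨ I.Factors j

/-- A simple algebra has precisely two ideals, zero and itself. -/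
structure IsSimpleAlgebra (S : CommMon (Ind C)) : Prop where
  bot_ne_top : (⊥ : Subobject S.X) ≠ ⊤
  eq_bot_or_eq_top : ∀ I : Subobject S.X, IsIdeal S I → I = ⊥ ∨ I = ⊤

/-- An ideal is visible if it is the kernel of a morphism to a simple algebra. -/
def IsVisible (A : CommMon (Ind C)) (I : Subobject A.X) : Prop :=
  ∃ S : CommMon (Ind C), IsSimpleAlgebra S ∧ ∃ f : A ⟶ S, kernelSubobject f.hom.hom = I

variable (C)

/-- Every prime ideal of every commutative algebra in ind-objects is visible. -/
def AllPrimesVisible : Prop :=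
  ∀ (A : CommMon (Ind C)) (I : Subobject A.X), IsPrimeIdeal A I → IsVisible A I

end Algebras

/-! ## Extension of a functor to ind-objects -/

section Extension
variable {C : Type u₁} [Category.{v} C] [EssentiallySmall.{v} C]
  {D : Type u₂} [Category.{v} D] [Abelian D]

instance (G : C ⥤ Ind D) : (Ind.yoneda (C := C)).HasPointwiseLeftKanExtension G :=
  fun X => (hasColimitsOfShape_of_essentiallySmall.{v} (CostructuredArrow Ind.yoneda X)
    (Ind D)).has_colimit _

/-- The extension of a functor `F : C ⥤ D` to ind-objects, which sends a filtered colimit of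
objects `X i` of `C` to the filtered colimit of the `F X i`. -/
def indMap (F : C ⥤ D) : Ind C ⥤ Ind D :=
  Ind.yoneda.pointwiseLeftKanExtension (F ⋙ Ind.yoneda)

end Extension

end TensorCat

end

universe w' w''

set_option linter.unusedSectionVars false

noncomputable section

namespace TensorCat

/-! The elements `X ⟶ A`, for `X` in `C`, turn a commutative algebra of `Ind C` into an additive lax
symmetric monoidal presheaf on `C`. A prime ideal of the algebra gives a prime ideal of this
presheaf, closed under descent along epimorphisms. The quotient presheaf `B` is then separated
(restriction along epimorphisms is injective) and integral (products of nonzero elements are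
nonzero). Visibility follows once `B` embeds into the presheaf of a simple algebra. The target is
the presheaf `X ↦ Hom(F X, 𝟙) ⊗ K` for a field `K` over `k`, which is left exact and hence comes
from an algebra of `Ind C`; morally it is `F_* (𝟙 ⊗ K)`.

The embedding is constructed over the MN category `D`. Let `x` be an element over `X` of a separated
integral presheaf, and let `Y` be the quotient of `X` by the largest subobject on which `x`
vanishes. If a simple subobject of `Y` were not the unit, or were a non-split copy of it, then the
restriction of `x` to its preimage would be nonzero with a vanishing power, against integrality
(`exists_comp_ne_zero`). So linear forms `Y ⟶ 𝟙` detect every simple subobject, and by the chain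
condition finitely many of them are jointly monic (`exists_linearForms`). Hence `x` depends only on
finitely many linear forms `φ i` on `X`, and `x = ∑ φ i ⊗ c i` with unique coefficients `c i` in a
field of fractions (`exists_expansion`, `exists_isInjective_hom_baseChange`).

To pass from `C` to `D`, `B` is extended along `F` by a left Kan extension. As `F` is exact and
conservative, `B` still embeds, and Zorn's lemma gives a prime ideal of the extension that avoids
all nonzero elements of `B` (`exists_isPrime_extension`).

Simplicity of the target requires that every epimorphism onto the unit of `D` be dominated by the
image under `F` of an epimorphism onto the unit of `C`. Given a nonzero `∑ φ i ⊗ z i` with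
independent `φ i`, duality then supplies a multiple that restricts to `1` along an epimorphism onto
the unit (`exists_map_mul_eq_map_one`). The domination property is immediate when `F` is the
identity, follows from splitting when `D` is semisimple, and follows from right exactness of `F_*`
in the last case. -/

/-! ## Lax symmetric monoidal presheaves of abelian groups -/

/-- An additive lax symmetric monoidal presheaf of abelian groups. -/
structure LaxAlgebra (C : Type u) [Category.{v} C] [Preadditive C] [MonoidalCategory C]
    [SymmetricCategory C] where
  obj : C → Type w
  [grp : ∀ X, AddCommGroup (obj X)]
  map {X Y : C} : (X ⟶ Y) → (obj Y →+ obj X)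
  protected map_id (X : C) (x : obj X) : map (𝟙 X) x = x
  protected map_comp {X Y Z : C} (f : X ⟶ Y) (g : Y ⟶ Z) (x : obj Z) : map (f ≫ g) x = map f (map g x)
  map_add_hom {X Y : C} (f g : X ⟶ Y) (x : obj Y) : map (f + g) x = map f x + map g x
  mul {X Y : C} : obj X →+ obj Y →+ obj (X ⊗ Y)
  protected map_mul {X X' Y Y' : C} (f : X ⟶ X') (g : Y ⟶ Y') (x : obj X') (y : obj Y') :
    map (f ⊗ₘ g) (mul x y) = mul (map f x) (map g y)
  one : obj (𝟙_ C)
  protected one_mul {X : C} (x : obj X) : mul one x = map (λ_ X).hom x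
  protected mul_assoc {X Y Z : C} (x : obj X) (y : obj Y) (z : obj Z) :
    mul (mul x y) z = map (α_ X Y Z).hom (mul x (mul y z))
  protected mul_comm {X Y : C} (x : obj X) (y : obj Y) : mul x y = map (β_ X Y).hom (mul y x)

attribute [instance] LaxAlgebra.grp

namespace LaxAlgebra

section Basic

variable {C : Type u} [Category.{v} C] [Preadditive C] [MonoidalCategory C]
  [SymmetricCategory C] (A : LaxAlgebra.{w} C)

theorem map_zero_hom {X Y : C} (x : A.obj Y) : A.map (0 : X ⟶ Y) x = 0 := by
  have := A.map_add_hom (0 : X ⟶ Y) 0 x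
  simpa using this

theorem map_neg_hom {X Y : C} (f : X ⟶ Y) (x : A.obj Y) : A.map (-f) x = -A.map f x := by
  have := A.map_add_hom f (-f) x
  rw [add_neg_cancel, map_zero_hom] at this
  exact eq_neg_of_add_eq_zero_right this.symm

theorem map_sub_hom {X Y : C} (f g : X ⟶ Y) (x : A.obj Y) :
    A.map (f - g) x = A.map f x - A.map g x := by
  rw [sub_eq_add_neg, A.map_add_hom, map_neg_hom, sub_eq_add_neg]

theorem map_sum_hom {X Y : C} {ι : Type*} (s : Finset ι) (f : ι → (X ⟶ Y)) (x : A.obj Y) :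
    A.map (∑ i ∈ s, f i) x = ∑ i ∈ s, A.map (f i) x := by
  classical
  induction s using Finset.induction_on with
  | empty => simp [map_zero_hom]
  | insert a s ha ih => rw [Finset.sum_insert ha, Finset.sum_insert ha, A.map_add_hom, ih]

theorem map_whiskerRight {X X' : C} (f : X ⟶ X') (Y : C) (x : A.obj X') (y : A.obj Y) :
    A.map (f ▷ Y) (A.mul x y) = A.mul (A.map f x) y := by
  rw [← tensorHom_id, A.map_mul, A.map_id]

theorem map_whiskerLeft {Y Y' : C} (X : C) (f : Y ⟶ Y') (x : A.obj X) (y : A.obj Y') :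
    A.map (X ◁ f) (A.mul x y) = A.mul x (A.map f y) := by
  rw [← id_tensorHom, A.map_mul, A.map_id]

protected theorem mul_one {X : C} (x : A.obj X) : A.mul x A.one = A.map (ρ_ X).hom x := by
  rw [A.mul_comm, A.one_mul, ← A.map_comp, braiding_leftUnitor]

theorem mul_assoc' {X Y Z : C} (x : A.obj X) (y : A.obj Y) (z : A.obj Z) :
    A.mul x (A.mul y z) = A.map (α_ X Y Z).inv (A.mul (A.mul x y) z) := by
  rw [A.mul_assoc, ← A.map_comp, Iso.inv_hom_id, A.map_id]

/-- Factors over different objects commute only up to restriction along the symmetry. Used in both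
directions, this interchange brings two chosen factors together, so that a relation between them can
be applied. -/
protected theorem mul_mul_mul_comm {X Y Z W : C} (x : A.obj X) (y : A.obj Y) (z : A.obj Z) (w : A.obj W) :
    A.mul (A.mul x y) (A.mul z w) =
      A.map (tensorμ X Y Z W) (A.mul (A.mul x z) (A.mul y w)) := by
  rw [tensorμ, A.map_comp, A.map_comp, A.map_comp, A.map_comp, ← A.mul_assoc', map_whiskerLeft,
    ← A.mul_assoc, map_whiskerLeft, map_whiskerRight, ← A.mul_comm, map_whiskerLeft,
    ← A.mul_assoc', ← A.mul_assoc]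

protected theorem mul_right_comm {X Y Z : C} (x : A.obj X) (y : A.obj Y) (z : A.obj Z) :
    A.mul (A.mul x y) z =
      A.map ((α_ X Y Z).hom ≫ X ◁ (β_ Y Z).hom ≫ (α_ X Z Y).inv) (A.mul (A.mul x z) y) := by
  rw [A.map_comp, A.map_comp, ← A.mul_assoc', map_whiskerLeft, ← A.mul_comm, ← A.mul_assoc]

theorem map_injective_of_isIso {X Y : C} (f : X ⟶ Y) [IsIso f] :
    Function.Injective (A.map f) := by
  intro x y h
  have := congrArg (A.map (inv f)) h
  rwa [← A.map_comp, ← A.map_comp, IsIso.inv_hom_id, A.map_id, A.map_id] at this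

/-- Restriction along an epimorphism is injective. -/
def IsSeparated : Prop :=
  ∀ ⦃X Y : C⦄ (f : X ⟶ Y), Epi f → ∀ x : A.obj Y, A.map f x = 0 → x = 0

/-- The unit is nonzero and products of nonzero elements are nonzero. -/
class IsIntegral : Prop where
  one_ne_zero : A.one ≠ 0
  mul_ne_zero {X Y : C} {x : A.obj X} {y : A.obj Y} : x ≠ 0 → y ≠ 0 → A.mul x y ≠ 0

/-- Natural transformations of lax algebras. -/
structure Hom (A : LaxAlgebra.{w} C) (B : LaxAlgebra.{w'} C) where
  app (X : C) : A.obj X →+ B.obj X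
  naturality {X Y : C} (f : X ⟶ Y) (x : A.obj Y) : app X (A.map f x) = B.map f (app Y x)
  protected map_mul {X Y : C} (x : A.obj X) (y : A.obj Y) :
    app (X ⊗ Y) (A.mul x y) = B.mul (app X x) (app Y y)
  protected map_one : app (𝟙_ C) A.one = B.one

/-- A morphism of lax algebras all of whose components are injective. -/
def Hom.IsInjective {A : LaxAlgebra.{w} C} {B : LaxAlgebra.{w'} C} (θ : Hom A B) : Prop :=
  ∀ X (x : A.obj X), θ.app X x = 0 → x = 0

/-- The composition of morphisms of lax algebras. -/
def Hom.comp {A : LaxAlgebra.{w} C} {B : LaxAlgebra.{w'} C} {E : LaxAlgebra.{w''} C}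
    (θ : Hom A B) (η : Hom B E) : Hom A E where
  app X := (η.app X).comp (θ.app X)
  naturality f x := by simp [θ.naturality, η.naturality]
  map_mul x y := by simp [θ.map_mul, η.map_mul]
  map_one := by simp [θ.map_one, η.map_one]

/-- Ideals that are closed under descent along epimorphisms. -/
structure Ideal where
  carrier (X : C) : AddSubgroup (A.obj X)
  map_mem {X Y : C} (f : X ⟶ Y) {x : A.obj Y} : x ∈ carrier Y → A.map f x ∈ carrier X
  mul_mem {X Y : C} {x : A.obj X} (y : A.obj Y) : x ∈ carrier X → A.mul x y ∈ carrier (X ⊗ Y)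
  mem_of_epi {X Y : C} (f : X ⟶ Y) [Epi f] {x : A.obj Y} : A.map f x ∈ carrier X → x ∈ carrier Y

namespace Ideal

variable {A} (I : A.Ideal)

@[ext]
theorem ext {I J : A.Ideal} (h : ∀ X, I.carrier X = J.carrier X) : I = J := by
  cases I
  cases J
  congr
  exact funext h

theorem mul_mem_left {X Y : C} (x : A.obj X) {y : A.obj Y} (hy : y ∈ I.carrier Y) :
    A.mul x y ∈ I.carrier (X ⊗ Y) := by
  rw [A.mul_comm]
  exact I.map_mem _ (I.mul_mem x hy)

theorem mem_of_isIso {X Y : C} (f : X ⟶ Y) [IsIso f] {x : A.obj Y}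
    (h : A.map f x ∈ I.carrier X) : x ∈ I.carrier Y :=
  I.mem_of_epi f h

/-- The quotient of a lax algebra by an ideal. -/
def quotient : LaxAlgebra.{w} C where
  obj X := A.obj X ⧸ I.carrier X
  map f := QuotientAddGroup.map _ _ (A.map f) fun _ hx => I.map_mem f hx
  map_id X x := by
    induction x using QuotientAddGroup.induction_on with | H x => exact congrArg _ (A.map_id _ x)
  map_comp f g x := by
    induction x using QuotientAddGroup.induction_on with | H x => exact congrArg _ (A.map_comp f g x)
  map_add_hom f g x := by
    induction x using QuotientAddGroup.induction_on with | H x => exact congrArg _ (A.map_add_hom f g x)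
  mul {X Y} := QuotientAddGroup.lift _
    (AddMonoidHom.mk' (fun x => QuotientAddGroup.map _ _ (A.mul x)
      fun _ hy => I.mul_mem_left x hy) (fun a b => by
        ext y
        exact congrArg QuotientAddGroup.mk (DFunLike.congr_fun ((A.mul (Y := Y)).map_add a b) y)))
    (fun x hx => by
      ext y
      exact (QuotientAddGroup.eq_zero_iff _).2 (I.mul_mem y hx))
  map_mul f g x y := by
    induction x using QuotientAddGroup.induction_on with | H x =>
    induction y using QuotientAddGroup.induction_on with | H y =>
    exact congrArg _ (A.map_mul f g x y)
  one := QuotientAddGroup.mk A.one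
  one_mul x := by
    induction x using QuotientAddGroup.induction_on with | H x =>
    exact congrArg _ (A.one_mul x)
  mul_assoc x y z := by
    induction x using QuotientAddGroup.induction_on with | H x =>
    induction y using QuotientAddGroup.induction_on with | H y =>
    induction z using QuotientAddGroup.induction_on with | H z =>
    exact congrArg _ (A.mul_assoc x y z)
  mul_comm x y := by
    induction x using QuotientAddGroup.induction_on with | H x =>
    induction y using QuotientAddGroup.induction_on with | H y =>
    exact congrArg _ (A.mul_comm x y)

/-- The projection onto the quotient by an ideal. -/
def proj : Hom A I.quotient where
  app X := QuotientAddGroup.mk' (I.carrier X)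
  naturality _ _ := rfl
  map_mul _ _ := rfl
  map_one := rfl

theorem proj_surjective (X : C) : Function.Surjective (I.proj.app X) :=
  QuotientAddGroup.mk'_surjective _

theorem proj_eq_zero_iff {X : C} (x : A.obj X) : I.proj.app X x = 0 ↔ x ∈ I.carrier X :=
  QuotientAddGroup.eq_zero_iff x

/-- This is the purpose of the closure condition `mem_of_epi`: no sheafification of the quotient is
required. -/
theorem isSeparated_quotient : I.quotient.IsSeparated := by
  intro X Y f _ x hx
  obtain ⟨x, rfl⟩ := I.proj_surjective Y x
  rw [← I.proj.naturality, proj_eq_zero_iff] at hx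
  exact (I.proj_eq_zero_iff x).2 (I.mem_of_epi f hx)

/-- Prime ideals of lax algebras. -/
structure IsPrime : Prop where
  one_notMem : A.one ∉ I.carrier (𝟙_ C)
  mem_or_mem {X Y : C} (x : A.obj X) (y : A.obj Y) :
    A.mul x y ∈ I.carrier (X ⊗ Y) → x ∈ I.carrier X ∨ y ∈ I.carrier Y

theorem IsPrime.isIntegral_quotient {I : A.Ideal} (h : I.IsPrime) : I.quotient.IsIntegral where
  one_ne_zero := by
    rw [← I.proj.map_one, Ne, proj_eq_zero_iff]
    exact h.one_notMem
  mul_ne_zero {X Y x y} hx hy := by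
    obtain ⟨x, rfl⟩ := I.proj_surjective X x
    obtain ⟨y, rfl⟩ := I.proj_surjective Y y
    rw [Ne, proj_eq_zero_iff] at hx hy
    rw [← I.proj.map_mul, Ne, proj_eq_zero_iff]
    intro hxy
    exact (h.mem_or_mem x y hxy).elim hx hy

end Ideal

end Basic

end LaxAlgebra

end TensorCat

end
noncomputable section

namespace TensorCat
namespace LaxAlgebra

/-! ### Scalars on the values of a lax algebra. -/

section LinearStructure

variable {k : Type*} [Field k] {C : Type u} [Category.{v} C] [Preadditive C] [Linear k C]
  [MonoidalCategory C] [SymmetricCategory C] (A : LaxAlgebra.{w} C)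

/-- Scalars act on a lax algebra through the endomorphisms of the objects of `C`. -/
instance (X : C) : Module k (A.obj X) where
  smul a x := A.map (a • 𝟙 X) x
  one_smul x := by
    change A.map ((1 : k) • 𝟙 X) x = x
    rw [one_smul, A.map_id]
  mul_smul a b x := by
    change A.map ((a * b) • 𝟙 X) x = A.map (a • 𝟙 X) (A.map (b • 𝟙 X) x)
    rw [← A.map_comp, Linear.smul_comp, Category.id_comp, smul_smul]
  smul_zero a := map_zero _
  smul_add a := map_add _
  add_smul a b x := by
    change A.map ((a + b) • 𝟙 X) x = A.map (a • 𝟙 X) x + A.map (b • 𝟙 X) x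
    rw [add_smul, A.map_add_hom]
  zero_smul x := by
    change A.map ((0 : k) • 𝟙 X) x = 0
    rw [zero_smul, map_zero_hom]

theorem smul_def {X : C} (a : k) (x : A.obj X) : a • x = A.map (a • 𝟙 X) x := rfl

theorem map_smul_hom {X Y : C} (a : k) (f : X ⟶ Y) (x : A.obj Y) :
    A.map (a • f) x = a • A.map f x := by
  rw [smul_def, ← A.map_comp, Linear.smul_comp, Category.id_comp]

protected theorem map_smul {X Y : C} (a : k) (f : X ⟶ Y) (x : A.obj Y) :
    A.map f (a • x) = a • A.map f x := by
  rw [smul_def, ← A.map_comp, Linear.comp_smul, Category.comp_id, map_smul_hom]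

variable [MonoidalPreadditive C] [MonoidalLinear k C]

theorem mul_smul_left {X Y : C} (a : k) (x : A.obj X) (y : A.obj Y) :
    A.mul (a • x) y = a • A.mul x y := by
  rw [smul_def, ← map_whiskerRight, MonoidalLinear.smul_whiskerRight, id_whiskerRight, smul_def]

theorem mul_smul_right {X Y : C} (a : k) (x : A.obj X) (y : A.obj Y) :
    A.mul x (a • y) = a • A.mul x y := by
  rw [smul_def, ← map_whiskerLeft, MonoidalLinear.whiskerLeft_smul, whiskerLeft_id, smul_def]

end LinearStructure

/-! ### The field of fractions of an integral lax algebra. -/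

section Fractions

variable {C : Type u} [Category.{v} C] [Preadditive C] [MonoidalCategory C]
  [SymmetricCategory C] (A : LaxAlgebra.{w} C)

protected theorem mul_ne_zero [A.IsIntegral] {X Y : C} {x : A.obj X} {y : A.obj Y} (hx : x ≠ 0)
    (hy : y ≠ 0) : A.mul x y ≠ 0 := IsIntegral.mul_ne_zero hx hy

theorem eq_of_mul_eq_mul_right [A.IsIntegral] {X Y : C} {x x' : A.obj X} {y : A.obj Y}
    (hy : y ≠ 0) (h : A.mul x y = A.mul x' y) : x = x' := by
  by_contra hx
  refine A.mul_ne_zero (sub_ne_zero.2 hx) hy ?_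
  rw [map_sub, AddMonoidHom.sub_apply, h, sub_self]

/-- Fractions: pairs of elements of the same value of `A` which are proportional, with nonzero
denominator. -/
structure Fraction where
  base : C
  num : A.obj base
  den : A.obj base
  den_ne_zero : den ≠ 0
  comm : A.mul num den = A.mul den num

variable {A} in
/-- Equality of fractions. -/
def Fraction.Rel (a b : A.Fraction) : Prop := A.mul a.num b.den = A.mul a.den b.num

variable {A} in
theorem Fraction.Rel.symm {a b : A.Fraction} (h : a.Rel b) : b.Rel a := by
  unfold Fraction.Rel at *
  rw [A.mul_comm, ← h, ← A.mul_comm]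

variable {A} in
theorem Fraction.Rel.trans [A.IsIntegral] {a b c : A.Fraction} (h₁ : a.Rel b) (h₂ : b.Rel c) :
    a.Rel c := by
  have h₃ := h₂.symm
  unfold Fraction.Rel at *
  -- The square of the middle denominator is cancelled. One copy absorbs `h₁`; then `b.comm`
  -- exchanges the resulting `b.num` with the other copy, so that the second relation applies.
  refine A.eq_of_mul_eq_mul_right (A.mul_ne_zero b.den_ne_zero b.den_ne_zero) ?_
  rw [A.mul_mul_mul_comm, h₁, ← A.mul_mul_mul_comm, b.comm, A.mul_mul_mul_comm, ← h₃,
    ← A.mul_mul_mul_comm]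

/-- The setoid of fractions. -/
def fractionSetoid [A.IsIntegral] : Setoid A.Fraction where
  r := Fraction.Rel
  iseqv := ⟨fun a => a.comm, .symm, .trans⟩

/-- The field of fractions of an integral lax algebra. -/
def FractionField [A.IsIntegral] : Type _ := _root_.Quotient A.fractionSetoid

namespace FractionField

variable {A} [A.IsIntegral]

/-- The class of a fraction. -/
def mk (a : A.Fraction) : A.FractionField := Quotient.mk A.fractionSetoid a

theorem mk_eq_mk {a b : A.Fraction} : mk a = mk b ↔ A.mul a.num b.den = A.mul a.den b.num :=
  Quotient.eq (r := A.fractionSetoid)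

theorem ind {p : A.FractionField → Prop} (h : ∀ a, p (mk a)) (x) : p x :=
  Quotient.ind (s := A.fractionSetoid) h x

/-- The product of two fractions. -/
def mulAux (a b : A.Fraction) : A.Fraction where
  base := a.base ⊗ b.base
  num := A.mul a.num b.num
  den := A.mul a.den b.den
  den_ne_zero := A.mul_ne_zero a.den_ne_zero b.den_ne_zero
  comm := by rw [A.mul_mul_mul_comm, a.comm, b.comm, ← A.mul_mul_mul_comm]

/-- The sum of two fractions. -/
def addAux (a b : A.Fraction) : A.Fraction where
  base := a.base ⊗ b.base
  num := A.mul a.num b.den + A.mul a.den b.num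
  den := A.mul a.den b.den
  den_ne_zero := A.mul_ne_zero a.den_ne_zero b.den_ne_zero
  comm := by
    rw [map_add, map_add, AddMonoidHom.add_apply, A.mul_mul_mul_comm, a.comm, ← A.mul_mul_mul_comm,
      A.mul_mul_mul_comm a.den b.num, b.comm, ← A.mul_mul_mul_comm]

instance : Mul A.FractionField where
  mul := Quotient.map₂ (sa := A.fractionSetoid) (sb := A.fractionSetoid)
    (sc := A.fractionSetoid) mulAux fun a a' ha b b' hb => by
    change A.mul (A.mul a.num b.num) (A.mul a'.den b'.den) =
      A.mul (A.mul a.den b.den) (A.mul a'.num b'.num)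
    rw [A.mul_mul_mul_comm, show A.mul a.num a'.den = _ from ha,
      show A.mul b.num b'.den = _ from hb, ← A.mul_mul_mul_comm]

instance : Add A.FractionField where
  add := Quotient.map₂ (sa := A.fractionSetoid) (sb := A.fractionSetoid)
    (sc := A.fractionSetoid) addAux fun a a' ha b b' hb => by
    change A.mul (A.mul a.num b.den + A.mul a.den b.num) (A.mul a'.den b'.den) =
      A.mul (A.mul a.den b.den) (A.mul a'.num b'.den + A.mul a'.den b'.num)
    rw [map_add, map_add, AddMonoidHom.add_apply, A.mul_mul_mul_comm,
      show A.mul a.num a'.den = _ from ha, ← A.mul_mul_mul_comm, A.mul_mul_mul_comm a.den b.num,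
      show A.mul b.num b'.den = _ from hb, ← A.mul_mul_mul_comm]

/-- The numerators with a given denominator. -/
def numerators {X : C} (d : A.obj X) : AddSubgroup (A.obj X) where
  carrier := {x | A.mul x d = A.mul d x}
  add_mem' {x y} hx hy := by
    change A.mul _ _ = A.mul _ _
    rw [map_add, AddMonoidHom.add_apply, map_add, show A.mul x d = _ from hx,
      show A.mul y d = _ from hy]
  zero_mem' := by
    change A.mul _ _ = A.mul _ _
    simp
  neg_mem' {x} hx := by
    change A.mul _ _ = A.mul _ _
    rw [map_neg, AddMonoidHom.neg_apply, map_neg, show A.mul x d = _ from hx]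

theorem den_mem_numerators {X : C} (d : A.obj X) : d ∈ numerators d := rfl

theorem map_mem_numerators {X Y : C} {d x : A.obj Y} (f : X ⟶ Y) (hx : x ∈ numerators d) :
    A.map f x ∈ numerators (A.map f d) := by
  change A.mul _ _ = A.mul _ _
  rw [← A.map_mul, ← A.map_mul, show A.mul x d = _ from hx]

theorem mul_mem_numerators {X Y : C} {d x : A.obj X} {e y : A.obj Y} (hx : x ∈ numerators d)
    (hy : y ∈ numerators e) : A.mul x y ∈ numerators (A.mul d e) := by
  change A.mul _ _ = A.mul _ _
  rw [A.mul_mul_mul_comm, show A.mul x d = _ from hx, show A.mul y e = _ from hy,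
    ← A.mul_mul_mul_comm]

/-- The fraction with given denominator and numerator. -/
def frac {X : C} {d : A.obj X} (hd : d ≠ 0) (x : numerators d) : A.FractionField :=
  mk ⟨X, x.1, d, hd, x.2⟩

theorem exists_frac (r : A.FractionField) :
    ∃ (X : C) (d : A.obj X) (hd : d ≠ 0) (x : numerators d), frac hd x = r := by
  induction r using ind with | h a => exact ⟨a.base, a.den, a.den_ne_zero, ⟨a.num, a.comm⟩, rfl⟩

theorem frac_eq_frac {X Y : C} {d : A.obj X} (hd : d ≠ 0) (x : numerators d) {e : A.obj Y}
    (he : e ≠ 0) (y : numerators e) : frac hd x = frac he y ↔ A.mul x.1 e = A.mul d y.1 :=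
  mk_eq_mk

theorem frac_congr {X : C} {d d' : A.obj X} (hd : d ≠ 0) (hd' : d' ≠ 0) {x : numerators d}
    {x' : numerators d'} (h : d = d') (h' : x.1 = x'.1) : frac hd x = frac hd' x' := by
  subst h
  rw [Subtype.ext h']

theorem frac_mul_frac {X Y : C} {d : A.obj X} (hd : d ≠ 0) (x : numerators d) {e : A.obj Y}
    (he : e ≠ 0) (y : numerators e) : frac hd x * frac he y =
      frac (A.mul_ne_zero hd he) ⟨_, mul_mem_numerators x.2 y.2⟩ := rfl

theorem frac_mul_den {X Y : C} {d : A.obj X} (hd : d ≠ 0) (x : numerators d) {e : A.obj Y}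
    (he : e ≠ 0) : frac (A.mul_ne_zero hd he) ⟨_, mul_mem_numerators x.2 (den_mem_numerators e)⟩ =
      frac hd x := by
  rw [frac_eq_frac]
  dsimp only
  rw [A.mul_right_comm, show A.mul x.1 d = _ from x.2, ← A.mul_right_comm]

theorem frac_den_mul {X Y : C} {d : A.obj X} (hd : d ≠ 0) (x : numerators d) {e : A.obj Y}
    (he : e ≠ 0) : frac (A.mul_ne_zero he hd) ⟨_, mul_mem_numerators (den_mem_numerators e) x.2⟩ =
      frac hd x := by
  rw [frac_eq_frac]
  dsimp only
  rw [A.mul_assoc, A.mul_assoc, show A.mul x.1 d = _ from x.2]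

/-- A fraction does not see the object over which it is written. This is how symmetries and
associators disappear in the ring axioms. -/
theorem frac_map {X Y : C} (f : X ⟶ Y) {d : A.obj Y} (hd : A.map f d ≠ 0) (hd' : d ≠ 0)
    (x : numerators d) :
    frac hd ⟨_, map_mem_numerators f x.2⟩ = frac hd' x := by
  rw [frac_eq_frac]
  dsimp only
  rw [← map_whiskerRight, ← map_whiskerRight, show A.mul x.1 d = _ from x.2]

theorem frac_add_frac {X : C} {d : A.obj X} (hd : d ≠ 0) (x y : numerators d) :
    frac hd x + frac hd y = frac hd (x + y) := by
  rw [← frac_mul_den hd (x + y) hd]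
  refine frac_congr (x := ⟨A.mul x.1 d + A.mul d y.1, ?_⟩) _ _ rfl ?_
  · exact add_mem (mul_mem_numerators x.2 (den_mem_numerators d))
      (mul_mem_numerators (den_mem_numerators d) y.2)
  · dsimp only
    rw [AddSubgroup.coe_add, map_add, AddMonoidHom.add_apply, show A.mul y.1 d = _ from y.2]

/-- Common denominators: `d ⊗ e` serves for both, after multiplying each numerator by the other
denominator. The axioms of addition then take place in the group `numerators d`. -/
theorem exists_frac₂ (r s : A.FractionField) : ∃ (X : C) (d : A.obj X) (hd : d ≠ 0)
    (x y : numerators d), frac hd x = r ∧ frac hd y = s := by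
  obtain ⟨X, d, hd, x, rfl⟩ := exists_frac r
  obtain ⟨Y, e, he, y, rfl⟩ := exists_frac s
  exact ⟨X ⊗ Y, A.mul d e, A.mul_ne_zero hd he, ⟨_, mul_mem_numerators x.2 (den_mem_numerators e)⟩,
    ⟨_, mul_mem_numerators (den_mem_numerators d) y.2⟩, frac_mul_den hd x he, frac_den_mul he y hd⟩

theorem exists_frac₃ (r s t : A.FractionField) : ∃ (X : C) (d : A.obj X) (hd : d ≠ 0)
    (x y z : numerators d), frac hd x = r ∧ frac hd y = s ∧ frac hd z = t := by
  obtain ⟨X, d, hd, x, y, rfl, rfl⟩ := exists_frac₂ r s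
  obtain ⟨Y, e, he, z, rfl⟩ := exists_frac t
  exact ⟨X ⊗ Y, A.mul d e, A.mul_ne_zero hd he, ⟨_, mul_mem_numerators x.2 (den_mem_numerators e)⟩,
    ⟨_, mul_mem_numerators y.2 (den_mem_numerators e)⟩,
    ⟨_, mul_mem_numerators (den_mem_numerators d) z.2⟩, frac_mul_den hd x he,
    frac_mul_den hd y he, frac_den_mul he z hd⟩

instance : Zero A.FractionField := ⟨frac IsIntegral.one_ne_zero 0⟩

instance : One A.FractionField := ⟨frac IsIntegral.one_ne_zero ⟨A.one, rfl⟩⟩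

theorem frac_eq_zero_iff {X : C} {d : A.obj X} (hd : d ≠ 0) (x : numerators d) :
    frac hd x = 0 ↔ x = 0 := by
  change _ = frac _ _ ↔ _
  rw [frac_eq_frac]
  constructor
  · intro h
    refine Subtype.ext ?_
    by_contra hx
    refine A.mul_ne_zero hx (IsIntegral.one_ne_zero (A := A)) ?_
    simpa using h
  · rintro rfl
    simp

theorem frac_zero {X : C} {d : A.obj X} (hd : d ≠ 0) : frac hd 0 = 0 :=
  (frac_eq_zero_iff hd 0).2 rfl

theorem frac_self {X : C} {d : A.obj X} (hd : d ≠ 0) :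
    frac hd ⟨d, den_mem_numerators d⟩ = 1 := by
  change _ = frac _ _
  rw [frac_eq_frac]

instance : Neg A.FractionField where
  neg := Quotient.map (sa := A.fractionSetoid) (sb := A.fractionSetoid)
    (fun a => ⟨a.base, -a.num, a.den, a.den_ne_zero, by
      rw [map_neg, AddMonoidHom.neg_apply, map_neg, a.comm]⟩) fun a b h => by
        change A.mul (-a.num) b.den = A.mul a.den (-b.num)
        rw [map_neg, AddMonoidHom.neg_apply, map_neg, show A.mul a.num b.den = _ from h]

theorem neg_frac {X : C} {d : A.obj X} (hd : d ≠ 0) (x : numerators d) :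
    -frac hd x = frac hd (-x) := rfl

open Classical in
/-- The inverse of a fraction. -/
def invAux (a : A.Fraction) : A.FractionField :=
  if h : a.num = 0 then 0 else mk ⟨a.base, a.den, a.num, h, a.comm.symm⟩

theorem num_eq_zero_iff {a b : A.Fraction} (h : a.Rel b) : a.num = 0 ↔ b.num = 0 := by
  have h₁ := frac_eq_zero_iff a.den_ne_zero ⟨a.num, a.comm⟩
  have h₂ := frac_eq_zero_iff b.den_ne_zero ⟨b.num, b.comm⟩
  have h₃ : frac a.den_ne_zero ⟨a.num, a.comm⟩ = frac b.den_ne_zero ⟨b.num, b.comm⟩ := mk_eq_mk.2 h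
  rw [h₃, h₂] at h₁
  simpa [Subtype.ext_iff] using h₁.symm

instance : Inv A.FractionField where
  inv := Quotient.lift (s := A.fractionSetoid) invAux fun a b h => by
    have h' : A.mul a.num b.den = A.mul a.den b.num := h
    unfold invAux
    by_cases ha : a.num = 0
    · rw [dif_pos ha, dif_pos ((num_eq_zero_iff h).1 ha)]
    · rw [dif_neg ha, dif_neg (mt (num_eq_zero_iff h).2 ha), mk_eq_mk]
      exact h'.symm

theorem inv_frac {X : C} {d : A.obj X} (hd : d ≠ 0) (x : numerators d) (hx : x.1 ≠ 0) :
    (frac hd x)⁻¹ = frac hx ⟨d, x.2.symm⟩ :=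
  dif_neg hx

theorem frac_mul_frac_comm {X Y : C} {d : A.obj X} (hd : d ≠ 0) (x : numerators d) {e : A.obj Y}
    (he : e ≠ 0) (y : numerators e) : frac hd x * frac he y = frac he y * frac hd x := by
  have h : A.map (β_ X Y).hom (A.mul e d) ≠ 0 := by
    rw [← A.mul_comm]
    exact A.mul_ne_zero hd he
  rw [frac_mul_frac, frac_mul_frac, ← frac_map (β_ X Y).hom h]
  exact frac_congr _ _ (A.mul_comm _ _) (A.mul_comm _ _)

instance : CommRing A.FractionField where
  add_assoc r s t := by
    obtain ⟨X, d, hd, x, y, z, rfl, rfl, rfl⟩ := exists_frac₃ r s t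
    simp only [frac_add_frac, add_assoc]
  zero_add r := by
    obtain ⟨X, d, hd, x, rfl⟩ := exists_frac r
    rw [← frac_zero hd, frac_add_frac, zero_add]
  add_zero r := by
    obtain ⟨X, d, hd, x, rfl⟩ := exists_frac r
    rw [← frac_zero hd, frac_add_frac, add_zero]
  add_comm r s := by
    obtain ⟨X, d, hd, x, y, rfl, rfl⟩ := exists_frac₂ r s
    rw [frac_add_frac, frac_add_frac, add_comm]
  neg_add_cancel r := by
    obtain ⟨X, d, hd, x, rfl⟩ := exists_frac r
    rw [neg_frac, frac_add_frac, neg_add_cancel, frac_zero]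
  nsmul := nsmulRec
  zsmul := zsmulRec
  mul_comm r s := by
    obtain ⟨X, d, hd, x, rfl⟩ := exists_frac r
    obtain ⟨Y, e, he, y, rfl⟩ := exists_frac s
    exact frac_mul_frac_comm hd x he y
  left_distrib r s t := by
    obtain ⟨X, d, hd, x, rfl⟩ := exists_frac r
    obtain ⟨Y, e, he, y, z, rfl, rfl⟩ := exists_frac₂ s t
    rw [frac_add_frac, frac_mul_frac, frac_mul_frac, frac_mul_frac, frac_add_frac]
    congr 2
    exact map_add _ _ _
  right_distrib s t r := by
    obtain ⟨X, d, hd, x, rfl⟩ := exists_frac r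
    obtain ⟨Y, e, he, y, z, rfl, rfl⟩ := exists_frac₂ s t
    rw [frac_add_frac, frac_mul_frac, frac_mul_frac, frac_mul_frac, frac_add_frac]
    congr 2
    exact DFunLike.congr_fun (map_add _ _ _) _
  zero_mul r := by
    obtain ⟨X, d, hd, x, rfl⟩ := exists_frac r
    rw [← frac_zero hd, frac_mul_frac, frac_zero, frac_eq_zero_iff]
    simp
  mul_zero r := by
    obtain ⟨X, d, hd, x, rfl⟩ := exists_frac r
    rw [← frac_zero hd, frac_mul_frac, frac_zero, frac_eq_zero_iff]
    simp
  mul_assoc r s t := by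
    obtain ⟨X, d, hd, x, rfl⟩ := exists_frac r
    obtain ⟨Y, e, he, y, rfl⟩ := exists_frac s
    obtain ⟨Z, f, hf, z, rfl⟩ := exists_frac t
    simp only [frac_mul_frac]
    have h : A.map (α_ X Y Z).hom (A.mul d (A.mul e f)) ≠ 0 := by
      rw [← A.mul_assoc]
      exact A.mul_ne_zero (A.mul_ne_zero hd he) hf
    rw [← frac_map (α_ X Y Z).hom h]
    exact frac_congr _ _ (A.mul_assoc _ _ _) (A.mul_assoc _ _ _)
  one_mul r := by
    obtain ⟨X, d, hd, x, rfl⟩ := exists_frac r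
    rw [← frac_self hd, frac_mul_frac]
    exact frac_den_mul hd x hd
  mul_one r := by
    obtain ⟨X, d, hd, x, rfl⟩ := exists_frac r
    rw [← frac_self hd, frac_mul_frac]
    exact frac_mul_den hd x hd

instance : Field A.FractionField where
  exists_pair_ne := ⟨1, 0, fun h => (IsIntegral.one_ne_zero (A := A))
    (congrArg Subtype.val ((frac_eq_zero_iff _ _).1 h))⟩
  mul_inv_cancel r hr := by
    obtain ⟨X, d, hd, x, rfl⟩ := exists_frac r
    have hx : x.1 ≠ 0 := fun h => hr ((frac_eq_zero_iff hd x).2 (Subtype.ext h))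
    rw [inv_frac hd x hx, frac_mul_frac, ← frac_self (A.mul_ne_zero hd hx)]
    congr 2
    exact x.2
  inv_zero := dif_pos rfl
  nnqsmul := _
  nnqsmul_def := fun _ _ => rfl
  qsmul := _
  qsmul_def := fun _ _ => rfl

end FractionField

end Fractions

end LaxAlgebra
end TensorCat

end
noncomputable section

namespace TensorCat
namespace LaxAlgebra

section FractionAlgebra

variable {k : Type*} [Field k] {C : Type u} [Category.{v} C] [Preadditive C] [Linear k C]
  [MonoidalCategory C] [SymmetricCategory C] [MonoidalPreadditive C] [MonoidalLinear k C]
  {A : LaxAlgebra.{w} C} [A.IsIntegral]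

open FractionField

theorem smul_mem_numerators {X : C} {d x : A.obj X} (a : k) (hx : x ∈ numerators d) :
    a • x ∈ numerators d := by
  change A.mul _ _ = A.mul _ _
  rw [mul_smul_left, mul_smul_right, show A.mul x d = _ from hx]

variable (k) in
/-- The numerators with a given denominator, as a linear subspace. -/
def numeratorSubmodule {X : C} (d : A.obj X) : Submodule k (A.obj X) where
  __ := numerators d
  smul_mem' a _ hx := smul_mem_numerators a hx

instance : Algebra k A.FractionField where
  smul a r := frac IsIntegral.one_ne_zero ⟨a • A.one, smul_mem_numerators a rfl⟩ * r
  algebraMap :=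
    { toFun a := frac IsIntegral.one_ne_zero ⟨a • A.one, smul_mem_numerators a rfl⟩
      map_one' := by
        refine (frac_congr _ _ rfl ?_).trans (frac_self IsIntegral.one_ne_zero)
        exact one_smul k A.one
      map_zero' := by
        rw [frac_eq_zero_iff]
        exact Subtype.ext (zero_smul k A.one)
      map_mul' a b := by
        rw [frac_mul_frac, frac_eq_frac]
        dsimp only
        rw [mul_smul_left, mul_smul_left, mul_smul_right, mul_smul_right, mul_smul_right, smul_smul]
      map_add' a b := by
        rw [frac_add_frac]
        exact frac_congr _ _ rfl (add_smul a b A.one) }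
  commutes' _ _ := mul_comm _ _
  smul_def' _ _ := rfl

theorem smul_frac {X : C} {d : A.obj X} (hd : d ≠ 0) (x : numerators d) (a : k) :
    a • frac hd x = frac hd ⟨a • x.1, smul_mem_numerators a x.2⟩ := by
  change frac _ _ * frac _ _ = _
  rw [frac_mul_frac, ← frac_den_mul hd ⟨a • x.1, smul_mem_numerators a x.2⟩
    (IsIntegral.one_ne_zero (A := A))]
  refine frac_congr _ _ rfl ?_
  dsimp only
  rw [mul_smul_left, mul_smul_right]

variable (k) in
/-- The fractions with a given denominator, as a linear map. -/
def fracₗ {X : C} {d : A.obj X} (hd : d ≠ 0) : numeratorSubmodule k d →ₗ[k] A.FractionField where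
  toFun x := frac hd ⟨x.1, x.2⟩
  map_add' _ _ := (frac_add_frac hd _ _).symm
  map_smul' a _ := (smul_frac hd _ a).symm

/-- Tensored with a space of linear forms, this injectivity lets equalities of coefficients in the
fraction field be read off on numerators. -/
theorem fracₗ_injective {X : C} {d : A.obj X} (hd : d ≠ 0) :
    Function.Injective (fracₗ k hd) := by
  rw [← LinearMap.ker_eq_bot, LinearMap.ker_eq_bot']
  intro x hx
  exact Subtype.ext (congrArg Subtype.val ((frac_eq_zero_iff hd _).1 hx) :)

end FractionAlgebra

/-! ### Extension of scalars. -/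

section BaseChange

variable (k : Type*) [Field k] {C : Type u} [Category.{v} C] [Preadditive C] [Linear k C]
  [MonoidalCategory C] [SymmetricCategory C] (A : LaxAlgebra.{w} C)

/-- Restriction maps as linear maps. -/
def mapₗ {X Y : C} (f : X ⟶ Y) : A.obj Y →ₗ[k] A.obj X where
  toFun := A.map f
  map_add' := map_add _
  map_smul' a x := A.map_smul a f x

@[simp]
theorem mapₗ_apply {X Y : C} (f : X ⟶ Y) (x : A.obj Y) : A.mapₗ k f x = A.map f x := rfl

/-- Morphisms of lax algebras are linear. -/
theorem Hom.map_smul {A : LaxAlgebra.{w} C} {B : LaxAlgebra.{w'} C} (θ : Hom A B) {X : C} (a : k)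
    (x : A.obj X) : θ.app X (a • x) = a • θ.app X x := by
  rw [smul_def, θ.naturality, smul_def]

variable [MonoidalPreadditive C] [MonoidalLinear k C]

/-- The product as a bilinear map. -/
def mulₗ {X Y : C} : A.obj X →ₗ[k] A.obj Y →ₗ[k] A.obj (X ⊗ Y) :=
  LinearMap.mk₂ k (fun x y => A.mul x y) (fun x y z => by rw [map_add]; rfl)
    (fun a x y => A.mul_smul_left a x y) (fun x y z => map_add _ _ _)
    (fun a x y => A.mul_smul_right a x y)

@[simp]
theorem mulₗ_apply {X Y : C} (x : A.obj X) (y : A.obj Y) : A.mulₗ k x y = A.mul x y := rfl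

variable (K : Type w') [CommRing K] [Algebra k K]

open TensorProduct in
/-- The extension of scalars of a lax algebra. -/
def baseChange : LaxAlgebra.{max w w'} C where
  obj X := A.obj X ⊗[k] K
  map f := ((A.mapₗ k f).rTensor K).toAddMonoidHom
  map_id X x := by
    induction x with
    | zero => simp
    | add x y hx hy => rw [map_add, hx, hy]
    | tmul x r => simp [A.map_id]
  map_comp f g x := by
    induction x with
    | zero => simp
    | add x y hx hy => simp only [map_add, hx, hy]
    | tmul x r => simp [A.map_comp]
  map_add_hom f g x := by
    induction x with
    | zero => simp
    | add x y hx hy => rw [map_add, hx, hy, map_add, map_add]; abel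
    | tmul x r => simp [A.map_add_hom, TensorProduct.add_tmul]
  mul {X Y} := AddMonoidHom.mk' (fun x =>
      (TensorProduct.map₂ (A.mulₗ k (X := X) (Y := Y)) (LinearMap.mul k K) x).toAddMonoidHom)
    fun x y => by ext z; simp
  map_mul f g x y := by
    induction x with
    | zero => simp
    | add x x' hx hx' => simp only [map_add, AddMonoidHom.add_apply, hx, hx']
    | tmul x r =>
      induction y with
      | zero => simp
      | add y y' hy hy' => simp only [map_add, hy, hy']
      | tmul y s => simp [A.map_mul]
  one := A.one ⊗ₜ 1
  one_mul x := by
    induction x with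
    | zero => simp
    | add x y hx hy => simp only [map_add, hx, hy]
    | tmul x r => simp [A.one_mul]
  mul_assoc x y z := by
    induction x with
    | zero => simp
    | add x x' hx hx' => simp only [map_add, AddMonoidHom.add_apply, hx, hx']
    | tmul x r =>
      induction y with
      | zero => simp
      | add y y' hy hy' => simp only [map_add, AddMonoidHom.add_apply, hy, hy']
      | tmul y s =>
        induction z with
        | zero => simp
        | add z z' hz hz' => simp only [map_add, hz, hz']
        | tmul z t => simp [A.mul_assoc, _root_.mul_assoc]
  mul_comm x y := by
    induction x with
    | zero => simp
    | add x x' hx hx' => simp only [map_add, AddMonoidHom.add_apply, hx, hx']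
    | tmul x r =>
      induction y with
      | zero => simp
      | add y y' hy hy' => simp only [map_add, AddMonoidHom.add_apply, hy, hy']
      | tmul y s => simp [← A.mul_comm, _root_.mul_comm]

end BaseChange

/-! ### The algebra of linear forms. -/

section UnitAlgebra

variable (C : Type u) [Category.{v} C] [Preadditive C] [MonoidalCategory C]
  [SymmetricCategory C] [MonoidalPreadditive C]

/-- The lax algebra represented by the unit object. -/
def unitAlgebra : LaxAlgebra.{v} C where
  obj X := X ⟶ 𝟙_ C
  map f := Preadditive.leftComp _ f
  map_id X x := Category.id_comp x
  map_comp f g x := Category.assoc f g x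
  map_add_hom f g x := Preadditive.add_comp _ _ _ f g x
  mul {X Y} := AddMonoidHom.mk' (fun x => AddMonoidHom.mk' (fun y => (x ⊗ₘ y) ≫ (λ_ (𝟙_ C)).hom)
      fun y y' => by rw [MonoidalPreadditive.tensor_add, Preadditive.add_comp]) fun x x' => by
        ext y
        simp [MonoidalPreadditive.add_tensor]
  map_mul f g x y := by
    change (f ⊗ₘ g) ≫ (x ⊗ₘ y) ≫ _ = ((f ≫ x) ⊗ₘ (g ≫ y)) ≫ _
    rw [tensorHom_comp_tensorHom_assoc]
  one := 𝟙 _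
  one_mul {X} x := by
    change (𝟙 _ ⊗ₘ x) ≫ _ = (λ_ X).hom ≫ x
    simp
  mul_assoc {X Y Z} x y z := by
    change (((x ⊗ₘ y) ≫ (λ_ (𝟙_ C)).hom) ⊗ₘ z) ≫ (λ_ (𝟙_ C)).hom =
      (α_ X Y Z).hom ≫ (x ⊗ₘ ((y ⊗ₘ z) ≫ (λ_ (𝟙_ C)).hom)) ≫ (λ_ (𝟙_ C)).hom
    monoidal
  mul_comm {X Y} x y := by
    change (x ⊗ₘ y) ≫ (λ_ (𝟙_ C)).hom = (β_ X Y).hom ≫ (y ⊗ₘ x) ≫ (λ_ (𝟙_ C)).hom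
    rw [← BraidedCategory.braiding_naturality_assoc, braiding_leftUnitor, unitors_equal]

end UnitAlgebra

section Pullback

variable {C : Type u₁} [Category.{v} C] [Preadditive C] [MonoidalCategory C] [SymmetricCategory C]
  {D : Type u₂} [Category.{v} D] [Preadditive D] [MonoidalCategory D] [SymmetricCategory D]
  (F : C ⥤ D) [F.Braided] [F.Additive]

open Functor.LaxMonoidal Functor.OplaxMonoidal Functor.Monoidal

/-- The restriction of a lax algebra along a tensor functor. -/
def restrict (A : LaxAlgebra.{w} D) : LaxAlgebra.{w} C where
  obj X := A.obj (F.obj X)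
  map f := A.map (F.map f)
  map_id X x := by rw [F.map_id, A.map_id]
  map_comp f g x := by rw [F.map_comp, A.map_comp]
  map_add_hom f g x := by rw [F.map_add, A.map_add_hom]
  mul {X Y} := AddMonoidHom.mk' (fun x => (A.map (δ F X Y)).comp (A.mul x)) fun x x' => by
    ext y
    simp
  map_mul {X X' Y Y'} f g x y := by
    change A.map (F.map (f ⊗ₘ g)) (A.map (δ F X' Y') (A.mul x y)) =
      A.map (δ F X Y) (A.mul (A.map (F.map f) x) (A.map (F.map g) y))
    rw [← A.map_mul, ← A.map_comp, ← A.map_comp, δ_natural]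
  one := A.map (η F) A.one
  one_mul {X} x := by
    change A.map (δ F (𝟙_ C) X) (A.mul (A.map (η F) A.one) x) = A.map (F.map (λ_ X).hom) x
    rw [← map_whiskerRight, A.one_mul, ← A.map_comp, ← A.map_comp]
    simp
  mul_assoc {X Y Z} x y z := by
    change A.map (δ F (X ⊗ Y) Z) (A.mul (A.map (δ F X Y) (A.mul x y)) z) =
      A.map (F.map (α_ X Y Z).hom) (A.map (δ F X (Y ⊗ Z)) (A.mul x (A.map (δ F Y Z) (A.mul y z))))
    rw [← map_whiskerRight, ← map_whiskerLeft, A.mul_assoc, ← A.map_comp, ← A.map_comp,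
      ← A.map_comp, ← A.map_comp]
    congr 1
    simp
  mul_comm {X Y} x y := by
    change A.map (δ F X Y) (A.mul x y) = A.map (F.map (β_ X Y).hom) (A.map (δ F Y X) (A.mul y x))
    rw [A.mul_comm, ← A.map_comp, ← A.map_comp, Functor.map_braiding]
    simp

/-- The restriction of a morphism of lax algebras along a tensor functor. -/
def Hom.restrict {A : LaxAlgebra.{w} D} {B : LaxAlgebra.{w'} D} (θ : Hom A B) :
    Hom (A.restrict F) (B.restrict F) where
  app X := θ.app (F.obj X)
  naturality f x := θ.naturality (F.map f) x
  map_mul {X Y} x y := by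
    exact (θ.naturality (δ F X Y) _).trans (congrArg (B.map (δ F X Y)) (θ.map_mul _ _))
  map_one := by
    exact (θ.naturality (η F) _).trans (congrArg (B.map (η F)) θ.map_one)

end Pullback

end LaxAlgebra
end TensorCat

end
noncomputable section

namespace TensorCat

/-! ## Exactness of the tensor product and simplicity of the unit -/

section Duals

/-- Every object has a dual. -/
class HasDuals (C : Type u) [Category.{v} C] [MonoidalCategory C] : Prop where
  exists_dual : ∀ X : C, ∃ Y : C, Nonempty (ExactPairing X Y)

variable {C : Type u} [Category.{v} C] [MonoidalCategory C] [SymmetricCategory C] [HasDuals C]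

/-- By symmetry a dual is two-sided, so tensoring with an object has adjoints on both sides and is
exact. -/
instance (X : C) : (tensorLeft X).IsLeftAdjoint := by
  obtain ⟨Y, ⟨_⟩⟩ := HasDuals.exists_dual X
  have := BraidedCategory.exactPairing_swap X Y
  exact (tensorLeftAdjunction Y X).isLeftAdjoint

instance (X : C) : (tensorLeft X).IsRightAdjoint := by
  obtain ⟨Y, ⟨_⟩⟩ := HasDuals.exists_dual X
  exact (tensorLeftAdjunction X Y).isRightAdjoint

instance (X : C) : (tensorRight X).IsLeftAdjoint :=
  Functor.isLeftAdjoint_of_iso (BraidedCategory.tensorLeftIsoTensorRight X)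

instance (X : C) : (tensorRight X).IsRightAdjoint :=
  Functor.isRightAdjoint_of_iso (BraidedCategory.tensorLeftIsoTensorRight X)

instance (X : C) {Y Z : C} (f : Y ⟶ Z) [Epi f] : Epi (X ◁ f) :=
  inferInstanceAs (Epi ((tensorLeft X).map f))

instance (X : C) {Y Z : C} (f : Y ⟶ Z) [Epi f] : Epi (f ▷ X) :=
  inferInstanceAs (Epi ((tensorRight X).map f))

instance (X : C) {Y Z : C} (f : Y ⟶ Z) [Mono f] : Mono (f ▷ X) :=
  inferInstanceAs (Mono ((tensorRight X).map f))

instance {X X' Y Y' : C} (f : X ⟶ X') (g : Y ⟶ Y') [Epi f] [Epi g] : Epi (f ⊗ₘ g) := by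
  rw [MonoidalCategory.tensorHom_def]
  infer_instance

end Duals

section SimpleUnit

variable {C : Type u} [Category.{v} C] [Abelian C] [MonoidalCategory C] [SymmetricCategory C]
  [HasDuals C] [MonoidalPreadditive C]

/-- If the evaluation vanished, the triangle identity would make the identity of `X` zero. -/
theorem evaluation_ne_zero {X Y : C} [ExactPairing X Y] (hX : ¬ IsZero X) : ε_ X Y ≠ 0 := by
  intro h
  apply hX
  rw [IsZero.iff_id_eq_zero]
  have := ExactPairing.evaluation_coevaluation X Y
  rw [h, MonoidalPreadditive.whiskerLeft_zero, comp_zero, comp_zero] at this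
  rw [← cancel_epi (λ_ X).hom, ← cancel_mono (ρ_ X).inv]
  simpa using this.symm

/-- The composite in the hypothesis is the transpose of `g` under the duality between `U` and `V`.
-/
theorem whiskerLeft_eq_zero {U V Z : C} [ExactPairing U V] (g : V ⟶ Z)
    (h : η_ U V ≫ U ◁ g = 0) : g = 0 := by
  rw [← cancel_epi (ρ_ V).hom, comp_zero]
  apply (tensorLeftHomEquiv _ U V Z).injective
  simp only [tensorLeftHomEquiv, Equiv.coe_fn_mk]
  simp [h]

/-- The unit of a rigid abelian category is simple if its endomorphisms form a field. -/
theorem simple_unit [IsArtinianObject (𝟙_ C)] (h₀ : ¬ IsZero (𝟙_ C))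
    (h₁ : ∀ f : 𝟙_ C ⟶ 𝟙_ C, f ≠ 0 → IsIso f) : Simple (𝟙_ C) := by
  let U : C := simpleSubobject h₀
  let i : U ⟶ 𝟙_ C := simpleSubobjectArrow h₀
  obtain ⟨V, ⟨_⟩⟩ := HasDuals.exists_dual U
  -- The transpose of the inclusion `i` of a simple subobject. The aim is that `i ≫ j` is
  -- invertible, which makes `U` a retract of the unit.
  let j : 𝟙_ C ⟶ V := η_ U V ≫ i ▷ V ≫ (λ_ V).hom
  have hU : ¬ IsZero U := Simple.not_isZero U
  have hj : Epi j := by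
    refine Preadditive.epi_of_cancel_zero _ fun {Z} h hh => whiskerLeft_eq_zero (U := U) h ?_
    have : (η_ U V ≫ U ◁ h) ≫ (i ▷ Z ≫ (λ_ Z).hom) = 0 := by
      rw [Category.assoc, whisker_exchange_assoc, ← hh]
      simp [j]
    rwa [← zero_comp (f := i ▷ Z ≫ (λ_ Z).hom), cancel_mono] at this
  have hj' : j ▷ U ≫ ε_ U V = (λ_ U).hom ≫ i := by
    calc j ▷ U ≫ ε_ U V
      _ = η_ U V ▷ U ≫ (α_ U V U).hom ≫ (i ▷ (V ⊗ U) ≫ 𝟙_ C ◁ ε_ U V) ≫ (λ_ (𝟙_ C)).hom := by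
        simp only [j]
        monoidal
      _ = (η_ U V ▷ U ≫ (α_ U V U).hom ≫ U ◁ ε_ U V) ≫ i ▷ 𝟙_ C ≫ (λ_ (𝟙_ C)).hom := by
        rw [← whisker_exchange]
        simp only [Category.assoc]
      _ = (λ_ U).hom ≫ i := by
        rw [ExactPairing.evaluation_coevaluation]
        monoidal
  have key : (i ≫ j) ▷ U ≫ ε_ U V = i ▷ U ≫ (λ_ U).hom ≫ i := by
    rw [comp_whiskerRight, Category.assoc, hj']
  -- If `U ⊗ U` were zero, so would be `(U ⊗ V) ⊗ U ≅ (V ⊗ U) ⊗ U`, through which the triangle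
  -- identity factors the identity of `U`.
  have hUU : ¬ IsZero (U ⊗ U) := by
    intro h
    apply hU
    rw [IsZero.iff_id_eq_zero]
    have h' : (β_ U V).hom ▷ U = 0 := by
      have : IsZero ((V ⊗ U) ⊗ U) :=
        ((tensorLeft V).map_isZero h).of_iso (α_ V U U)
      exact this.eq_of_tgt _ _
    have h'' : η_ U V ▷ U = 0 := by
      rw [← cancel_mono ((β_ U V).hom ▷ U), zero_comp, h', comp_zero]
    have := ExactPairing.evaluation_coevaluation U V
    rw [h'', zero_comp] at this
    rw [← cancel_epi (λ_ U).hom, ← cancel_mono (ρ_ U).inv]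
    simpa using this.symm
  have hij : i ≫ j ≠ 0 := by
    intro h
    rw [h, MonoidalPreadditive.zero_whiskerRight, zero_comp] at key
    have : (𝟙 (U ⊗ U)) = 0 := by
      rw [← cancel_mono (i ▷ U ≫ (λ_ U).hom ≫ i), zero_comp, Category.id_comp, ← key]
    exact hUU ((IsZero.iff_id_eq_zero _).2 this)
  -- A nonzero monomorphism into a simple object: `U ⊗ U ≅ U` through `i`. Hence `i` becomes
  -- epimorphic after tensoring with `U`, and duality gives that `i ≫ j` is an epimorphism.
  have hiU : IsIso (i ▷ U ≫ (λ_ U).hom) := isIso_of_mono_of_nonzero fun h => hUU <| by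
    rw [IsZero.iff_id_eq_zero, ← cancel_mono (i ▷ U ≫ (λ_ U).hom), h, comp_zero, comp_zero]
  have hUi : Epi (U ◁ i) := by
    have : U ◁ i = (β_ U U).hom ≫ (i ▷ U ≫ (λ_ U).hom) ≫ (ρ_ U).inv := by
      rw [Category.assoc, ← BraidedCategory.braiding_naturality_right_assoc]
      simp
    rw [this]
    infer_instance
  have hm : Mono (i ≫ j) := Preadditive.mono_of_kernel_zero (kernel_zero_of_nonzero_from_simple hij)
  have he : Epi (i ≫ j) := by
    refine Preadditive.epi_of_cancel_zero _ fun {Z} g hg => whiskerLeft_eq_zero (U := U) g ?_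
    have h : U ◁ (i ≫ j) ≫ U ◁ g = 0 := by
      rw [← MonoidalCategory.whiskerLeft_comp, hg, MonoidalPreadditive.whiskerLeft_zero]
    rw [MonoidalCategory.whiskerLeft_comp, Category.assoc] at h
    rw [← Category.assoc] at h
    rw [(cancel_epi (U ◁ i ≫ U ◁ j)).1 (h.trans comp_zero.symm), comp_zero]
  have hiso : IsIso (i ≫ j) := isIso_of_mono_of_epi _
  -- The idempotent of the unit that projects onto `U` is nonzero, hence invertible, so `i` is an
  -- epimorphism as well.
  have hei : IsIso (j ≫ inv (i ≫ j) ≫ i) := h₁ _ fun h => by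
    have : (i ≫ j) ≫ inv (i ≫ j) ≫ i = 0 := by rw [Category.assoc, h, comp_zero]
    rw [IsIso.hom_inv_id_assoc] at this
    exact hij (by rw [this, zero_comp])
  have hi : Epi i := by
    have : Epi ((j ≫ inv (i ≫ j)) ≫ i) := by
      rw [Category.assoc]
      infer_instance
    exact epi_of_epi (j ≫ inv (i ≫ j)) i
  have : IsIso i := isIso_of_mono_of_epi i
  exact Simple.of_iso (asIso i).symm

end SimpleUnit

section LinearForms

variable {k : Type*} [Field k] {C : Type u} [Category.{v} C] [Abelian C] [Linear k C]
  [MonoidalCategory C] [Simple (𝟙_ C)]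

attribute [local instance] Abelian.hasFiniteBiproducts in
/-- Linearly independent morphisms to the unit are jointly epimorphic, as a morphism to a sum of
copies of the unit. -/
theorem eq_zero_of_sum_comp_eq_zero (h : ∀ f : 𝟙_ C ⟶ 𝟙_ C, ∃ a : k, f = a • 𝟙 _) {Y : C} {n : ℕ}
    (φ : Fin n → (Y ⟶ 𝟙_ C)) (hφ : LinearIndependent k φ) {V : C} (u : Fin n → (𝟙_ C ⟶ V))
    (hu : ∑ i, φ i ≫ u i = 0) (i : Fin n) : u i = 0 := by
  induction n generalizing V with
  | zero => exact i.elim0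
  | succ n ih =>
    rw [linearIndependent_finSucc] at hφ
    let p : Y ⟶ ⨁ fun _ : Fin n => 𝟙_ C := biproduct.lift (Fin.tail φ)
    have hp : Epi p := by
      refine Preadditive.epi_of_cancel_zero _ fun {Z} g hg => ?_
      ext j
      rw [comp_zero]
      refine ih (Fin.tail φ) hφ.1 (fun j => biproduct.ι (fun _ : Fin n => 𝟙_ C) j ≫ g) ?_ j
      rw [← hg]
      simp only [p, biproduct.lift_eq, Preadditive.sum_comp, Category.assoc]
    -- Otherwise `φ 0` would factor through the epimorphism `p` onto `𝟙 ^ n`, and would be a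
    -- combination of the other forms because endomorphisms of the unit are scalars.
    have hne : kernel.ι p ≫ φ 0 ≠ 0 := by
      intro h0
      apply hφ.2
      let g : (⨁ fun _ : Fin n => 𝟙_ C) ⟶ 𝟙_ C := Abelian.epiDesc p (φ 0) h0
      have hg : p ≫ g = φ 0 := Abelian.comp_epiDesc p (φ 0) h0
      rw [← hg]
      choose a ha using fun j => h (biproduct.ι (fun _ : Fin n => 𝟙_ C) j ≫ g)
      have : p ≫ g = ∑ j, a j • Fin.tail φ j := by
        simp only [p, biproduct.lift_eq, Preadditive.sum_comp, Category.assoc, ha,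
          Linear.comp_smul, Category.comp_id]
      rw [this]
      exact Submodule.sum_mem _ fun j _ => Submodule.smul_mem _ _ (Submodule.subset_span ⟨j, rfl⟩)
    have he : Epi (kernel.ι p ≫ φ 0) := epi_of_nonzero_to_simple hne
    have hz (j : Fin n) : kernel.ι p ≫ φ j.succ = 0 := by
      have : φ j.succ = p ≫ biproduct.π _ j := by simp [p, Fin.tail]
      rw [this, kernel.condition_assoc, zero_comp]
    -- On the kernel of the other forms only the term of index `0` of the relation survives, and `φ
    -- 0` is still epimorphic there.
    have hu0 : u 0 = 0 := by
      rw [← cancel_epi (kernel.ι p ≫ φ 0), comp_zero, Category.assoc]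
      have := kernel.ι p ≫= hu
      rw [Fin.sum_univ_succ, Preadditive.comp_add, Preadditive.comp_sum, comp_zero] at this
      rw [← this, left_eq_add]
      refine Finset.sum_eq_zero fun j _ => ?_
      rw [← Category.assoc, hz, zero_comp]
    refine Fin.cases hu0 (fun j => ?_) i
    refine ih (Fin.tail φ) hφ.1 (fun j => u j.succ) ?_ j
    rw [Fin.sum_univ_succ, hu0, comp_zero, zero_add] at hu
    exact hu

end LinearForms

section Conservative

variable {C : Type u₁} [Category.{v} C] [Abelian C] [MonoidalCategory C] [SymmetricCategory C]
  [HasDuals C] [MonoidalPreadditive C] [Simple (𝟙_ C)]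
  {D : Type u₂} [Category.{v} D] [Abelian D] [MonoidalCategory D] [SymmetricCategory D]
  [MonoidalPreadditive D] (F : C ⥤ D) [F.Braided] [F.Additive] [PreservesFiniteColimits F]

open Functor.LaxMonoidal Functor.OplaxMonoidal Functor.Monoidal

/-- Tensor functors between rigid abelian categories are conservative. -/
theorem isZero_of_isZero_map (hD : ¬ IsZero (𝟙_ D)) {X : C} (h : IsZero (F.obj X)) : IsZero X := by
  by_contra hX
  obtain ⟨Y, ⟨_⟩⟩ := HasDuals.exists_dual X
  -- The unit is simple, so it is a quotient of `Y ⊗ X`. Applying `F`, the unit of `D` would be a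
  -- quotient of zero.
  have : Epi (ε_ X Y) := epi_of_nonzero_to_simple (evaluation_ne_zero hX)
  have h₁ : IsZero (F.obj (Y ⊗ X)) :=
    ((tensorLeft (F.obj Y)).map_isZero h).of_iso (μIso F Y X).symm
  have h₂ : IsZero (F.obj (𝟙_ C)) := by
    rw [IsZero.iff_id_eq_zero, ← cancel_epi (F.map (ε_ X Y))]
    exact h₁.eq_of_src _ _
  exact hD (h₂.of_iso (εIso F))

/-- An epimorphism `F.map f` forces `F.obj (cokernel f)` to vanish, and conservativity then kills
the cokernel itself. -/
theorem epi_of_epi_map (hD : ¬ IsZero (𝟙_ D)) {X Y : C} (f : X ⟶ Y) [Epi (F.map f)] : Epi f := by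
  refine Preadditive.epi_of_isZero_cokernel f (isZero_of_isZero_map F hD ?_)
  rw [IsZero.iff_id_eq_zero, ← F.map_id, ← cancel_epi (F.map (cokernel.π f)),
    ← cancel_epi (F.map f), comp_zero, comp_zero, ← F.map_comp_assoc, cokernel.condition,
    F.map_zero, zero_comp]

end Conservative

end TensorCat

end
noncomputable section

namespace TensorCat
namespace LaxAlgebra

/-! ## Extension of a lax algebra along a tensor functor -/

section Extension

attribute [local instance] Abelian.hasFiniteBiproducts
open scoped ZeroObject

variable {C : Type u₁} [Category.{v} C] [Abelian C] [MonoidalCategory C] [SymmetricCategory C]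
  {D : Type u₂} [Category.{v} D] [Abelian D] [MonoidalCategory D] [SymmetricCategory D]
  (F : C ⥤ D) [F.Braided] [F.Additive] [PreservesFiniteLimits F] (A : LaxAlgebra.{w} C)

/-- Representatives of the values of the extension of a lax algebra. -/
structure PreExt (Y : D) where
  src : C
  val : A.obj src
  hom : Y ⟶ F.obj src

variable {F A} in
/-- Two representatives are equivalent if they are restrictions of the same element. -/
def PreExt.Rel {Y : D} (s t : PreExt F A Y) : Prop :=
  ∃ (W : C) (a : W ⟶ s.src) (b : W ⟶ t.src) (g : Y ⟶ F.obj W), g ≫ F.map a = s.hom ∧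
    g ≫ F.map b = t.hom ∧ A.map a s.val = A.map b t.val

/-- The setoid of representatives. -/
def PreExt.setoid (Y : D) : Setoid (PreExt F A Y) where
  r := Rel
  iseqv :=
    { refl s := ⟨s.src, 𝟙 _, 𝟙 _, s.hom, by simp, by simp, rfl⟩
      symm := fun ⟨W, a, b, g, ha, hb, h⟩ => ⟨W, b, a, g, hb, ha, h.symm⟩
      trans := by
        rintro s t r ⟨W, a, b, g, ha, hb, h⟩ ⟨W', a', b', g', ha', hb', h'⟩
        -- Left exactness of `F` enters here: the two maps out of `Y` glue to a map into the image
        -- of the pullback.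
        have hp := (IsPullback.of_hasPullback b a').map F
        refine ⟨pullback b a', pullback.fst _ _ ≫ a, pullback.snd _ _ ≫ b',
          hp.lift g g' (hb.trans ha'.symm), ?_, ?_, ?_⟩
        · rw [F.map_comp, hp.lift_fst_assoc, ha]
        · rw [F.map_comp, hp.lift_snd_assoc, hb']
        · rw [A.map_comp, h, ← A.map_comp, pullback.condition, A.map_comp, h', A.map_comp] }

/-- The values of the extension of a lax algebra. -/
def Ext (Y : D) : Type (max u₁ v w) := _root_.Quotient (PreExt.setoid F A Y)

namespace Ext

variable {F A}

/-- The class of a representative. -/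
def mk {Y : D} {X : C} (x : A.obj X) (f : Y ⟶ F.obj X) : Ext F A Y :=
  Quotient.mk (PreExt.setoid F A Y) ⟨X, x, f⟩

theorem ind {Y : D} {p : Ext F A Y → Prop} (h : ∀ {X : C} (x : A.obj X) (f), p (mk x f)) (e) :
    p e :=
  Quotient.ind (s := PreExt.setoid F A Y) (fun _ => h _ _) e

theorem mk_eq_mk {Y : D} {X X' : C} {x : A.obj X} {f : Y ⟶ F.obj X} {x' : A.obj X'}
    {f' : Y ⟶ F.obj X'} : mk x f = mk x' f' ↔ ∃ (W : C) (a : W ⟶ X) (b : W ⟶ X')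
      (g : Y ⟶ F.obj W), g ≫ F.map a = f ∧ g ≫ F.map b = f' ∧ A.map a x = A.map b x' :=
  Quotient.eq (r := PreExt.setoid F A Y)

theorem mk_map {Y : D} {X X' : C} (h : X ⟶ X') (x : A.obj X') (f : Y ⟶ F.obj X) :
    mk (A.map h x) f = mk x (f ≫ F.map h) :=
  mk_eq_mk.2 ⟨X, 𝟙 _, h, f, by simp, rfl, A.map_id _ _⟩

variable (F A) in
/-- The restriction maps of the extension. -/
def mapAux {Y Y' : D} (g : Y ⟶ Y') : Ext F A Y' → Ext F A Y :=
  Quotient.map (sa := PreExt.setoid F A Y') (sb := PreExt.setoid F A Y)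
    (fun s => ⟨s.src, s.val, g ≫ s.hom⟩) <| by
      rintro s t ⟨W, a, b, h, ha, hb, hab⟩
      exact ⟨W, a, b, g ≫ h, by simp [ha], by simp [hb], hab⟩

/-- The sum of two representatives. -/
def addAux {Y : D} (s t : PreExt F A Y) : PreExt F A Y where
  src := s.src ⊞ t.src
  val := A.map biprod.fst s.val + A.map biprod.snd t.val
  hom := s.hom ≫ F.map biprod.inl + t.hom ≫ F.map biprod.inr

instance (Y : D) : Add (Ext F A Y) where
  add := Quotient.map₂ (sa := PreExt.setoid F A Y) (sb := PreExt.setoid F A Y)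
    (sc := PreExt.setoid F A Y) addAux <| by
      rintro ⟨X, x, f⟩ ⟨X', x', f'⟩ ⟨W, a, b, g, ha, hb, h⟩ ⟨Y, y, e⟩ ⟨Y', y', e'⟩
        ⟨W', a', b', g', ha', hb', h'⟩
      dsimp only at a b ha hb h a' b' ha' hb' h'
      subst ha hb ha' hb'
      have key : ∃ (Z : C) (c : Z ⟶ X ⊞ Y) (d : Z ⟶ X' ⊞ Y') (i : _ ⟶ F.obj Z),
          i ≫ F.map c = (g ≫ F.map a) ≫ F.map biprod.inl + (g' ≫ F.map a') ≫ F.map biprod.inr ∧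
          i ≫ F.map d = (g ≫ F.map b) ≫ F.map biprod.inl + (g' ≫ F.map b') ≫ F.map biprod.inr ∧
          A.map c (A.map biprod.fst x + A.map biprod.snd y) =
            A.map d (A.map biprod.fst x' + A.map biprod.snd y') := by
        refine ⟨W ⊞ W', biprod.map a a', biprod.map b b',
          g ≫ F.map biprod.inl + g' ≫ F.map biprod.inr, ?_, ?_, ?_⟩
        · rw [Preadditive.add_comp, Category.assoc, Category.assoc, ← F.map_comp, ← F.map_comp,
            biprod.inl_map, biprod.inr_map, F.map_comp, F.map_comp, Category.assoc, Category.assoc]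
        · rw [Preadditive.add_comp, Category.assoc, Category.assoc, ← F.map_comp, ← F.map_comp,
            biprod.inl_map, biprod.inr_map, F.map_comp, F.map_comp, Category.assoc, Category.assoc]
        · simp only [map_add, ← A.map_comp, biprod.map_fst, biprod.map_snd]
          simp only [A.map_comp, h, h']
      exact key

theorem mk_add_mk {Y : D} {X X' : C} (x : A.obj X) (f : Y ⟶ F.obj X) (x' : A.obj X')
    (f' : Y ⟶ F.obj X') : mk x f + mk x' f' = mk (A.map biprod.fst x + A.map biprod.snd x')
      (f ≫ F.map biprod.inl + f' ≫ F.map biprod.inr) := rfl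

theorem mk_add {Y : D} {X : C} (x x' : A.obj X) (f : Y ⟶ F.obj X) :
    mk (x + x') f = mk x f + mk x' f := by
  have h : f ≫ F.map biprod.inl + f ≫ F.map biprod.inr =
      f ≫ F.map (biprod.lift (𝟙 X) (𝟙 X)) := by
    rw [biprod.lift_eq, F.map_add]
    simp
  rw [mk_add_mk, h, ← mk_map, map_add, ← A.map_comp, ← A.map_comp]
  simp [A.map_id]

theorem mk_hom_add {Y : D} {X : C} (x : A.obj X) (f f' : Y ⟶ F.obj X) :
    mk x (f + f') = mk x f + mk x f' := by
  have h : A.map biprod.fst x + A.map biprod.snd x = A.map (biprod.desc (𝟙 X) (𝟙 X)) x := by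
    rw [biprod.desc_eq, A.map_add_hom]
    simp
  rw [mk_add_mk, h, mk_map]
  simp [← F.map_comp]

/-- The direct sum of the two source objects carries both representatives, so that identities in the
extension reduce to identities in one group `A.obj X`. -/
theorem exists_mk₂ {Y : D} (e e' : Ext F A Y) :
    ∃ (X : C) (x x' : A.obj X) (f : Y ⟶ F.obj X), mk x f = e ∧ mk x' f = e' := by
  induction e using ind with | h x f =>
  induction e' using ind with | h x' f' =>
  refine ⟨_, A.map biprod.fst x, A.map biprod.snd x',
    f ≫ F.map biprod.inl + f' ≫ F.map biprod.inr, ?_, ?_⟩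
  · rw [mk_map]
    simp [← F.map_comp]
  · rw [mk_map]
    simp [← F.map_comp]

theorem exists_mk₃ {Y : D} (e e' e'' : Ext F A Y) :
    ∃ (X : C) (x x' x'' : A.obj X) (f : Y ⟶ F.obj X), mk x f = e ∧ mk x' f = e' ∧
      mk x'' f = e'' := by
  obtain ⟨X, x, x', f, rfl, rfl⟩ := exists_mk₂ e e'
  induction e'' using ind with | h x'' f' =>
  refine ⟨_, A.map biprod.fst x, A.map biprod.fst x', A.map biprod.snd x'',
    f ≫ F.map biprod.inl + f' ≫ F.map biprod.inr, ?_, ?_, ?_⟩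
  all_goals
    rw [mk_map]
    simp [← F.map_comp]

instance (Y : D) : Zero (Ext F A Y) := ⟨mk (0 : A.obj 0) 0⟩

theorem mk_zero {Y : D} {X : C} (f : Y ⟶ F.obj X) : mk (0 : A.obj X) f = 0 :=
  mk_eq_mk.2 ⟨X, 𝟙 _, 0, f, by simp, by simp, by simp⟩

theorem mk_eq_zero_iff {Y : D} {X : C} {x : A.obj X} {f : Y ⟶ F.obj X} :
    mk x f = 0 ↔ ∃ (W : C) (a : W ⟶ X) (g : Y ⟶ F.obj W), g ≫ F.map a = f ∧ A.map a x = 0 := by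
  constructor
  · intro h
    obtain ⟨W, a, b, g, ha, -, h⟩ := mk_eq_mk.1 h
    exact ⟨W, a, g, ha, by rw [h, map_zero]⟩
  · rintro ⟨W, a, g, rfl, h⟩
    rw [← mk_map, h, mk_zero]

instance (Y : D) : Neg (Ext F A Y) where
  neg := Quotient.map (sa := PreExt.setoid F A Y) (sb := PreExt.setoid F A Y)
    (fun s => ⟨s.src, -s.val, s.hom⟩) <| by
      rintro s t ⟨W, a, b, g, ha, hb, h⟩
      exact ⟨W, a, b, g, ha, hb, by simp [h]⟩

theorem neg_mk {Y : D} {X : C} (x : A.obj X) (f : Y ⟶ F.obj X) : -mk x f = mk (-x) f := rfl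

instance (Y : D) : AddCommGroup (Ext F A Y) where
  add_assoc e e' e'' := by
    obtain ⟨X, x, x', x'', f, rfl, rfl, rfl⟩ := exists_mk₃ e e' e''
    simp only [← mk_add, add_assoc]
  zero_add e := by
    induction e using ind with | h x f => rw [← mk_zero f, ← mk_add, zero_add]
  add_zero e := by
    induction e using ind with | h x f => rw [← mk_zero f, ← mk_add, add_zero]
  add_comm e e' := by
    obtain ⟨X, x, x', f, rfl, rfl⟩ := exists_mk₂ e e'
    rw [← mk_add, ← mk_add, add_comm]
  neg_add_cancel e := by
    induction e using ind with | h x f => rw [neg_mk, ← mk_add, neg_add_cancel, mk_zero]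
  nsmul := nsmulRec
  zsmul := zsmulRec

open Functor.LaxMonoidal Functor.OplaxMonoidal Functor.Monoidal

/-- The product on the extension. -/
def mulAux {Y Y' : D} : Ext F A Y → Ext F A Y' → Ext F A (Y ⊗ Y') :=
  Quotient.map₂ (sa := PreExt.setoid F A Y) (sb := PreExt.setoid F A Y')
    (sc := PreExt.setoid F A (Y ⊗ Y'))
    (fun s t => ⟨s.src ⊗ t.src, A.mul s.val t.val, (s.hom ⊗ₘ t.hom) ≫ μ F _ _⟩) <| by
      rintro s s' ⟨W, a, b, g, ha, hb, h⟩ t t' ⟨W', a', b', g', ha', hb', h'⟩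
      refine ⟨W ⊗ W', a ⊗ₘ a', b ⊗ₘ b', (g ⊗ₘ g') ≫ μ F _ _, ?_, ?_, ?_⟩
      · rw [Category.assoc, ← μ_natural, tensorHom_comp_tensorHom_assoc, ha, ha']
      · rw [Category.assoc, ← μ_natural, tensorHom_comp_tensorHom_assoc, hb, hb']
      · rw [A.map_mul, A.map_mul, h, h']

end Ext

open Functor.LaxMonoidal Functor.OplaxMonoidal Functor.Monoidal

/-- The extension of a lax algebra along a tensor functor. -/
def extension : LaxAlgebra.{max u₁ v w} D where
  obj := Ext F A
  map g := AddMonoidHom.mk' (Ext.mapAux F A g) fun e e' => by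
    obtain ⟨X, x, x', f, rfl, rfl⟩ := Ext.exists_mk₂ e e'
    rw [← Ext.mk_add]
    exact Ext.mk_add x x' (g ≫ f)
  map_id Y e := by
    induction e using Ext.ind with | h x f => exact congrArg (Ext.mk x) (Category.id_comp f)
  map_comp g g' e := by
    induction e using Ext.ind with | h x f => exact congrArg (Ext.mk x) (Category.assoc g g' f)
  map_add_hom g g' e := by
    induction e using Ext.ind with | h x f =>
    exact (congrArg (Ext.mk x) (Preadditive.add_comp _ _ _ g g' f)).trans (Ext.mk_hom_add x _ _)
  mul := AddMonoidHom.mk' (fun e => AddMonoidHom.mk' (Ext.mulAux e) fun e₁ e₂ => by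
      obtain ⟨X, x, x', f, rfl, rfl⟩ := Ext.exists_mk₂ e₁ e₂
      induction e using Ext.ind with | h y g =>
      rw [← Ext.mk_add]
      exact (congrArg (Ext.mk · _) (map_add (A.mul y) x x')).trans (Ext.mk_add _ _ _))
    fun e₁ e₂ => by
      obtain ⟨X, x, x', f, rfl, rfl⟩ := Ext.exists_mk₂ e₁ e₂
      ext e
      induction e using Ext.ind with | h y g =>
      rw [← Ext.mk_add]
      exact (congrArg (Ext.mk · _) (DFunLike.congr_fun (map_add A.mul x x') y)).trans
        (Ext.mk_add _ _ _)
  map_mul g g' e e' := by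
    induction e using Ext.ind with | h x f =>
    induction e' using Ext.ind with | h x' f' =>
    refine congrArg (Ext.mk (A.mul x x')) ?_
    rw [← Category.assoc, tensorHom_comp_tensorHom]
  one := Ext.mk A.one (ε F)
  one_mul {Y} e := by
    induction e using Ext.ind with | @h X x f =>
    change Ext.mk (A.mul A.one x) ((ε F ⊗ₘ f) ≫ μ F _ _) = Ext.mk x ((λ_ Y).hom ≫ f)
    rw [A.one_mul, Ext.mk_map]
    congr 1
    rw [tensorHom_def', Category.assoc, Category.assoc, ← Functor.LaxMonoidal.left_unitality]
    simp
  mul_assoc {X Y Z} e e' e'' := by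
    induction e using Ext.ind with | h x f =>
    induction e' using Ext.ind with | h x' f' =>
    induction e'' using Ext.ind with | h x'' f'' =>
    change Ext.mk (A.mul (A.mul x x') x'') ((((f ⊗ₘ f') ≫ μ F _ _) ⊗ₘ f'') ≫ μ F _ _) =
      Ext.mk (A.mul x (A.mul x' x'')) ((α_ X Y Z).hom ≫ ((f ⊗ₘ ((f' ⊗ₘ f'') ≫ μ F _ _)) ≫ μ F _ _))
    rw [A.mul_assoc, Ext.mk_map]
    congr 1
    calc ((((f ⊗ₘ f') ≫ μ F _ _) ⊗ₘ f'') ≫ μ F _ _) ≫ F.map (α_ _ _ _).hom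
      _ = ((f ⊗ₘ f') ⊗ₘ f'') ≫ μ F _ _ ▷ _ ≫ μ F _ _ ≫ F.map (α_ _ _ _).hom := by
        rw [← tensorHom_id, tensorHom_comp_tensorHom_assoc, Category.comp_id, Category.assoc]
      _ = _ := by
        rw [Functor.LaxMonoidal.associativity, associator_naturality_assoc, ← id_tensorHom,
          tensorHom_comp_tensorHom_assoc, Category.comp_id]
  mul_comm {X Y} e e' := by
    induction e using Ext.ind with | h x f =>
    induction e' using Ext.ind with | h x' f' =>
    change Ext.mk (A.mul x x') ((f ⊗ₘ f') ≫ μ F _ _) =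
      Ext.mk (A.mul x' x) ((β_ X Y).hom ≫ (f' ⊗ₘ f) ≫ μ F _ _)
    rw [A.mul_comm, Ext.mk_map]
    congr 1
    rw [Category.assoc, Functor.Braided.braided]
    simp

theorem extension_map_mk {Y Y' : D} {X : C} (g : Y ⟶ Y') (x : A.obj X) (f : Y' ⟶ F.obj X) :
    (extension F A).map g (Ext.mk x f) = Ext.mk x (g ≫ f) := rfl

theorem extension_mul_mk {Y Y' : D} {X X' : C} (x : A.obj X) (f : Y ⟶ F.obj X) (x' : A.obj X')
    (f' : Y' ⟶ F.obj X') : (extension F A).mul (Ext.mk x f) (Ext.mk x' f') =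
      Ext.mk (A.mul x x') ((f ⊗ₘ f') ≫ μ F _ _) := rfl

/-- The unit of the extension of a lax algebra. -/
def toExtension : Hom A ((extension F A).restrict F) where
  app X := AddMonoidHom.mk' (fun x => Ext.mk x (𝟙 (F.obj X))) fun x x' => Ext.mk_add _ _ _
  naturality {X Y} f x := by
    change Ext.mk (A.map f x) (𝟙 _) = Ext.mk x (F.map f ≫ 𝟙 _)
    rw [Ext.mk_map]
    simp
  map_mul {X Y} x y := by
    change Ext.mk (A.mul x y) (𝟙 _) = Ext.mk (A.mul x y) (δ F X Y ≫ (𝟙 _ ⊗ₘ 𝟙 _) ≫ μ F X Y)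
    simp
  map_one := by
    change Ext.mk A.one (𝟙 _) = Ext.mk A.one (η F ≫ ε F)
    simp

variable {A}

/-- If `x` dies in the extension, it is killed by some `a` through whose image under `F` the
identity of `F.obj X` factors. Then `F.map a` is epimorphic, so `a` is, and separatedness gives `x =
0`. -/
theorem toExtension_isInjective [PreservesFiniteColimits F]
    (hF : ∀ {X Y : C} (f : X ⟶ Y), Epi (F.map f) → Epi f) (hA : A.IsSeparated) :
    (toExtension F A).IsInjective := by
  intro X x hx
  obtain ⟨W, a, g, hg, h⟩ := Ext.mk_eq_zero_iff.1 hx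
  have : Epi (g ≫ F.map a) := by
    rw [hg]
    infer_instance
  exact hA a (hF a (epi_of_epi g _)) x h

/-- By separatedness of `A`, the morphism that kills `x` may be replaced by its image, a
monomorphism preserved by `F`. Lifting the epimorphism `p` against it carries the vanishing over to
`Y'`. -/
theorem isSeparated_extension (hA : A.IsSeparated) : (extension F A).IsSeparated := by
  intro Y Y' p _ e he
  induction e using Ext.ind with | h x f =>
  obtain ⟨W, a, g, hg, h⟩ := Ext.mk_eq_zero_iff.1 he
  have hi : A.map (image.ι a) x = 0 := by
    refine hA (factorThruImage a) inferInstance _ ?_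
    rw [← A.map_comp, image.fac, h]
  have hsq : CommSq (g ≫ F.map (factorThruImage a)) p (F.map (image.ι a)) f := ⟨by
    rw [Category.assoc, ← F.map_comp, image.fac, hg]⟩
  have : StrongEpi p := strongEpi_of_epi p
  exact Ext.mk_eq_zero_iff.2 ⟨_, image.ι a, hsq.lift, hsq.fac_right, hi⟩

end Extension

end LaxAlgebra
end TensorCat

end
noncomputable section

namespace TensorCat
namespace LaxAlgebra

/-! ## Prime ideals -/

section PrimeIdeals

attribute [local instance] Abelian.hasFiniteBiproducts
open scoped ZeroObject

variable {C : Type u} [Category.{v} C] [Abelian C] [MonoidalCategory C] [SymmetricCategory C]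
  [HasDuals C] [MonoidalPreadditive C] {A : LaxAlgebra.{w} C}

namespace Ideal

theorem sub_mem_mul (I : A.Ideal) {X Y : C} {x x' : A.obj X} {y y' : A.obj Y}
    (hx : x - x' ∈ I.carrier X) (hy : y - y' ∈ I.carrier Y) :
    A.mul x y - A.mul x' y' ∈ I.carrier (X ⊗ Y) := by
  have h : A.mul x y - A.mul x' y' = A.mul (x - x') y + A.mul x' (y - y') := by
    rw [map_sub, map_sub, AddMonoidHom.sub_apply, sub_add_sub_cancel]
  rw [h]
  exact add_mem (I.mul_mem _ hx) (I.mul_mem_left _ hy)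

/-- The ideal generated by an ideal and an element. -/
def adjoin (I : A.Ideal) {Y : C} (t : A.obj Y) : A.Ideal where
  carrier Z :=
    -- Membership is local: after restriction along an epimorphism `p`, the element is a multiple of
    -- `t` modulo `I`. Without `p` the condition would not descend along epimorphisms.
    { carrier := {s | ∃ (Z' : C) (p : Z' ⟶ Z) (_ : Epi p) (V : C) (r : A.obj V) (q : Z' ⟶ Y ⊗ V),
        A.map p s - A.map q (A.mul t r) ∈ I.carrier Z'}
      zero_mem' := ⟨Z, 𝟙 _, inferInstance, 0, 0, 0, by simp⟩
      add_mem' := by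
        rintro s s' ⟨Z₁, p₁, _, V₁, r₁, q₁, h₁⟩ ⟨Z₂, p₂, _, V₂, r₂, q₂, h₂⟩
        refine ⟨pullback p₁ p₂, pullback.fst p₁ p₂ ≫ p₁, epi_comp _ _, V₁ ⊞ V₂,
          A.map biprod.fst r₁ + A.map biprod.snd r₂,
          pullback.fst p₁ p₂ ≫ q₁ ≫ Y ◁ biprod.inl + pullback.snd p₁ p₂ ≫ q₂ ≫ Y ◁ biprod.inr, ?_⟩
        have h := add_mem (I.map_mem (pullback.fst p₁ p₂) h₁) (I.map_mem (pullback.snd p₁ p₂) h₂)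
        convert h using 1
        simp only [map_add, map_sub, A.map_add_hom, A.map_comp, map_whiskerLeft]
        simp only [← A.map_comp, biprod.inl_fst, biprod.inl_snd, biprod.inr_fst, biprod.inr_snd,
          A.map_id, map_zero_hom, map_zero, add_zero, zero_add, pullback.condition]
        abel
      neg_mem' := by
        rintro s ⟨Z₁, p₁, _, V₁, r₁, q₁, h₁⟩
        refine ⟨Z₁, p₁, inferInstance, V₁, -r₁, q₁, ?_⟩
        have h := neg_mem h₁
        rw [neg_sub'] at h
        simpa using h }
  map_mem := by
    rintro Z₁ Z₂ f s ⟨Z₃, p, _, V, r, q, h⟩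
    refine ⟨pullback f p, pullback.fst f p, inferInstance, V, r, pullback.snd f p ≫ q, ?_⟩
    rw [← A.map_comp, pullback.condition, A.map_comp, A.map_comp, ← map_sub]
    exact I.map_mem _ h
  mul_mem := by
    rintro Z₁ Z₂ s y ⟨Z₃, p, _, V, r, q, h⟩
    refine ⟨Z₃ ⊗ Z₂, p ▷ Z₂, inferInstance, V ⊗ Z₂, A.mul r y, q ▷ Z₂ ≫ (α_ _ _ _).hom, ?_⟩
    rw [A.map_comp, ← A.mul_assoc, map_whiskerRight, map_whiskerRight, ← AddMonoidHom.sub_apply,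
      ← map_sub]
    exact I.mul_mem _ h
  mem_of_epi := by
    rintro Z₁ Z₂ f _ s ⟨Z₃, p, _, V, r, q, h⟩
    refine ⟨Z₃, p ≫ f, epi_comp _ _, V, r, q, ?_⟩
    rwa [A.map_comp]

theorem mem_adjoin {I : A.Ideal} {Y Z : C} {t : A.obj Y} {s : A.obj Z} :
    s ∈ (I.adjoin t).carrier Z ↔ ∃ (Z' : C) (p : Z' ⟶ Z) (_ : Epi p) (V : C) (r : A.obj V)
      (q : Z' ⟶ Y ⊗ V), A.map p s - A.map q (A.mul t r) ∈ I.carrier Z' := Iff.rfl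

theorem le_adjoin (I : A.Ideal) {Y : C} (t : A.obj Y) {Z : C} {s : A.obj Z}
    (hs : s ∈ I.carrier Z) : s ∈ (I.adjoin t).carrier Z :=
  mem_adjoin.2 ⟨Z, 𝟙 _, inferInstance, 0, 0, 0, by simpa [A.map_id] using hs⟩

theorem self_mem_adjoin (I : A.Ideal) {Y : C} (t : A.obj Y) : t ∈ (I.adjoin t).carrier Y :=
  mem_adjoin.2 ⟨Y, 𝟙 _, inferInstance, 𝟙_ C, A.one, (ρ_ Y).inv, by
    rw [A.mul_one, ← A.map_comp, Iso.inv_hom_id, sub_self]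
    exact zero_mem _⟩

/-- Locally the product is `(t r) (t' r')`, which is a restriction of `(t t') (r r')` by
interchange. The two covers combine to `p ⊗ p'`, an epimorphism by exactness of the tensor product.
-/
theorem mul_mem_of_mem_adjoin {I : A.Ideal} {Y Y' Z Z' : C} {t : A.obj Y} {t' : A.obj Y'}
    {s : A.obj Z} {s' : A.obj Z'} (ht : A.mul t t' ∈ I.carrier _)
    (hs : s ∈ (I.adjoin t).carrier Z) (hs' : s' ∈ (I.adjoin t').carrier Z') :
    A.mul s s' ∈ I.carrier (Z ⊗ Z') := by
  obtain ⟨W, p, _, V, r, q, h⟩ := mem_adjoin.1 hs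
  obtain ⟨W', p', _, V', r', q', h'⟩ := mem_adjoin.1 hs'
  have h₁ := I.sub_mem_mul h h'
  rw [← A.map_mul, ← A.map_mul, A.mul_mul_mul_comm] at h₁
  have h₂ := I.map_mem (q ⊗ₘ q') (I.map_mem (tensorμ _ _ _ _) (I.mul_mem (A.mul r r') ht))
  have h₃ := add_mem h₁ h₂
  rw [sub_add_cancel] at h₃
  exact I.mem_of_epi (p ⊗ₘ p') h₃

instance : PartialOrder A.Ideal where
  le I J := ∀ X, I.carrier X ≤ J.carrier X
  le_refl I X := le_rfl
  le_trans I J K h h' X := (h X).trans (h' X)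
  le_antisymm I J h h' := ext fun X => le_antisymm (h X) (h' X)

/-- The union of a nonempty chain of ideals. -/
def sSupChain (c : Set A.Ideal) (hc : IsChain (· ≤ ·) c) (hne : c.Nonempty) : A.Ideal where
  carrier X :=
    { carrier := {x | ∃ I ∈ c, x ∈ I.carrier X}
      zero_mem' := ⟨hne.some, hne.some_mem, zero_mem _⟩
      add_mem' := by
        rintro x y ⟨I, hI, hx⟩ ⟨J, hJ, hy⟩
        rcases hc.total hI hJ with h | h
        · exact ⟨J, hJ, add_mem (h X hx) hy⟩
        · exact ⟨I, hI, add_mem hx (h X hy)⟩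
      neg_mem' := by
        rintro x ⟨I, hI, hx⟩
        exact ⟨I, hI, neg_mem hx⟩ }
  map_mem := by
    rintro X Y f x ⟨I, hI, hx⟩
    exact ⟨I, hI, I.map_mem f hx⟩
  mul_mem := by
    rintro X Y x y ⟨I, hI, hx⟩
    exact ⟨I, hI, I.mul_mem y hx⟩
  mem_of_epi := by
    rintro X Y f _ x ⟨I, hI, hx⟩
    exact ⟨I, hI, I.mem_of_epi f hx⟩

/-- The zero ideal of a separated lax algebra. -/
def zero (hA : A.IsSeparated) : A.Ideal where
  carrier X := ⊥
  map_mem f x hx := by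
    rw [AddSubgroup.mem_bot] at hx ⊢
    rw [hx, map_zero]
  mul_mem y hx := by
    rw [AddSubgroup.mem_bot] at hx ⊢
    rw [hx, map_zero, AddMonoidHom.zero_apply]
  mem_of_epi f _ x hx := by
    rw [AddSubgroup.mem_bot] at hx ⊢
    exact hA f inferInstance x hx

/-- An ideal that is maximal among the ideals disjoint from a multiplicative family of elements
is prime. -/
theorem exists_isPrime (hA : A.IsSeparated) (M : ∀ X, Set (A.obj X)) (h0 : ∀ X, 0 ∉ M X)
    (h1 : A.one ∈ M _) (hM : ∀ {X Y} (x : A.obj X) (y : A.obj Y), x ∈ M X → y ∈ M Y →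
      ∃ (Z : C) (f : Z ⟶ X ⊗ Y), A.map f (A.mul x y) ∈ M Z) :
    ∃ P : A.Ideal, P.IsPrime ∧ ∀ X, ∀ x ∈ M X, x ∉ P.carrier X := by
  obtain ⟨P, hP⟩ := zorn_le₀ {P : A.Ideal | ∀ X, ∀ x ∈ M X, x ∉ P.carrier X} fun c hc hchain => by
    rcases c.eq_empty_or_nonempty with rfl | hne
    · exact ⟨zero hA, fun X x hx hx' => h0 X (by rwa [AddSubgroup.mem_bot.1 hx'] at hx), by simp⟩
    · refine ⟨sSupChain c hchain hne, ?_, fun I hI X x hx => ⟨I, hI, hx⟩⟩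
      rintro X x hx ⟨I, hI, hx'⟩
      exact hc hI X x hx hx'
  refine ⟨P, ⟨fun h => hP.1 _ _ h1 h, fun {X Y} x y hxy => ?_⟩, hP.1⟩
  by_contra! hcon
  -- By maximality, adjoining an element outside `P` produces an ideal that meets `M`.
  have key : ∀ {X : C} (x : A.obj X), x ∉ P.carrier X →
      ∃ (Z : C) (m : A.obj Z), m ∈ M Z ∧ m ∈ (P.adjoin x).carrier Z := by
    intro X x hx
    by_contra! h
    exact hx (hP.2 (y := P.adjoin x) (fun Z m hm => h Z m hm) (fun Z z hz => P.le_adjoin x hz) X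
      (P.self_mem_adjoin x))
  obtain ⟨Z, m, hm, hmx⟩ := key x hcon.1
  obtain ⟨Z', m', hm', hmy⟩ := key y hcon.2
  obtain ⟨W, f, hf⟩ := hM m m' hm hm'
  exact hP.1 _ _ hf (P.map_mem f (mul_mem_of_mem_adjoin hxy hmx hmy))

end Ideal

end PrimeIdeals

end LaxAlgebra
end TensorCat

end
noncomputable section

namespace TensorCat

attribute [local instance] Abelian.hasFiniteBiproducts

/-! ## Tensor powers of morphisms -/

section TensorPowers

variable {C : Type u} [Category.{v} C] [MonoidalCategory C]

/-- The tensor power of a morphism. -/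
def tensorPowMap {X Y : C} (f : X ⟶ Y) : (n : ℕ) → (tensorPow X n ⟶ tensorPow Y n)
  | 0 => 𝟙 _
  | n + 1 => f ⊗ₘ tensorPowMap f n

theorem tensorPowMap_comp {X Y Z : C} (f : X ⟶ Y) (g : Y ⟶ Z) (n : ℕ) :
    tensorPowMap (f ≫ g) n = tensorPowMap f n ≫ tensorPowMap g n := by
  induction n with
  | zero => exact (Category.id_comp _).symm
  | succ n ih =>
    change (f ≫ g) ⊗ₘ tensorPowMap (f ≫ g) n = (f ⊗ₘ tensorPowMap f n) ≫ (g ⊗ₘ tensorPowMap g n)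
    rw [ih, tensorHom_comp_tensorHom]

/-- It transfers the vanishing of `unitSymPow α n` to the tensor power of `α`, whose source is `𝟙 ^
⊗ n` and not `𝟙`. -/
theorem exists_tensorPowMap_eq {X : C} (α : 𝟙_ C ⟶ X) (n : ℕ) :
    ∃ e : tensorPow (𝟙_ C) n ⟶ 𝟙_ C, tensorPowMap α n = e ≫ unitTensorPow α n := by
  induction n with
  | zero => exact ⟨𝟙 _, (Category.id_comp _).symm⟩
  | succ n ih =>
    obtain ⟨e, he⟩ := ih
    refine ⟨𝟙_ C ◁ e ≫ (λ_ _).hom, ?_⟩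
    change α ⊗ₘ tensorPowMap α n = (𝟙_ C ◁ e ≫ (λ_ _).hom) ≫ (λ_ _).inv ≫ (α ⊗ₘ unitTensorPow α n)
    rw [he, Category.assoc, Iso.hom_inv_id_assoc, ← id_tensorHom, tensorHom_comp_tensorHom,
      Category.id_comp]

variable [SymmetricCategory C]

theorem tensorPowMap_transposition {X Y : C} (f : X ⟶ Y) (n i : ℕ) :
    tensorPowMap f n ≫ transposition Y n i = transposition X n i ≫ tensorPowMap f n := by
  induction n generalizing i with
  | zero => rfl
  | succ n ih =>
    cases n with
    | zero => exact (Category.comp_id _).trans (Category.id_comp _).symm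
    | succ n =>
      cases i with
      | zero =>
        change (f ⊗ₘ (f ⊗ₘ tensorPowMap f n)) ≫ (α_ _ _ _).inv ≫ ((β_ Y Y).hom ▷ _) ≫ (α_ _ _ _).hom =
          ((α_ _ _ _).inv ≫ ((β_ X X).hom ▷ _) ≫ (α_ _ _ _).hom) ≫ (f ⊗ₘ (f ⊗ₘ tensorPowMap f n))
        rw [associator_inv_naturality_assoc, ← tensorHom_id, tensorHom_comp_tensorHom_assoc,
          BraidedCategory.braiding_naturality, Category.comp_id, Category.assoc, Category.assoc,
          ← associator_naturality, ← tensorHom_id, tensorHom_comp_tensorHom_assoc, Category.id_comp]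
      | succ i =>
        change (f ⊗ₘ tensorPowMap f (n + 1)) ≫ (Y ◁ transposition Y (n + 1) i) =
          (X ◁ transposition X (n + 1) i) ≫ (f ⊗ₘ tensorPowMap f (n + 1))
        rw [← id_tensorHom, ← id_tensorHom, tensorHom_comp_tensorHom, tensorHom_comp_tensorHom, ih,
          Category.comp_id, Category.id_comp]

instance [HasDuals C] {X Y : C} (f : X ⟶ Y) [Epi f] (n : ℕ) : Epi (tensorPowMap f n) := by
  induction n with
  | zero => exact inferInstanceAs (Epi (𝟙 _))
  | succ n ih => exact inferInstanceAs (Epi (f ⊗ₘ tensorPowMap f n))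

end TensorPowers

section SymRel

variable {C : Type u} [Category.{v} C] [Abelian C] [MonoidalCategory C] [SymmetricCategory C]

theorem map_comp_symRel {X Y : C} (f : X ⟶ Y) (n : ℕ) :
    biproduct.map (fun _ : Fin (n - 1) => tensorPowMap f n) ≫ symRel Y n =
      symRel X n ≫ tensorPowMap f n := by
  ext i
  simp [symRel, Preadditive.comp_sub, Preadditive.sub_comp, tensorPowMap_transposition]

end SymRel

namespace LaxAlgebra

/-! ### Maximal nilpotency forces elements to factor through linear forms. -/

section Nilpotency

variable {C : Type u} [Category.{v} C] [Abelian C] [MonoidalCategory C] [SymmetricCategory C]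
  (A : LaxAlgebra.{w} C)

/-- The powers of an element. -/
def pow {X : C} (x : A.obj X) : (n : ℕ) → A.obj (tensorPow X n)
  | 0 => A.one
  | n + 1 => A.mul x (pow x n)

theorem map_pow {X Y : C} (f : X ⟶ Y) (y : A.obj Y) (n : ℕ) :
    A.map (tensorPowMap f n) (A.pow y n) = A.pow (A.map f y) n := by
  induction n with
  | zero => exact A.map_id _ _
  | succ n ih =>
    change A.map (f ⊗ₘ tensorPowMap f n) (A.mul y (A.pow y n)) = A.mul _ (A.pow _ n)
    rw [A.map_mul, ih]

/-- Commutativity makes powers symmetric. Hence they vanish on the relations of the symmetric power,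
which lets nilpotency in `C` act on elements. -/
theorem map_transposition_pow {X : C} (x : A.obj X) (n i : ℕ) :
    A.map (transposition X n i) (A.pow x n) = A.pow x n := by
  induction n generalizing i with
  | zero => exact A.map_id _ _
  | succ n ih =>
    cases n with
    | zero => exact A.map_id _ _
    | succ n =>
      cases i with
      | zero =>
        change A.map ((α_ _ _ _).inv ≫ ((β_ X X).hom ▷ _) ≫ (α_ _ _ _).hom)
          (A.mul x (A.mul x (A.pow x n))) = A.mul x (A.mul x (A.pow x n))
        rw [A.map_comp, A.map_comp, ← A.mul_assoc, map_whiskerRight, ← A.mul_comm, ← A.mul_assoc']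
      | succ i =>
        change A.map (X ◁ transposition X (n + 1) i) (A.mul x (A.pow x (n + 1))) = _
        rw [map_whiskerLeft, ih]
        rfl

theorem pow_ne_zero [A.IsIntegral] {X : C} {x : A.obj X} (hx : x ≠ 0) (n : ℕ) : A.pow x n ≠ 0 := by
  induction n with
  | zero => exact IsIntegral.one_ne_zero
  | succ n ih => exact A.mul_ne_zero hx ih

theorem map_symRel_pow {X : C} (x : A.obj X) (n : ℕ) : A.map (symRel X n) (A.pow x n) = 0 := by
  have h : symRel X n = ∑ i : Fin (n - 1),
      biproduct.π (fun _ : Fin (n - 1) => tensorPow X n) i ≫ (𝟙 _ - transposition X n i) :=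
    biproduct.desc_eq
  rw [h, map_sum_hom]
  refine Finset.sum_eq_zero fun i _ => ?_
  rw [A.map_comp, map_sub_hom, A.map_id, map_transposition_pow, sub_self, map_zero]

variable {A}

/-- The element `x` restricts to zero on the kernel of `p`. -/
def VanishesOnKernel {X Y : C} (p : X ⟶ Y) (x : A.obj X) : Prop :=
  ∀ ⦃V : C⦄ (g : V ⟶ X), g ≫ p = 0 → A.map g x = 0

theorem VanishesOnKernel.eq_of_comp_eq {X Y : C} {p : X ⟶ Y} {x : A.obj X}
    (h : VanishesOnKernel p x) {V : C} {g g' : V ⟶ X} (hg : g ≫ p = g' ≫ p) :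
    A.map g x = A.map g' x := by
  rw [← sub_eq_zero, ← map_sub_hom]
  exact h _ (by rw [Preadditive.sub_comp, hg, sub_self])

variable [HasDuals C] [MonoidalPreadditive C]

/-- The kernel of `p ⊗ p'` is the sum of `X ⊗ ker p'` and `ker p ⊗ X'`. Locally, `g` modulo `ker p ⊗
X'` comes from `Y ⊗ ker p'`, which is covered by `X ⊗ ker p'`; the product vanishes on both parts.
-/
theorem VanishesOnKernel.tensor (hA : A.IsSeparated) {X Y X' Y' : C} {p : X ⟶ Y} {p' : X' ⟶ Y'}
    [Epi p] {x : A.obj X} {x' : A.obj X'} (h : VanishesOnKernel p x) (h' : VanishesOnKernel p' x') :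
    VanishesOnKernel (p ⊗ₘ p') (A.mul x x') := by
  intro V g hg
  have e₁ := ((ShortComplex.mk _ _ (kernel.condition p')).exact_of_f_is_kernel
    (kernelIsKernel p')).map (tensorLeft Y)
  have e₂ := ((ShortComplex.mk _ _ (kernel.condition p)).exact_of_f_is_kernel
    (kernelIsKernel p)).map (tensorRight X')
  obtain ⟨V₁, π₁, _, y₁, h₁⟩ := e₁.exact_up_to_refinements (g ≫ p ▷ X') (by
    rw [MonoidalCategory.tensorHom_def, ← Category.assoc] at hg
    exact hg)
  change V₁ ⟶ Y ⊗ kernel p' at y₁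
  change π₁ ≫ g ≫ p ▷ X' = y₁ ≫ Y ◁ kernel.ι p' at h₁
  obtain ⟨V₂, π₂, _, y₂, h₂⟩ := surjective_up_to_refinements_of_epi (p ▷ kernel p') y₁
  obtain ⟨V₃, π₃, _, y₃, h₃⟩ := e₂.exact_up_to_refinements
      (π₂ ≫ π₁ ≫ g - y₂ ≫ X ◁ kernel.ι p') (by
    change (π₂ ≫ π₁ ≫ g - y₂ ≫ X ◁ kernel.ι p') ≫ (p ▷ X') = 0
    rw [Preadditive.sub_comp, Category.assoc, Category.assoc, h₁, reassoc_of% h₂, Category.assoc,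
      whisker_exchange, sub_self])
  change V₃ ⟶ kernel p ⊗ X' at y₃
  change π₃ ≫ _ = y₃ ≫ kernel.ι p ▷ X' at h₃
  have h₄ : A.map (π₂ ≫ π₁ ≫ g - y₂ ≫ X ◁ kernel.ι p') (A.mul x x') = 0 := by
    refine hA π₃ inferInstance _ ?_
    rw [← A.map_comp, h₃, A.map_comp, map_whiskerRight, h _ (kernel.condition p), map_zero,
      AddMonoidHom.zero_apply, map_zero]
  rw [map_sub_hom, A.map_comp y₂, map_whiskerLeft, h' _ (kernel.condition p'), map_zero, map_zero,
    sub_zero, ← Category.assoc, A.map_comp] at h₄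
  exact hA (π₂ ≫ π₁) (epi_comp _ _) _ h₄

theorem VanishesOnKernel.pow (hA : A.IsSeparated) {X Y : C} {p : X ⟶ Y} [Epi p] {x : A.obj X}
    (h : VanishesOnKernel p x) (n : ℕ) : VanishesOnKernel (tensorPowMap p n) (A.pow x n) := by
  induction n with
  | zero =>
    intro V g hg
    change g ≫ 𝟙 _ = 0 at hg
    rw [Category.comp_id] at hg
    rw [hg, map_zero_hom]
  | succ n ih => exact VanishesOnKernel.tensor hA h ih

/-- The power `x ^ n` depends only on images in `Y ^ ⊗ n`. There `j` locally becomes a combination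
of symmetric relations, which lift along `p` to relations on `X ^ ⊗ n`, and `x ^ n` kills these. -/
theorem VanishesOnKernel.map_pow_eq_zero (hA : A.IsSeparated) {X Y : C} {p : X ⟶ Y} [Epi p]
    {x : A.obj X} (h : VanishesOnKernel p x) {n : ℕ} {V : C} (j : V ⟶ tensorPow X n)
    (hj : j ≫ tensorPowMap p n ≫ symPowπ Y n = 0) : A.map j (A.pow x n) = 0 := by
  rw [← Category.assoc] at hj
  obtain ⟨V₁, π₁, _, y₁, h₁⟩ :=
    (CokernelCofork.IsColimit.comp_π_eq_zero_iff_up_to_refinements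
      (cokernelIsCokernel (symRel Y n)) _).1 hj
  obtain ⟨V₂, π₂, _, y₂, h₂⟩ := surjective_up_to_refinements_of_epi
    (biproduct.map (fun _ : Fin (n - 1) => tensorPowMap p n)) y₁
  refine hA (π₂ ≫ π₁) (epi_comp _ _) _ ?_
  rw [← A.map_comp, (h.pow hA n).eq_of_comp_eq (g' := y₂ ≫ symRel X n), A.map_comp,
    map_symRel_pow, map_zero]
  rw [Category.assoc, Category.assoc, Category.assoc, h₁, reassoc_of% h₂, map_comp_symRel]

/-- The quotient is by a maximal subobject on which `x` vanishes, provided by the Noetherian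
condition. It contains every `g` that kills `x`, since by separatedness `x` also vanishes on the
image of `U ⊞ V`. -/
theorem exists_coimage [∀ X : C, IsNoetherianObject X] (hA : A.IsSeparated) {X : C} (x : A.obj X) :
    ∃ (Y : C) (p : X ⟶ Y) (_ : Epi p), VanishesOnKernel p x ∧
      ∀ ⦃V : C⦄ (g : V ⟶ X), A.map g x = 0 → g ≫ p = 0 := by
  obtain ⟨U, hU, hmax⟩ := WellFounded.has_min (wellFounded_gt (α := Subobject X))
    {U | A.map U.arrow x = 0} ⟨⊥, by
      have : (⊥ : Subobject X).arrow = 0 := Subobject.bot_arrow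
      change A.map _ x = 0
      rw [this, map_zero_hom]⟩
  refine ⟨_, cokernel.π U.arrow, inferInstance, fun V g hg => ?_, fun V g hg => ?_⟩
  · have := Abelian.monoLift_comp U.arrow g hg
    rw [← this, A.map_comp, show A.map U.arrow x = 0 from hU, map_zero]
  · let d : (U : C) ⊞ V ⟶ X := biprod.desc U.arrow g
    have hd : A.map (imageSubobject d).arrow x = 0 := by
      refine hA (factorThruImageSubobject d) inferInstance _ ?_
      rw [← A.map_comp, imageSubobject_arrow_comp]
      have : d = biprod.fst ≫ U.arrow + biprod.snd ≫ g := biprod.desc_eq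
      rw [this, A.map_add_hom, A.map_comp, A.map_comp, show A.map U.arrow x = 0 from hU, hg,
        map_zero, map_zero, add_zero]
    have hle : U ≤ imageSubobject d := by
      refine Subobject.le_of_comm (biprod.inl ≫ factorThruImageSubobject d) ?_
      rw [Category.assoc, imageSubobject_arrow_comp, biprod.inl_desc]
    have heq : U = imageSubobject d := by
      by_contra hne
      exact hmax _ hd (lt_of_le_of_ne hle hne)
    have hg' : g = (biprod.inr ≫ factorThruImageSubobject d ≫
        ((imageSubobject d).ofLE U heq.ge)) ≫ U.arrow := by
      simp only [Category.assoc, Subobject.ofLE_arrow, imageSubobject_arrow_comp]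
      exact (biprod.inr_desc _ _).symm
    rw [hg', Category.assoc, cokernel.condition, comp_zero]

/-- The point where the MN hypothesis is used. The restriction `z` of `x` to the preimage of `L` is
nonzero, so no power of it vanishes. If `L` is not the unit, `Sym ^ n L = 0` kills `z ^ n`; if `L`
is the unit and `l` does not split, the vanishing power of `l` does. The remaining case is a split
unit, and a retraction is the required form. -/
theorem exists_comp_ne_zero (hC : IsMN C) (hA : A.IsSeparated) [A.IsIntegral] [Simple (𝟙_ C)]
    {X Y : C} {x : A.obj X}
    {p : X ⟶ Y} [Epi p] (h : VanishesOnKernel p x)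
    (h' : ∀ ⦃V : C⦄ (g : V ⟶ X), A.map g x = 0 → g ≫ p = 0) {L : C} [Simple L] (l : L ⟶ Y)
    [Mono l] : ∃ ψ : Y ⟶ 𝟙_ C, l ≫ ψ ≠ 0 := by
  set j := pullback.fst p l
  set q := pullback.snd p l
  have hjq : j ≫ p = q ≫ l := pullback.condition
  have hz : A.map j x ≠ 0 := by
    intro h0
    have h1 := h' j h0
    rw [hjq] at h1
    have hl : l = 0 := by
      rw [← cancel_epi q, h1, comp_zero]
    exact id_nonzero L (by rw [← cancel_mono l, hl, comp_zero, comp_zero])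
  by_cases hL : Nonempty (L ≅ 𝟙_ C)
  · obtain ⟨e⟩ := hL
    by_cases hs : IsSplitMono (e.inv ≫ l)
    · refine ⟨retraction (e.inv ≫ l), fun h0 => ?_⟩
      have h1 := IsSplitMono.id (e.inv ≫ l)
      rw [Category.assoc, h0, comp_zero] at h1
      exact id_nonzero (𝟙_ C) h1.symm
    · obtain ⟨n, hn⟩ := hC.unitSymPow_eq_zero _ (e.inv ≫ l) inferInstance hs
      refine absurd ?_ (A.pow_ne_zero hz n)
      rw [← map_pow]
      refine h.map_pow_eq_zero hA _ ?_
      obtain ⟨u, hu⟩ := exists_tensorPowMap_eq (e.inv ≫ l) n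
      have : j ≫ p = (q ≫ e.hom) ≫ (e.inv ≫ l) := by simp [hjq]
      rw [← Category.assoc, ← tensorPowMap_comp, this, tensorPowMap_comp, hu, Category.assoc,
        Category.assoc]
      change _ ≫ u ≫ unitSymPow (e.inv ≫ l) n = 0
      rw [hn, comp_zero, comp_zero]
  · obtain ⟨n, hn⟩ := hC.isZero_symPow L inferInstance hL
    refine absurd ?_ (A.pow_ne_zero hz n)
    have hq : VanishesOnKernel q (A.map j x) := by
      intro V g hg
      rw [← A.map_comp]
      refine h _ ?_
      rw [Category.assoc, hjq, reassoc_of% hg, zero_comp]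
    rw [← A.map_id _ (A.pow _ n)]
    exact hq.map_pow_eq_zero hA _ (hn.eq_of_tgt _ _)

/-- Among intersections of kernels of finitely many forms on the coimage, a minimal one exists by
the Artinian condition. If it were nonzero it would contain a simple subobject, and a form that is
nonzero there would shrink it. -/
theorem exists_linearForms [∀ X : C, IsNoetherianObject X] [∀ X : C, IsArtinianObject X]
    (hC : IsMN C) (hA : A.IsSeparated) [A.IsIntegral] [Simple (𝟙_ C)] {X : C} (x : A.obj X) :
    ∃ s : Finset (X ⟶ 𝟙_ C), ∀ ⦃V : C⦄ (g : V ⟶ X), (∀ φ ∈ s, g ≫ φ = 0) → A.map g x = 0 := by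
  classical
  obtain ⟨Y, p, _, h, h'⟩ := exists_coimage hA x
  obtain ⟨N, ⟨s, rfl⟩, hmin⟩ := WellFounded.has_min (wellFounded_lt (α := Subobject Y))
    (Set.range fun s : Finset (Y ⟶ 𝟙_ C) => s.inf fun φ => kernelSubobject φ)
    ⟨_, ⟨∅, rfl⟩⟩
  set N := s.inf fun φ => kernelSubobject φ with hN
  have hle (ψ : Y ⟶ 𝟙_ C) : N ≤ kernelSubobject ψ := by
    have h1 : (insert ψ s).inf (fun φ => kernelSubobject φ) = kernelSubobject ψ ⊓ N :=
      Finset.inf_insert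
    by_contra hcon
    exact hmin _ ⟨insert ψ s, rfl⟩ (h1.trans_lt (lt_of_le_of_ne inf_le_right fun h2 =>
      hcon (inf_eq_right.1 h2)))
  have hzero : IsZero (N : C) := by
    by_contra hne
    obtain ⟨ψ, hψ⟩ := exists_comp_ne_zero hC hA h h' (simpleSubobjectArrow hne ≫ N.arrow)
    apply hψ
    have : N.arrow ≫ ψ = 0 := by
      rw [← Subobject.ofLE_arrow (hle ψ), Category.assoc, kernelSubobject_arrow_comp, comp_zero]
    rw [Category.assoc, this, comp_zero]
  refine ⟨s.image (p ≫ ·), fun V g hg => h g ?_⟩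
  have hf : N.Factors (g ≫ p) := (Subobject.finset_inf_factors _).2 fun ψ hψ =>
    kernelSubobject_factors _ _ (by
      rw [Category.assoc]
      exact hg _ (Finset.mem_image_of_mem _ hψ))
  rw [← Subobject.factorThru_arrow _ _ hf, hzero.eq_of_tgt (N.factorThru _ hf) 0, zero_comp]

end Nilpotency

/-! ### Expansion of an element in linear forms, with fractions as coefficients. -/

section Expansion

variable {k : Type*} [Field k] {C : Type u} [Category.{v} C] [Abelian C] [Linear k C]
  [MonoidalCategory C] [SymmetricCategory C] {A : LaxAlgebra.{w} C}

/-- Independent forms make `X ⟶ 𝟙 ^ n` an epimorphism. A section need not exist, but the `n`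
standard inclusions of the unit lift simultaneously after one cover `p` of the unit. -/
theorem exists_dual_basis [Simple (𝟙_ C)] (h : ∀ f : 𝟙_ C ⟶ 𝟙_ C, ∃ a : k, f = a • 𝟙 _) {X : C}
    {n : ℕ} (φ : Fin n → (X ⟶ 𝟙_ C)) (hφ : LinearIndependent k φ) :
    ∃ (Z : C) (p : Z ⟶ 𝟙_ C) (_ : Epi p) (s : Fin n → (Z ⟶ X)),
      ∀ i j, s i ≫ φ j = if i = j then p else 0 := by
  let f : X ⟶ ⨁ fun _ : Fin n => 𝟙_ C := biproduct.lift φ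
  have hf : Epi f := by
    refine Preadditive.epi_of_cancel_zero _ fun {Z} g hg => ?_
    ext j
    rw [comp_zero]
    refine eq_zero_of_sum_comp_eq_zero h φ hφ (fun j => biproduct.ι (fun _ : Fin n => 𝟙_ C) j ≫ g)
      ?_ j
    rw [← hg]
    simp only [f, biproduct.lift_eq, Preadditive.sum_comp, Category.assoc]
  obtain ⟨Z, p, hp, y, hy⟩ := surjective_up_to_refinements_of_epi
    (biproduct.map fun _ : Fin n => f)
    (biproduct.lift fun i => biproduct.ι (fun _ : Fin n => 𝟙_ C) i)
  refine ⟨Z, p, hp, fun i => y ≫ biproduct.π _ i, fun i j => ?_⟩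
  have h1 := (hy =≫ biproduct.π _ i) =≫ biproduct.π _ j
  simp only [Category.assoc, biproduct.lift_π, biproduct.map_π, biproduct.ι_π, f] at h1
  rw [Category.assoc, ← h1]
  split_ifs with hij
  · subst hij
    simp
  · simp

variable [HasDuals C] [MonoidalPreadditive C]

/-- Restriction along the dual vector `s i` isolates the product of `y i` with the restriction of
`1` along `p`, which is nonzero by separatedness. -/
theorem eq_zero_of_sum_mul_eq_zero [Simple (𝟙_ C)] (h : ∀ f : 𝟙_ C ⟶ 𝟙_ C, ∃ a : k, f = a • 𝟙 _)
    (hA : A.IsSeparated) [A.IsIntegral] {X Y : C} {n : ℕ} (φ : Fin n → (X ⟶ 𝟙_ C))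
    (hφ : LinearIndependent k φ) (y : Fin n → A.obj Y)
    (hy : ∑ i, A.mul (y i) (A.map (φ i) A.one) = 0) (i : Fin n) : y i = 0 := by
  obtain ⟨Z, p, hp, s, hs⟩ := exists_dual_basis h φ hφ
  have h1 : A.map p A.one ≠ 0 := fun h0 => IsIntegral.one_ne_zero (hA p hp _ h0)
  by_contra hne
  refine A.mul_ne_zero hne h1 ?_
  have h2 := congrArg (A.map (Y ◁ s i)) hy
  rw [map_sum, map_zero] at h2
  rw [← h2, Finset.sum_eq_single i]
  · rw [map_whiskerLeft, ← A.map_comp, hs, if_pos rfl]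
  · intro j _ hj
    rw [map_whiskerLeft, ← A.map_comp, hs, if_neg hj.symm, map_zero_hom, map_zero]
  · simp

/-- By `exists_linearForms`, two restrictions of `x` agree as soon as the two maps agree after
composition with all `φ j`. Multiplication by a restriction of `1` is itself a restriction, so both
the proportionality of numerators and denominator and the expansion reduce to identities between
morphisms to the unit. -/
theorem exists_expansion [∀ X : C, IsNoetherianObject X] [∀ X : C, IsArtinianObject X]
    [Simple (𝟙_ C)] (h : ∀ f : 𝟙_ C ⟶ 𝟙_ C, ∃ a : k, f = a • 𝟙 _)
    (hC : IsMN C) (hA : A.IsSeparated) [A.IsIntegral] {X : C} (x : A.obj X) :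
    ∃ (n : ℕ) (φ : Fin n → (X ⟶ 𝟙_ C)) (Z : C) (d : A.obj Z) (_ : d ≠ 0)
      (z : Fin n → FractionField.numerators d),
      A.mul d x = ∑ i, A.mul (z i).1 (A.map (φ i) A.one) := by
  obtain ⟨s, hs⟩ := exists_linearForms hC hA x
  let W := Submodule.span k (s : Set (X ⟶ 𝟙_ C))
  have : FiniteDimensional k W := FiniteDimensional.span_finset k s
  let b := Module.finBasis k W
  let φ : Fin (Module.finrank k W) → (X ⟶ 𝟙_ C) := fun i => (b i : X ⟶ 𝟙_ C)
  have hφ : LinearIndependent k φ := b.linearIndependent.map' W.subtype (Submodule.ker_subtype W)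
  have hs' : ∀ ⦃V : C⦄ (g : V ⟶ X), (∀ i, g ≫ φ i = 0) → A.map g x = 0 := by
    intro V g hg
    refine hs g fun ψ hψ => ?_
    have h1 : ψ = ∑ i, b.repr ⟨ψ, Submodule.subset_span hψ⟩ i • φ i := by
      have h2 := congrArg W.subtype (b.sum_repr ⟨ψ, Submodule.subset_span hψ⟩)
      simp only [map_sum, map_smul] at h2
      exact h2.symm
    rw [h1, Preadditive.comp_sum]
    exact Finset.sum_eq_zero fun i _ => by rw [Linear.comp_smul, hg, smul_zero]
  have hs'' : ∀ ⦃V : C⦄ (g g' : V ⟶ X), (∀ i, g ≫ φ i = g' ≫ φ i) → A.map g x = A.map g' x := by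
    intro V g g' hg
    rw [← sub_eq_zero, ← map_sub_hom]
    exact hs' _ fun i => by rw [Preadditive.sub_comp, hg, sub_self]
  obtain ⟨Z, p, hp, t, ht⟩ := exists_dual_basis h φ hφ
  have hd : A.map p A.one ≠ 0 := fun h0 => IsIntegral.one_ne_zero (hA p hp _ h0)
  have h₁ {V : C} (y : A.obj V) : A.mul (A.map p A.one) y = A.map (p ▷ V ≫ (λ_ V).hom) y := by
    rw [← map_whiskerRight, A.one_mul, A.map_comp]
  have h₂ {V V' : C} (f : V' ⟶ 𝟙_ C) (y : A.obj V) :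
      A.mul y (A.map f A.one) = A.map (V ◁ f ≫ (ρ_ V).hom) y := by
    rw [← map_whiskerLeft, A.mul_one, A.map_comp]
  -- With a dual basis `t` over `p`, the common denominator is the restriction of `1` along `p`, and
  -- the numerators are the values of `x` on the dual vectors.
  refine ⟨_, φ, Z, A.map p A.one, hd, fun i => ⟨A.map (t i) x, ?_⟩, ?_⟩
  · change A.mul _ _ = A.mul _ _
    rw [h₁, h₂, ← A.map_comp, ← A.map_comp]
    refine hs'' _ _ fun j => ?_
    rw [Category.assoc, Category.assoc, Category.assoc, Category.assoc, ht]
    split_ifs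
    · rw [← leftUnitor_naturality, ← rightUnitor_naturality, whisker_exchange_assoc, unitors_equal]
    · simp
  · dsimp only
    simp_rw [h₁, h₂, ← A.map_comp]
    rw [← map_sum_hom]
    refine hs'' _ _ fun j => ?_
    rw [Preadditive.sum_comp, Finset.sum_eq_single j]
    · rw [Category.assoc, Category.assoc, Category.assoc, ht, if_pos rfl, ← leftUnitor_naturality,
        ← rightUnitor_naturality, whisker_exchange_assoc, unitors_equal]
    · intro i _ hij
      rw [Category.assoc, Category.assoc, ht, if_neg hij, comp_zero, comp_zero]
    · simp

end Expansion

end LaxAlgebra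
end TensorCat

end
noncomputable section

namespace TensorCat

/-- Expansion in a basis of `M`, keeping only the terms with nonzero coefficient. -/
theorem exists_sum_tmul_linearIndependent (k : Type*) [Field k] {M N : Type*} [AddCommGroup M]
    [Module k M] [AddCommGroup N] [Module k N] (t : TensorProduct k M N) :
    ∃ (n : ℕ) (φ : Fin n → M) (z : Fin n → N), LinearIndependent k φ ∧ (∀ i, z i ≠ 0) ∧
      t = ∑ i, TensorProduct.tmul k (φ i) (z i) := by
  classical
  let b := Module.Basis.ofVectorSpace k M
  let f := TensorProduct.equivFinsuppOfBasisLeft (N := N) b t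
  refine ⟨f.support.card, fun i => b (f.support.equivFin.symm i),
    fun i => f (f.support.equivFin.symm i), ?_, fun i => ?_, ?_⟩
  · exact b.linearIndependent.comp _
      (Subtype.val_injective.comp f.support.equivFin.symm.injective)
  · exact Finsupp.mem_support_iff.1 (f.support.equivFin.symm i).2
  · have h : (TensorProduct.equivFinsuppOfBasisLeft (N := N) b).symm f = t :=
      LinearEquiv.symm_apply_apply _ _
    rw [TensorProduct.equivFinsuppOfBasisLeft_symm_apply, Finsupp.sum,
      ← Finset.sum_coe_sort f.support] at h
    rw [← h]
    exact (f.support.equivFin.symm.sum_comp fun i => TensorProduct.tmul k (b i) (f i)).symm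

namespace LaxAlgebra

open FractionField TensorProduct

theorem sum_mul_sum {C : Type u} [Category.{v} C] [Preadditive C] [MonoidalCategory C]
    [SymmetricCategory C] (A : LaxAlgebra.{w} C) {X Y : C} {ι ι' : Type*} [Fintype ι] [Fintype ι']
    (x : ι → A.obj X) (y : ι' → A.obj Y) :
    A.mul (∑ i, x i) (∑ j, y j) = ∑ i : ι × ι', A.mul (x i.1) (y i.2) := by
  rw [Fintype.sum_prod_type, map_sum A.mul, AddMonoidHom.finsetSum_apply]
  exact Finset.sum_congr rfl fun i _ => map_sum _ _ _

section UnitAlgebra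

variable (k : Type*) [Field k] {C : Type u} [Category.{v} C] [Preadditive C] [Linear k C]
  [MonoidalCategory C] [SymmetricCategory C] [MonoidalPreadditive C]

/-- The values of the unit algebra, with the linear structure of the category. -/
def unitAlgebraEquiv (X : C) : (unitAlgebra C).obj X ≃ₗ[k] (X ⟶ 𝟙_ C) where
  toFun φ := φ
  map_add' _ _ := rfl
  map_smul' a φ := by
    change (a • 𝟙 X) ≫ (show X ⟶ 𝟙_ C from φ) = a • (show X ⟶ 𝟙_ C from φ)
    rw [Linear.smul_comp, Category.id_comp]
  invFun φ := φ
  left_inv _ := rfl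
  right_inv _ := rfl

/-- The unit of a lax algebra. -/
def unitHom (A : LaxAlgebra.{w} C) : Hom (unitAlgebra C) A where
  app X := AddMonoidHom.mk' (fun φ => A.map (show X ⟶ 𝟙_ C from φ) A.one)
    fun _ _ => A.map_add_hom _ _ _
  naturality _ _ := A.map_comp _ _ _
  map_mul {X Y} φ ψ := by
    change A.map ((φ ⊗ₘ ψ) ≫ (λ_ (𝟙_ C)).hom) A.one = A.mul (A.map φ A.one) (A.map ψ A.one)
    rw [A.map_comp, ← A.one_mul]
    exact A.map_mul _ _ _ _
  map_one := A.map_id _ _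

variable {k}

theorem linearIndependent_unitAlgebraEquiv {X : C} {ι : Type*} {φ : ι → (unitAlgebra C).obj X}
    (h : LinearIndependent k φ) : LinearIndependent (ι := ι) (M := X ⟶ 𝟙_ C) k φ :=
  h.map' (unitAlgebraEquiv k X).toLinearMap (LinearEquiv.ker _)

end UnitAlgebra

/-! ### The embedding into an extension of scalars of the algebra of linear forms. -/

section Universal

variable {k : Type*} [Field k] {C : Type u} [Category.{v} C] [Abelian C] [Linear k C]
  [MonoidalCategory C] [SymmetricCategory C] [MonoidalPreadditive C] [MonoidalLinear k C]
  {A : LaxAlgebra.{w} C} [A.IsIntegral] {K : Type w'} [Field K] [Algebra k K]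
  (e : A.FractionField →ₐ[k] K)

/-- The value `q` is represented by the sum `τ` of linear forms with coefficients in fractions. -/
def Represents {X : C} (q : A.obj X) (τ : (unitAlgebra C).obj X ⊗[k] K) : Prop :=
  ∃ (Z : C) (d : A.obj Z) (hd : d ≠ 0) (ι : Type) (_ : Fintype ι)
    (φ : ι → (unitAlgebra C).obj X) (z : ι → numerators d),
    A.mul d q = ∑ i, A.mul (z i).1 (A.unitHom.app X (φ i)) ∧ τ = ∑ i, φ i ⊗ₜ[k] e (frac hd (z i))

variable {e}

theorem Represents.add {X : C} {q q' : A.obj X} {τ τ' : (unitAlgebra C).obj X ⊗[k] K}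
    (h : Represents e q τ) (h' : Represents e q' τ') : Represents e (q + q') (τ + τ') := by
  obtain ⟨Z, d, hd, ι, _, φ, z, h₁, rfl⟩ := h
  obtain ⟨Z', d', hd', ι', _, φ', z', h₁', rfl⟩ := h'
  refine ⟨Z ⊗ Z', A.mul d d', A.mul_ne_zero hd hd', ι ⊕ ι', inferInstance, Sum.elim φ φ',
    Sum.elim (fun i => ⟨_, mul_mem_numerators (z i).2 (den_mem_numerators d')⟩)
      (fun i => ⟨_, mul_mem_numerators (den_mem_numerators d) (z' i).2⟩), ?_, ?_⟩
  · rw [Fintype.sum_sum_type, map_add]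
    congr 1
    · rw [A.mul_right_comm, h₁, map_sum, AddMonoidHom.finsetSum_apply, map_sum]
      exact Finset.sum_congr rfl fun i _ => (A.mul_right_comm _ _ _).symm
    · rw [A.mul_assoc, h₁', map_sum, map_sum]
      exact Finset.sum_congr rfl fun i _ => (A.mul_assoc _ _ _).symm
  · rw [Fintype.sum_sum_type]
    congr 1
    · exact Finset.sum_congr rfl fun i _ => by
        rw [Sum.elim_inl, Sum.elim_inl, frac_mul_den hd _ hd']
    · exact Finset.sum_congr rfl fun i _ => by
        rw [Sum.elim_inr, Sum.elim_inr, frac_den_mul hd' _ hd]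

theorem Represents.map {X Y : C} (f : X ⟶ Y) {q : A.obj Y} {τ : (unitAlgebra C).obj Y ⊗[k] K}
    (h : Represents e q τ) :
    Represents e (A.map f q) (((unitAlgebra C).baseChange k K).map f τ) := by
  obtain ⟨Z, d, hd, ι, _, φ, z, h₁, rfl⟩ := h
  refine ⟨Z, d, hd, ι, inferInstance, fun i => (unitAlgebra C).map f (φ i), z, ?_, ?_⟩
  · rw [← map_whiskerLeft, h₁, map_sum]
    refine Finset.sum_congr rfl fun i _ => ?_
    rw [map_whiskerLeft, ← A.unitHom.naturality]
  · exact map_sum (((unitAlgebra C).mapₗ k f).rTensor K) _ _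

theorem Represents.neg {X : C} {q : A.obj X} {τ : (unitAlgebra C).obj X ⊗[k] K}
    (h : Represents e q τ) : Represents e (-q) (-τ) := by
  have := h.map (-𝟙 X)
  rw [map_neg_hom, A.map_id] at this
  refine (congrArg (Represents e (-q)) ?_).mp this
  exact (map_neg_hom _ _ _).trans (congrArg _ (LaxAlgebra.map_id _ _ _))

theorem Represents.mul {X Y : C} {q : A.obj X} {τ : (unitAlgebra C).obj X ⊗[k] K}
    {q' : A.obj Y} {τ' : (unitAlgebra C).obj Y ⊗[k] K} (h : Represents e q τ)
    (h' : Represents e q' τ') :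
    Represents e (A.mul q q') (((unitAlgebra C).baseChange k K).mul τ τ') := by
  obtain ⟨Z, d, hd, ι, _, φ, z, h₁, rfl⟩ := h
  obtain ⟨Z', d', hd', ι', _, φ', z', h₁', rfl⟩ := h'
  refine ⟨Z ⊗ Z', A.mul d d', A.mul_ne_zero hd hd', ι × ι', inferInstance,
    fun i => (unitAlgebra C).mul (φ i.1) (φ' i.2),
    fun i => ⟨_, mul_mem_numerators (z i.1).2 (z' i.2).2⟩, ?_, ?_⟩
  · rw [A.mul_mul_mul_comm, h₁, h₁', sum_mul_sum, map_sum]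
    refine Finset.sum_congr rfl fun i _ => ?_
    rw [← A.mul_mul_mul_comm, A.unitHom.map_mul]
  · refine (sum_mul_sum ((unitAlgebra C).baseChange k K)
      (fun i => (φ i ⊗ₜ[k] e (frac hd (z i)) : (unitAlgebra C).obj X ⊗[k] K)) _).trans ?_
    refine Finset.sum_congr rfl fun i _ => ?_
    rw [← frac_mul_frac hd _ hd', map_mul]
    rfl

theorem represents_one : Represents e A.one ((unitAlgebra C).baseChange k K).one := by
  refine ⟨𝟙_ C, A.one, IsIntegral.one_ne_zero, Unit, inferInstance, fun _ => 𝟙 (𝟙_ C),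
    fun _ => ⟨A.one, den_mem_numerators _⟩, ?_, ?_⟩
  · rw [Finset.univ_unique, Finset.sum_singleton]
    exact congrArg (A.mul A.one) A.unitHom.map_one.symm
  · rw [Finset.univ_unique, Finset.sum_singleton, frac_self, map_one]
    rfl

variable (k A) in
/-- Evaluation of sums of linear forms with coefficients in numerators. -/
def evalNumerators (X : C) {Z : C} (d : A.obj Z) :
    (unitAlgebra C).obj X ⊗[k] numeratorSubmodule k d →ₗ[k] A.obj (Z ⊗ X) :=
  TensorProduct.lift <| LinearMap.mk₂ k (fun φ z => A.mul z.1 (A.unitHom.app X φ))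
    (fun φ φ' z => by rw [map_add, map_add])
    (fun a φ z => by rw [Hom.map_smul, mul_smul_right])
    (fun φ z z' => by
      change A.mul (z.1 + z'.1) _ = _
      rw [map_add]
      rfl)
    (fun a φ z => mul_smul_left _ _ _ _)

/-- With the denominator fixed, a representation becomes a single tensor over `k`, to which flatness
and linear independence apply. -/
theorem Represents.exists_evalNumerators {X : C} {q : A.obj X} {τ : (unitAlgebra C).obj X ⊗[k] K}
    (h : Represents e q τ) : ∃ (Z : C) (d : A.obj Z) (hd : d ≠ 0)
      (t : (unitAlgebra C).obj X ⊗[k] numeratorSubmodule k d),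
      A.mul d q = evalNumerators k A X d t ∧
      τ = (e.toLinearMap ∘ₗ fracₗ k hd).lTensor ((unitAlgebra C).obj X) t := by
  obtain ⟨Z, d, hd, ι, _, φ, z, h₁, rfl⟩ := h
  refine ⟨Z, d, hd, ∑ i, φ i ⊗ₜ[k] (⟨(z i).1, (z i).2⟩ : numeratorSubmodule k d), ?_, ?_⟩
  · rw [h₁, map_sum]
    rfl
  · rw [map_sum]
    rfl

/-- Numerators over `d` embed into `K`, and tensoring over a field preserves this. So the tensor of
numerators is zero, `d q = 0`, and integrality gives `q = 0`. This is the injectivity of the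
embedding. -/
theorem Represents.eq_zero_of_right_eq_zero {X : C} {q : A.obj X} (h : Represents e q 0) :
    q = 0 := by
  obtain ⟨Z, d, hd, t, h₁, h₂⟩ := h.exists_evalNumerators
  have ht : t = 0 := by
    refine Module.Flat.lTensor_preserves_injective_linearMap
      (e.toLinearMap ∘ₗ fracₗ k hd) ?_ (h₂.symm.trans (map_zero _).symm)
    exact e.toRingHom.injective.comp (fracₗ_injective hd)
  rw [ht, map_zero] at h₁
  by_contra hq
  exact A.mul_ne_zero hd hq h₁

variable [HasDuals C] [Simple (𝟙_ C)]

/-- Once the tensor of numerators is written with independent forms, the relation `d q = 0` kills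
each numerator. This makes the representing tensor unique. -/
theorem Represents.eq_zero_of_left_eq_zero (hk : ∀ f : 𝟙_ C ⟶ 𝟙_ C, ∃ a : k, f = a • 𝟙 _)
    (hA : A.IsSeparated) {X : C} {τ : (unitAlgebra C).obj X ⊗[k] K}
    (h : Represents e (0 : A.obj X) τ) : τ = 0 := by
  obtain ⟨Z, d, hd, t, h₁, rfl⟩ := h.exists_evalNumerators
  obtain ⟨n, φ, z, hφ, -, rfl⟩ := exists_sum_tmul_linearIndependent k t
  rw [map_zero, map_sum] at h₁
  have h₂ := eq_zero_of_sum_mul_eq_zero hk hA φ (linearIndependent_unitAlgebraEquiv hφ)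
    (fun i => (z i).1) h₁.symm
  have h₃ : ∀ i, z i = 0 := fun i => Subtype.ext (h₂ i)
  simp [h₃]

theorem Represents.unique (hk : ∀ f : 𝟙_ C ⟶ 𝟙_ C, ∃ a : k, f = a • 𝟙 _)
    (hA : A.IsSeparated) {X : C} {q : A.obj X} {τ τ' : (unitAlgebra C).obj X ⊗[k] K}
    (h : Represents e q τ) (h' : Represents e q τ') : τ = τ' := by
  have h₁ := h.add h'.neg
  rw [add_neg_cancel] at h₁
  exact eq_of_sub_eq_zero ((sub_eq_add_neg _ _).trans (h₁.eq_zero_of_left_eq_zero hk hA))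

variable [∀ X : C, IsNoetherianObject X] [∀ X : C, IsArtinianObject X]

theorem exists_represents (hk : ∀ f : 𝟙_ C ⟶ 𝟙_ C, ∃ a : k, f = a • 𝟙 _)
    (hC : IsMN C) (hA : A.IsSeparated) {X : C} (q : A.obj X) :
    ∃ τ : (unitAlgebra C).obj X ⊗[k] K, Represents e q τ := by
  obtain ⟨n, φ, Z, d, hd, z, h⟩ := exists_expansion hk hC hA q
  exact ⟨_, Z, d, hd, Fin n, inferInstance, φ, z, h, rfl⟩

/-- A separated integral lax algebra over a maximally nilpotent category embeds into an extension of
scalars of the unit algebra. -/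
theorem exists_isInjective_hom_baseChange (e : A.FractionField →ₐ[k] K)
    (hk : ∀ f : 𝟙_ C ⟶ 𝟙_ C, ∃ a : k, f = a • 𝟙 _)
    (hC : IsMN C) (hA : A.IsSeparated) :
    ∃ θ : Hom A ((unitAlgebra C).baseChange k K), θ.IsInjective := by
  choose τ hτ using fun (X : C) (q : A.obj X) => exists_represents (e := e) hk hC hA q
  -- Representing tensors are compatible with sums, restrictions, products and the unit, so by
  -- uniqueness the chosen ones form a morphism of lax algebras.
  have huniq {X : C} {q : A.obj X} {σ} (h : Represents e q σ) : τ X q = σ :=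
    (hτ X q).unique hk hA h
  exact ⟨
    { app X := AddMonoidHom.mk' (τ X) fun q q' => huniq ((hτ X q).add (hτ X q'))
      naturality f q := huniq ((hτ _ q).map f)
      map_mul q q' := huniq ((hτ _ q).mul (hτ _ q'))
      map_one := huniq represents_one },
    fun X q hq => Represents.eq_zero_of_right_eq_zero (e := e) <|
      (congrArg (Represents e q) (show τ X q = 0 from hq)).mp (hτ X q)⟩

end Universal

end LaxAlgebra
end TensorCat

end
noncomputable section

namespace TensorCat

namespace LaxAlgebra

/-! ### Size bounds, from representatives over a small model of the category. -/

section Small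

variable {C : Type u₁} [Category.{v} C] [Abelian C] [MonoidalCategory C] [SymmetricCategory C]
  [EssentiallySmall.{v} C]

instance {D : Type u₂} [Category.{v} D] [Abelian D] [MonoidalCategory D] [SymmetricCategory D]
    (F : C ⥤ D) [F.Braided] [F.Additive] [PreservesFiniteLimits F] (A : LaxAlgebra.{v} C) (Y : D) :
    Small.{v} (Ext F A Y) := by
  let e := equivSmallModel.{v} C
  refine small_of_surjective
    (α := Σ X : SmallModel.{v} C, A.obj (e.inverse.obj X) × (Y ⟶ F.obj (e.inverse.obj X)))
    (f := fun s => Ext.mk s.2.1 s.2.2) fun y => ?_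
  induction y using Ext.ind with | h x f => ?_
  rename_i X
  refine ⟨⟨e.functor.obj X, A.map (e.unitIso.inv.app X) x, f ≫ F.map (e.unitIso.hom.app X)⟩, ?_⟩
  dsimp only
  rw [Ext.mk_map, Category.assoc, ← F.map_comp, Iso.hom_inv_id_app]
  exact congrArg _ ((congrArg _ (F.map_id _)).trans (Category.comp_id f))

instance (A : LaxAlgebra.{w} C) (I : A.Ideal) (X : C) [Small.{v} (A.obj X)] :
    Small.{v} (I.quotient.obj X) :=
  small_of_surjective (I.proj_surjective X)

instance (A : LaxAlgebra.{w} C) [A.IsIntegral] [∀ X, Small.{v} (A.obj X)] :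
    Small.{v} A.FractionField := by
  let e := equivSmallModel.{v} C
  refine small_of_surjective
    (α := Σ X : SmallModel.{v} C, {x : A.obj (e.inverse.obj X) × A.obj (e.inverse.obj X) //
      ∃ _ : x.2 ≠ 0, x.1 ∈ FractionField.numerators x.2})
    (f := fun s => FractionField.frac s.2.2.1 ⟨s.2.1.1, s.2.2.2⟩) fun r => ?_
  obtain ⟨X, d, hd, x, rfl⟩ := FractionField.exists_frac r
  have hd' : A.map (e.unitIso.inv.app X) d ≠ 0 := fun h =>
    hd (A.map_injective_of_isIso (e.unitIso.inv.app X) (h.trans (map_zero _).symm))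
  exact ⟨⟨e.functor.obj X, ⟨A.map (e.unitIso.inv.app X) x.1, A.map (e.unitIso.inv.app X) d⟩, hd',
    FractionField.map_mem_numerators _ x.2⟩, FractionField.frac_map _ _ hd x⟩

end Small

variable {k : Type*} [Field k] {C : Type u₁} [Category.{v} C] [Abelian C]
  [MonoidalCategory C] [SymmetricCategory C]
  {D : Type u₂} [Category.{v} D] [Abelian D] [Linear k D] [MonoidalCategory D] [SymmetricCategory D]
  (F : C ⥤ D) [F.Braided] [F.Additive]

open Functor.LaxMonoidal Functor.OplaxMonoidal Functor.Monoidal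

/-! ### Transfer of an integral lax algebra along a tensor functor. -/

section Embedding

variable [MonoidalPreadditive C] [PreservesFiniteLimits F] [PreservesFiniteColimits F]

/-- The images of the nonzero elements of `A` form a multiplicative family, by integrality, and this
family avoids zero because `A` embeds into its extension. -/
theorem exists_isPrime_extension [HasDuals C] [HasDuals D] [MonoidalPreadditive D]
    (A : LaxAlgebra.{w} C) [A.IsIntegral] (hA : A.IsSeparated)
    (hF : ∀ {X Y : C} (f : X ⟶ Y), Epi (F.map f) → Epi f) :
    ∃ P : (extension F A).Ideal, P.IsPrime ∧ ∀ {X : C} (x : A.obj X), x ≠ 0 →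
      Ext.mk x (𝟙 (F.obj X)) ∉ P.carrier (F.obj X) := by
  refine (Ideal.exists_isPrime (isSeparated_extension F hA)
    -- Any isomorphism `f` is allowed, not only the identity: the unit and the products live over
    -- `𝟙` and `F X ⊗ F X'`, which are only isomorphic to values of `F`.
    (fun Y => {e | ∃ (X : C) (x : A.obj X) (f : Y ⟶ F.obj X), x ≠ 0 ∧ IsIso f ∧ e = Ext.mk x f})
    ?_ ?_ ?_).imp fun P ⟨hP, h⟩ =>
      ⟨hP, fun {X} x hx => h _ _ ⟨X, x, 𝟙 _, hx, inferInstance, rfl⟩⟩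
  · rintro Y ⟨X, x, f, hx, hf, h0⟩
    refine hx (toExtension_isInjective F hF hA X x ?_)
    have := congrArg ((extension F A).map (inv f)) h0
    rw [map_zero, extension_map_mk, IsIso.inv_hom_id] at this
    exact this.symm
  · exact ⟨_, A.one, ε F, IsIntegral.one_ne_zero, inferInstance, rfl⟩
  · rintro Y Y' _ _ ⟨X, x, f, hx, hf, rfl⟩ ⟨X', x', f', hx', hf', rfl⟩
    refine ⟨Y ⊗ Y', 𝟙 _, X ⊗ X', A.mul x x', (f ⊗ₘ f') ≫ μ F X X', A.mul_ne_zero hx hx',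
      inferInstance, ?_⟩
    rw [LaxAlgebra.map_id, extension_mul_mk]

variable [EssentiallySmall.{v} C] [EssentiallySmall.{v} D] [MonoidalPreadditive D]
  [MonoidalLinear k D] [HasDuals C] [HasDuals D] [Simple (𝟙_ D)]
  [∀ X : D, IsNoetherianObject X] [∀ X : D, IsArtinianObject X]

/-- A separated integral lax algebra embeds into the restriction of an extension of scalars of the
unit algebra of a maximally nilpotent category. -/
theorem exists_isInjective_hom_restrict (A : LaxAlgebra.{v} C) [A.IsIntegral]
    (hA : A.IsSeparated) (hF : ∀ {X Y : C} (f : X ⟶ Y), Epi (F.map f) → Epi f)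
    (hk : ∀ f : 𝟙_ D ⟶ 𝟙_ D, ∃ a : k, f = a • 𝟙 _) (hD : IsMN D) :
    ∃ (K : Type v) (_ : Field K) (_ : Algebra k K)
      (θ : Hom A (((unitAlgebra D).baseChange k K).restrict F)), θ.IsInjective := by
  obtain ⟨P, hP, h⟩ := exists_isPrime_extension F A hA hF
  have := hP.isIntegral_quotient
  have (X : D) : Small.{v} ((extension F A).obj X) := inferInstanceAs (Small.{v} (Ext F A X))
  -- The fraction field is replaced by a copy in `Type v`, so that the extension of scalars takes
  -- values in the universe of the presheaves underlying ind-objects.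
  obtain ⟨θ, hθ⟩ := exists_isInjective_hom_baseChange (A := P.quotient)
    (K := Shrink.{v} P.quotient.FractionField) (Shrink.algEquiv k _).symm.toAlgHom hk hD
    P.isSeparated_quotient
  refine ⟨_, inferInstance, inferInstance,
    ((toExtension F A).comp (P.proj.restrict F)).comp (θ.restrict F), fun X x hx => ?_⟩
  have h₁ := hθ _ _ hx
  by_contra hne
  exact h x hne ((P.proj_eq_zero_iff _).1 h₁)

end Embedding

/-! ### Nonzero elements of the target algebra generate the unit ideal. -/

section Simple

/-- Coherence for the image of a dual pair under `F`: the coevaluation of `X`, transported through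
the monoidal structure, is a coevaluation for `F.obj X`. -/
theorem map_coevaluation (X X' Z : C) [ExactPairing X X'] :
    F.map ((λ_ Z).inv ≫ η_ X X' ▷ Z ≫ (α_ X X' Z).hom) ≫ δ F X (X' ⊗ Z) ≫ F.obj X ◁ δ F X' Z =
      (λ_ (F.obj Z)).inv ≫ (ε F ≫ F.map (η_ X X') ≫ δ F X X') ▷ F.obj Z ≫ (α_ _ _ _).hom := by
  have h : F.map (λ_ Z).inv ≫ δ F (𝟙_ C) Z = (λ_ (F.obj Z)).inv ≫ ε F ▷ F.obj Z := by
    rw [Functor.OplaxMonoidal.left_unitality F Z]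
    simp
  rw [F.map_comp, F.map_comp, Category.assoc, Category.assoc,
    ← Functor.OplaxMonoidal.associativity, ← δ_natural_left_assoc, reassoc_of% h]
  simp

/-- The triangle identity for the transported dual pair. -/
theorem map_coevaluation_evaluation (X X' : C) [ExactPairing X X'] :
    (λ_ (F.obj X)).inv ≫ (ε F ≫ F.map (η_ X X') ≫ δ F X X') ▷ F.obj X ≫ (α_ _ _ _).hom ≫
      F.obj X ◁ (μ F X' X ≫ F.map (ε_ X X') ≫ η F) = (ρ_ (F.obj X)).inv := by
  have h := map_coevaluation F X X' X =≫ (F.obj X ◁ (μ F X' X ≫ F.map (ε_ X X') ≫ η F))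
  simp only [Category.assoc] at h
  rw [← h, ← MonoidalCategory.whiskerLeft_comp, δ_μ_assoc, MonoidalCategory.whiskerLeft_comp,
    δ_natural_right_assoc, ← F.map_comp_assoc, Category.assoc, Category.assoc,
    ExactPairing.evaluation_coevaluation, Iso.inv_hom_id_assoc,
    ← Functor.OplaxMonoidal.right_unitality]

/-- The tensor product with the transpose of `ψ` recovers the composition with `ψ`. -/
theorem map_coevaluation_comp (X X' Z : C) [ExactPairing X X'] (ψ : F.obj Z ⟶ F.obj X)
    (φ : F.obj X ⟶ 𝟙_ D) :
    F.map ((λ_ Z).inv ≫ η_ X X' ▷ Z ≫ (α_ X X' Z).hom) ≫ δ F X (X' ⊗ Z) ≫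
      (φ ⊗ₘ (δ F X' Z ≫ F.obj X' ◁ ψ ≫ μ F X' X ≫ F.map (ε_ X X') ≫ η F)) ≫ (λ_ (𝟙_ D)).hom =
      ψ ≫ φ := by
  have h := map_coevaluation F X X' Z =≫ (F.obj X ◁ F.obj X' ◁ ψ)
  simp only [Category.assoc] at h
  rw [MonoidalCategory.tensorHom_def', MonoidalCategory.whiskerLeft_comp,
    MonoidalCategory.whiskerLeft_comp, Category.assoc, Category.assoc, Category.assoc, reassoc_of% h,
    ← associator_naturality_right_assoc, ← whisker_exchange_assoc,
    ← leftUnitor_inv_naturality_assoc, reassoc_of% (map_coevaluation_evaluation F X X'),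
    ← rightUnitor_inv_naturality_assoc, unitors_equal, Iso.inv_hom_id, Category.comp_id]

variable [MonoidalPreadditive D] [MonoidalLinear k D] [Simple (𝟙_ D)] [HasDuals C]
  (K : Type w) [Field K] [Algebra k K]

theorem map_sum_mul {E : Type u} [Category.{v} E] [Preadditive E] [MonoidalCategory E]
    [SymmetricCategory E] (A : LaxAlgebra.{w} E) {X Y Z : E} {ι : Type*} [Fintype ι]
    (x : ι → A.obj X) (y : A.obj Y) (q : Z ⟶ X ⊗ Y) :
    A.map q (A.mul (∑ i, x i) y) = ∑ i, A.map q (A.mul (x i) y) := by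
  rw [map_sum A.mul, AddMonoidHom.finsetSum_apply, map_sum]

open TensorProduct in
/-- Nonzero elements of an extension of scalars of the unit algebra generate the unit ideal, if
epimorphisms to the unit can be dominated by epimorphisms to the unit in the source. -/
theorem exists_map_mul_eq_map_one (hk : ∀ f : 𝟙_ D ⟶ 𝟙_ D, ∃ a : k, f = a • 𝟙 _)
    (hF : ∀ {Y : D} (g : Y ⟶ 𝟙_ D), Epi g → ∃ (Z : C) (p : Z ⟶ 𝟙_ C) (_ : Epi p)
      (ψ : F.obj Z ⟶ Y), ψ ≫ g = F.map p ≫ η F)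
    {X : C} (x : (((unitAlgebra D).baseChange k K).restrict F).obj X) (hx : x ≠ 0) :
    ∃ (Y : C) (y : (((unitAlgebra D).baseChange k K).restrict F).obj Y) (Z : C) (p : Z ⟶ 𝟙_ C)
      (_ : Epi p) (q : Z ⟶ X ⊗ Y), (((unitAlgebra D).baseChange k K).restrict F).map q
        ((((unitAlgebra D).baseChange k K).restrict F).mul x y) =
      (((unitAlgebra D).baseChange k K).restrict F).map p
        (((unitAlgebra D).baseChange k K).restrict F).one := by
  obtain ⟨n, φ, z, hφ, hz, rfl⟩ := exists_sum_tmul_linearIndependent (M := (unitAlgebra D).obj _) k x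
  cases n with
  | zero => exact (hx (Finset.sum_of_isEmpty _)).elim
  | succ n =>
    obtain ⟨V, g, hg, s, hs⟩ := exists_dual_basis hk φ (linearIndependent_unitAlgebraEquiv hφ)
    obtain ⟨Z, p, hp, ψ, hψ⟩ := hF g hg
    obtain ⟨X', ⟨_⟩⟩ := HasDuals.exists_dual X
    -- The transpose of `ψ ≫ s 0 : F Z ⟶ F X`. Multiplying by `χ` and restricting along the
    -- coevaluation amounts to precomposition with `ψ ≫ s 0`, which sends `φ 0` to the image of `p`
    -- and kills the other forms. The factor `(z 0)⁻¹` normalises the surviving coefficient.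
    let χ : (unitAlgebra D).obj (F.obj (X' ⊗ Z)) :=
      δ F X' Z ≫ F.obj X' ◁ (ψ ≫ s 0) ≫ μ F X' X ≫ F.map (ε_ X X') ≫ η F
    refine ⟨X' ⊗ Z, (χ ⊗ₜ[k] (z 0)⁻¹ : (unitAlgebra D).obj (F.obj (X' ⊗ Z)) ⊗[k] K), Z, p, hp,
      (λ_ Z).inv ≫ η_ X X' ▷ Z ≫ (α_ X X' Z).hom, ?_⟩
    have h (i : Fin (n + 1)) : (unitAlgebra D).map (F.map ((λ_ Z).inv ≫ η_ X X' ▷ Z ≫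
        (α_ X X' Z).hom)) ((unitAlgebra D).map (δ F _ _) ((unitAlgebra D).mul (φ i) χ)) =
        if i = 0 then (unitAlgebra D).map (F.map p) (η F) else 0 := by
      refine (map_coevaluation_comp F X X' Z (ψ ≫ s 0) (φ i)).trans
        (((Category.assoc _ _ _).trans (congrArg (ψ ≫ ·) (hs 0 i))).trans ?_)
      by_cases hi : i = 0
      · subst hi
        rw [if_pos rfl, if_pos rfl]
        exact hψ
      · rw [if_neg hi, if_neg (Ne.symm hi)]
        exact comp_zero
    have h' : ∀ i : Fin (n + 1), (((unitAlgebra D).baseChange k K).restrict F).map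
        ((λ_ Z).inv ≫ η_ X X' ▷ Z ≫ (α_ X X' Z).hom)
        ((((unitAlgebra D).baseChange k K).restrict F).mul
          (φ i ⊗ₜ[k] z i : (unitAlgebra D).obj (F.obj X) ⊗[k] K)
          (χ ⊗ₜ[k] (z 0)⁻¹ : (unitAlgebra D).obj (F.obj (X' ⊗ Z)) ⊗[k] K)) =
        if i = 0 then (((unitAlgebra D).baseChange k K).restrict F).map p
          (((unitAlgebra D).baseChange k K).restrict F).one else 0 := by
      intro i
      refine (congrArg (fun t => (t ⊗ₜ[k] (z i * (z 0)⁻¹) : (unitAlgebra D).obj (F.obj Z) ⊗[k] K))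
        (h i)).trans ?_
      by_cases hi : i = 0
      · subst hi
        rw [if_pos rfl, if_pos rfl, mul_inv_cancel₀ (hz 0)]
        exact congrArg (fun t => (t ⊗ₜ[k] (1 : K) : (unitAlgebra D).obj (F.obj Z) ⊗[k] K))
          (congrArg ((unitAlgebra D).map (F.map p)) (Category.comp_id (η F)).symm)
      · rw [if_neg hi, if_neg hi]
        exact TensorProduct.zero_tmul _ _
    refine (map_sum_mul _ _ _ _).trans ((Finset.sum_congr rfl fun i _ => h' i).trans ?_)
    rw [Finset.sum_ite_eq', if_pos (Finset.mem_univ _)]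

end Simple

end LaxAlgebra
end TensorCat

end
noncomputable section

namespace TensorCat

/-! ## Elements of ind-objects -/

section Elements

variable {C : Type u} [Category.{v} C] [MonoidalCategory C] [EssentiallySmall.{v} C]

open LawfulDayConvolutionMonoidalCategoryStruct

variable (C) in
/-- The functor from ind-objects to presheaves that is part of the Day convolution structure. -/
abbrev incl : Ind C ⥤ Cᵒᵖ ⥤ Type v := ι Cᵒᵖ (Type v) (Ind C)

variable (C) in
/-- The inclusion of ind-objects into presheaves is fully faithful. -/
def fullyFaithfulIncl : (incl C).FullyFaithful := Ind.inclusion.fullyFaithful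

variable (C) in
/-- On `C`, the inclusion of ind-objects into presheaves is the Yoneda embedding. -/
def yonedaCompIncl : Ind.yoneda ⋙ incl C ≅ yoneda := Ind.yonedaCompInclusion

/-- Morphisms from an object of `C` to an ind-object are the elements of the ind-object. -/
def elEquiv {X : C} {M : Ind C} : (Ind.yoneda.obj X ⟶ M) ≃ ((incl C).obj M).obj (op X) :=
  (fullyFaithfulIncl C).homEquiv.trans
    ((((yonedaCompIncl C).app X).homCongr (Iso.refl _)).trans yonedaEquiv)

theorem elEquiv_apply {X : C} {M : Ind C} (x : Ind.yoneda.obj X ⟶ M) :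
    elEquiv x = yonedaEquiv ((yonedaCompIncl C).inv.app X ≫ (incl C).map x) := by
  refine congrArg yonedaEquiv ?_
  change (yonedaCompIncl C).inv.app X ≫ (incl C).map x ≫ 𝟙 _ = _
  rw [Category.comp_id]

theorem elEquiv_comp {X : C} {M N : Ind C} (x : Ind.yoneda.obj X ⟶ M) (φ : M ⟶ N) :
    elEquiv (x ≫ φ) = ((incl C).map φ).app _ (elEquiv x) := by
  rw [elEquiv_apply, elEquiv_apply, Functor.map_comp, ← Category.assoc, yonedaEquiv_comp]

theorem elEquiv_map_comp {X Y : C} {M : Ind C} (f : X ⟶ Y) (x : Ind.yoneda.obj Y ⟶ M) :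
    elEquiv (Ind.yoneda.map f ≫ x) = ((incl C).obj M).map f.op (elEquiv x) := by
  rw [elEquiv_apply, elEquiv_apply, yonedaEquiv_naturality, Functor.map_comp]
  congr 1
  exact (((yonedaCompIncl C).inv.naturality_assoc f _).symm)

/-- Morphisms of ind-objects are determined by their values on elements. -/
theorem ind_hom_ext {M N : Ind C} {φ ψ : M ⟶ N}
    (h : ∀ (X : C) (x : Ind.yoneda.obj X ⟶ M), x ≫ φ = x ≫ ψ) : φ = ψ := by
  apply (incl C).map_injective
  ext ⟨X⟩ x
  obtain ⟨x, rfl⟩ := (elEquiv (X := X) (M := M)).surjective x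
  exact (elEquiv_comp x φ).symm.trans ((congrArg elEquiv (h X x)).trans (elEquiv_comp x ψ))

/-- Natural families of maps of elements define morphisms of ind-objects. -/
theorem exists_ind_hom {M N : Ind C} (t : ∀ {X : C}, (Ind.yoneda.obj X ⟶ M) → (Ind.yoneda.obj X ⟶ N))
    (ht : ∀ {X Y : C} (f : X ⟶ Y) (x : Ind.yoneda.obj Y ⟶ M),
      t (Ind.yoneda.map f ≫ x) = Ind.yoneda.map f ≫ t x) :
    ∃ φ : M ⟶ N, ∀ (X : C) (x : Ind.yoneda.obj X ⟶ M), x ≫ φ = t x := by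
  let τ : (incl C).obj M ⟶ (incl C).obj N :=
    { app X := TypeCat.ofHom fun x => elEquiv (X := X.unop) (t (elEquiv.symm x))
      naturality X Y f := by
        ext x
        obtain ⟨x, rfl⟩ := (elEquiv (X := X.unop) (M := M)).surjective x
        change elEquiv (X := Y.unop) (t (elEquiv.symm (((incl C).obj M).map f.unop.op (elEquiv x)))) =
          ((incl C).obj N).map f.unop.op (elEquiv (X := X.unop) (t (elEquiv.symm (elEquiv x))))
        rw [← elEquiv_map_comp, Equiv.symm_apply_apply, Equiv.symm_apply_apply, ht,
          elEquiv_map_comp] }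
  refine ⟨(fullyFaithfulIncl C).preimage τ, fun X x => ?_⟩
  apply elEquiv.injective
  rw [elEquiv_comp, Functor.FullyFaithful.map_preimage]
  change elEquiv (t (elEquiv.symm (elEquiv x))) = _
  rw [Equiv.symm_apply_apply]

/-- The tensor product of two elements. -/
def box {X Y : C} {M N : Ind C} (x : Ind.yoneda.obj X ⟶ M) (y : Ind.yoneda.obj Y ⟶ N) :
    Ind.yoneda.obj (X ⊗ Y) ⟶ M ⊗ N :=
  elEquiv.symm ((convolutionExtensionUnit Cᵒᵖ (Type v) M N).app (op X, op Y)
    (pair (elEquiv x) (elEquiv y)))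

theorem elEquiv_box {X Y : C} {M N : Ind C} (x : Ind.yoneda.obj X ⟶ M) (y : Ind.yoneda.obj Y ⟶ N) :
    elEquiv (box x y) = (convolutionExtensionUnit Cᵒᵖ (Type v) M N).app (op X, op Y)
      (pair (elEquiv x) (elEquiv y)) :=
  Equiv.apply_symm_apply _ _

theorem map_comp_box {X X' Y Y' : C} {M N : Ind C} (f : X ⟶ X') (g : Y ⟶ Y')
    (x : Ind.yoneda.obj X' ⟶ M) (y : Ind.yoneda.obj Y' ⟶ N) :
    Ind.yoneda.map (f ⊗ₘ g) ≫ box x y = box (Ind.yoneda.map f ≫ x) (Ind.yoneda.map g ≫ y) := by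
  apply elEquiv.injective
  rw [elEquiv_map_comp, elEquiv_box, elEquiv_box, elEquiv_map_comp, elEquiv_map_comp]
  exact (naturality₂ (convolutionExtensionUnit Cᵒᵖ (Type v) M N) f.op g.op (elEquiv x)
    (elEquiv y)).symm

theorem box_comp {X Y : C} {M M' N N' : Ind C} (x : Ind.yoneda.obj X ⟶ M)
    (y : Ind.yoneda.obj Y ⟶ N) (φ : M ⟶ M') (ψ : N ⟶ N') :
    box x y ≫ (φ ⊗ₘ ψ) = box (x ≫ φ) (y ≫ ψ) := by
  apply elEquiv.injective
  rw [elEquiv_comp, elEquiv_box, elEquiv_box, elEquiv_comp, elEquiv_comp]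
  exact ConcreteCategory.congr_hom
    (convolutionExtensionUnit_comp_ι_map_tensorHom_app Cᵒᵖ (Type v) φ ψ (op X) (op Y)) _

theorem box_assoc {X Y Z : C} {M N P : Ind C} (x : Ind.yoneda.obj X ⟶ M)
    (y : Ind.yoneda.obj Y ⟶ N) (z : Ind.yoneda.obj Z ⟶ P) :
    box (box x y) z ≫ (α_ M N P).hom = Ind.yoneda.map (α_ X Y Z).hom ≫ box x (box y z) := by
  apply elEquiv.injective
  rw [elEquiv_comp, elEquiv_box, elEquiv_box, elEquiv_map_comp, elEquiv_box, elEquiv_box]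
  let e : ((((incl C).obj M).obj (op X) ⊗ ((incl C).obj N).obj (op Y)) ⊗
    ((incl C).obj P).obj (op Z) : Type v) := ((elEquiv x, elEquiv y), elEquiv z)
  have h := associator_hom_unit_unit (Type v) M N P (op X) (op Y) (op Z)
  exact ConcreteCategory.congr_hom h e

variable (C) in
/-- The unit element of the unit object. -/
def unitEl : Ind.yoneda.obj (𝟙_ C) ⟶ 𝟙_ (Ind C) :=
  elEquiv.symm (unitUnit Cᵒᵖ (Type v) (Ind C) PUnit.unit)

theorem elEquiv_unitEl : elEquiv (unitEl C) = unitUnit Cᵒᵖ (Type v) (Ind C) PUnit.unit :=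
  Equiv.apply_symm_apply _ _

theorem box_unitEl {X : C} {M : Ind C} (x : Ind.yoneda.obj X ⟶ M) :
    box (unitEl C) x ≫ (λ_ M).hom = Ind.yoneda.map (λ_ X).hom ≫ x := by
  apply elEquiv.injective
  rw [elEquiv_comp, elEquiv_box, elEquiv_map_comp, elEquiv_unitEl]
  let e : (𝟙_ (Type v) ⊗ ((incl C).obj M).obj (op X) : Type v) := (PUnit.unit, elEquiv x)
  have h := leftUnitor_hom_unit_app (C := Cᵒᵖ) (Type v) M (op X)
  exact ConcreteCategory.congr_hom h e

/-- The left Kan extension property of Day convolution, expressed in elements. -/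
theorem box_desc {M N H : Ind C} (t : ∀ {X Y : C}, (Ind.yoneda.obj X ⟶ M) →
      (Ind.yoneda.obj Y ⟶ N) → (Ind.yoneda.obj (X ⊗ Y) ⟶ H))
    (ht : ∀ {X X' Y Y' : C} (f : X ⟶ X') (g : Y ⟶ Y') (x : Ind.yoneda.obj X' ⟶ M)
      (y : Ind.yoneda.obj Y' ⟶ N), t (Ind.yoneda.map f ≫ x) (Ind.yoneda.map g ≫ y) =
        Ind.yoneda.map (f ⊗ₘ g) ≫ t x y) :
    ∃ φ : M ⊗ N ⟶ H, ∀ {X Y : C} (x : Ind.yoneda.obj X ⟶ M) (y : Ind.yoneda.obj Y ⟶ N),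
      box x y ≫ φ = t x y := by
  let τ : (incl C).obj M ⊠ (incl C).obj N ⟶ tensor Cᵒᵖ ⋙ (incl C).obj H :=
    { app p := TypeCat.ofHom fun z => elEquiv (X := p.1.unop ⊗ p.2.unop)
        (t (elEquiv.symm z.1 : Ind.yoneda.obj p.1.unop ⟶ M)
          (elEquiv.symm z.2 : Ind.yoneda.obj p.2.unop ⟶ N))
      naturality := by
        rintro ⟨a, b⟩ ⟨a', b'⟩ ⟨f, g⟩
        ext ⟨x, y⟩
        obtain ⟨x, rfl⟩ := (elEquiv (X := a.unop) (M := M)).surjective x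
        obtain ⟨y, rfl⟩ := (elEquiv (X := b.unop) (M := N)).surjective y
        change elEquiv (X := a'.unop ⊗ b'.unop)
            (t (elEquiv.symm (((incl C).obj M).map f.unop.op (elEquiv x)))
              (elEquiv.symm (((incl C).obj N).map g.unop.op (elEquiv y)))) =
          ((incl C).obj H).map (f.unop ⊗ₘ g.unop).op (elEquiv (X := a.unop ⊗ b.unop)
            (t (elEquiv.symm (elEquiv x)) (elEquiv.symm (elEquiv y))))
        rw [← elEquiv_map_comp, ← elEquiv_map_comp, Equiv.symm_apply_apply, Equiv.symm_apply_apply,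
          Equiv.symm_apply_apply, Equiv.symm_apply_apply, ht, elEquiv_map_comp] }
  have : ((incl C).obj (M ⊗ N)).IsLeftKanExtension (convolutionExtensionUnit Cᵒᵖ (Type v) M N) :=
    (isPointwiseLeftKanExtensionConvolutionExtensionUnit M N).isLeftKanExtension
  let σ := ((incl C).obj (M ⊗ N)).descOfIsLeftKanExtension
    (convolutionExtensionUnit Cᵒᵖ (Type v) M N) _ τ
  refine ⟨(fullyFaithfulIncl C).preimage σ, fun {X Y} x y => ?_⟩
  apply elEquiv.injective
  rw [elEquiv_comp, Functor.FullyFaithful.map_preimage, elEquiv_box]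
  refine (ConcreteCategory.congr_hom (((incl C).obj (M ⊗ N)).descOfIsLeftKanExtension_fac_app
    (convolutionExtensionUnit Cᵒᵖ (Type v) M N) _ τ (op X, op Y))
      (pair (elEquiv x) (elEquiv y))).trans ?_
  change elEquiv (t (elEquiv.symm (elEquiv x)) (elEquiv.symm (elEquiv y))) = _
  rw [Equiv.symm_apply_apply, Equiv.symm_apply_apply]

/-- Transformations from the presheaf of a tensor product are determined by their values on tensor
products of elements. -/
theorem box_presheaf_ext {M N : Ind C} {H : Cᵒᵖ ⥤ Type v} {φ ψ : (incl C).obj (M ⊗ N) ⟶ H}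
    (h : ∀ {X Y : C} (x : Ind.yoneda.obj X ⟶ M) (y : Ind.yoneda.obj Y ⟶ N),
      φ.app _ (elEquiv (box x y)) = ψ.app _ (elEquiv (box x y))) : φ = ψ := by
  have : ((incl C).obj (M ⊗ N)).IsLeftKanExtension (convolutionExtensionUnit Cᵒᵖ (Type v) M N) :=
    (isPointwiseLeftKanExtensionConvolutionExtensionUnit M N).isLeftKanExtension
  apply ((incl C).obj (M ⊗ N)).hom_ext_of_isLeftKanExtension
    (convolutionExtensionUnit Cᵒᵖ (Type v) M N)
  ext ⟨a, b⟩ ⟨x, y⟩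
  obtain ⟨x, rfl⟩ := (elEquiv (X := a.unop) (M := M)).surjective x
  obtain ⟨y, rfl⟩ := (elEquiv (X := b.unop) (M := N)).surjective y
  have := h x y
  rw [elEquiv_box] at this
  exact this

theorem box_hom_ext {M N H : Ind C} {φ ψ : M ⊗ N ⟶ H}
    (h : ∀ {X Y : C} (x : Ind.yoneda.obj X ⟶ M) (y : Ind.yoneda.obj Y ⟶ N),
      box x y ≫ φ = box x y ≫ ψ) : φ = ψ := by
  apply (incl C).map_injective
  refine box_presheaf_ext fun x y => ?_
  rw [← elEquiv_comp, ← elEquiv_comp, h]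

/-- An element of `M ⊗ N` need not be a tensor product of elements. With `z` fixed, both sides are
transformations in that element, with values in a shifted presheaf; this is why `box_presheaf_ext`
admits arbitrary presheaves as targets. -/
theorem box_hom_ext₃ {M N P H : Ind C} {φ ψ : (M ⊗ N) ⊗ P ⟶ H}
    (h : ∀ {X Y Z : C} (x : Ind.yoneda.obj X ⟶ M) (y : Ind.yoneda.obj Y ⟶ N)
      (z : Ind.yoneda.obj Z ⟶ P), box (box x y) z ≫ φ = box (box x y) z ≫ ψ) : φ = ψ := by
  refine box_hom_ext fun {W Z} w z => ?_
  let τ (χ : (M ⊗ N) ⊗ P ⟶ H) :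
      (incl C).obj (M ⊗ N) ⟶ (tensorRight Z).op ⋙ (incl C).obj H :=
    { app X := TypeCat.ofHom fun w => elEquiv (X := X.unop ⊗ Z)
        (box (elEquiv.symm w : Ind.yoneda.obj X.unop ⟶ M ⊗ N) z ≫ χ)
      naturality X Y f := by
        ext w
        obtain ⟨w, rfl⟩ := (elEquiv (X := X.unop) (M := M ⊗ N)).surjective w
        change elEquiv (X := Y.unop ⊗ Z)
            (box (elEquiv.symm (((incl C).obj (M ⊗ N)).map f.unop.op (elEquiv w))) z ≫ χ) =
          ((incl C).obj H).map (f.unop ▷ Z).op (elEquiv (X := X.unop ⊗ Z)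
            (box (elEquiv.symm (elEquiv w)) z ≫ χ))
        rw [← elEquiv_map_comp, ← elEquiv_map_comp, Equiv.symm_apply_apply, Equiv.symm_apply_apply,
          ← tensorHom_id, reassoc_of% (map_comp_box f.unop (𝟙 Z) w z),
          CategoryTheory.Functor.map_id, Category.id_comp] }
  have hτ : τ φ = τ ψ := box_presheaf_ext fun x y => by
    change elEquiv (box (elEquiv.symm (elEquiv (box x y))) z ≫ φ) =
      elEquiv (box (elEquiv.symm (elEquiv (box x y))) z ≫ ψ)
    rw [Equiv.symm_apply_apply, h]
  have := congr_app hτ (op W) (elEquiv w)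
  change elEquiv (box (elEquiv.symm (elEquiv w)) z ≫ φ) =
    elEquiv (box (elEquiv.symm (elEquiv w)) z ≫ ψ) at this
  rw [Equiv.symm_apply_apply] at this
  exact elEquiv.injective this

/-- The Yoneda embedding is strong monoidal. The inverse comes from the universal property, as
elements of representables are morphisms of `C`. -/
instance {X Y : C} : IsIso (box (𝟙 (Ind.yoneda.obj X)) (𝟙 (Ind.yoneda.obj Y))) := by
  obtain ⟨φ, hφ⟩ := box_desc (M := Ind.yoneda.obj X) (N := Ind.yoneda.obj Y)
    (H := Ind.yoneda.obj (X ⊗ Y))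
    (fun x y => Ind.yoneda.map (Ind.yoneda.preimage x ⊗ₘ Ind.yoneda.preimage y)) (by
      intro X X' Y Y' f g x y
      obtain ⟨x, rfl⟩ := Ind.yoneda.map_surjective x
      obtain ⟨y, rfl⟩ := Ind.yoneda.map_surjective y
      simp only [← Functor.map_comp, Functor.preimage_map, tensorHom_comp_tensorHom])
  refine ⟨φ, ?_, box_hom_ext fun x y => ?_⟩
  · rw [hφ, Functor.preimage_id, Functor.preimage_id, id_tensorHom_id,
      CategoryTheory.Functor.map_id]
  · obtain ⟨x, rfl⟩ := Ind.yoneda.map_surjective x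
    obtain ⟨y, rfl⟩ := Ind.yoneda.map_surjective y
    rw [reassoc_of% (hφ (Ind.yoneda.map x) (Ind.yoneda.map y)), Functor.preimage_map,
      Functor.preimage_map, map_comp_box, Category.comp_id, Category.comp_id, Category.comp_id]

variable (C) in
/-- The element of the unit object that exhibits it as a left Kan extension. -/
def unitTrans : Functor.fromPUnit.{0} (𝟙_ (Type v)) ⟶
    Functor.fromPUnit.{0} (𝟙_ Cᵒᵖ) ⋙ (incl C).obj (𝟙_ (Ind C)) where
  app _ := unitUnit Cᵒᵖ (Type v) (Ind C)

instance : ((incl C).obj (𝟙_ (Ind C))).IsLeftKanExtension (unitTrans C) :=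
  (isPointwiseLeftKanExtensionUnitUnit Cᵒᵖ (Type v) (Ind C)).isLeftKanExtension

theorem unit_hom_ext {H : Cᵒᵖ ⥤ Type v} {φ ψ : (incl C).obj (𝟙_ (Ind C)) ⟶ H}
    (h : φ.app _ (elEquiv (unitEl C)) = ψ.app _ (elEquiv (unitEl C))) : φ = ψ := by
  apply ((incl C).obj (𝟙_ (Ind C))).hom_ext_of_isLeftKanExtension (unitTrans C)
  ext ⟨⟨⟩⟩ ⟨⟩
  rw [elEquiv_unitEl] at h
  exact h

theorem exists_unit_desc {H : Ind C} (x : Ind.yoneda.obj (𝟙_ C) ⟶ H) :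
    ∃ φ : 𝟙_ (Ind C) ⟶ H, unitEl C ≫ φ = x := by
  let σ := ((incl C).obj (𝟙_ (Ind C))).descOfIsLeftKanExtension (unitTrans C)
    ((incl C).obj H)
    { app _ := TypeCat.ofHom fun _ => elEquiv x }
  refine ⟨(fullyFaithfulIncl C).preimage σ, ?_⟩
  apply elEquiv.injective
  rw [elEquiv_comp, Functor.FullyFaithful.map_preimage, elEquiv_unitEl]
  exact ConcreteCategory.congr_hom (((incl C).obj (𝟙_ (Ind C))).descOfIsLeftKanExtension_fac_app
    (unitTrans C) ((incl C).obj H) { app _ := TypeCat.ofHom fun _ => elEquiv x } ⟨PUnit.unit⟩) PUnit.unit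

instance : IsIso (unitEl C) := by
  obtain ⟨φ, hφ⟩ := exists_unit_desc (𝟙 (Ind.yoneda.obj (𝟙_ C)))
  refine ⟨φ, hφ, ?_⟩
  apply (incl C).map_injective
  apply unit_hom_ext
  rw [← elEquiv_comp, ← elEquiv_comp, reassoc_of% hφ, Category.comp_id]

section Symmetric

attribute [local instance] convolution

variable [SymmetricCategory C]

theorem box_braiding {X Y : C} {M N : Ind C} (x : Ind.yoneda.obj X ⟶ M)
    (y : Ind.yoneda.obj Y ⟶ N) :
    box x y ≫ (β_ M N).hom = Ind.yoneda.map (β_ X Y).hom ≫ box y x := by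
  apply elEquiv.injective
  rw [elEquiv_comp, elEquiv_box, elEquiv_map_comp, elEquiv_box]
  let e : (((incl C).obj M).obj (op X) ⊗ ((incl C).obj N).obj (op Y) : Type v) :=
    (elEquiv x, elEquiv y)
  have h := DayConvolution.unit_app_braiding_hom_app ((incl C).obj M) ((incl C).obj N) (op X) (op Y)
  have h' := map_preimage M N
  exact (congr_app h' _ _).trans (ConcreteCategory.congr_hom h e)

end Symmetric

end Elements

end TensorCat

end
noncomputable section

namespace TensorCat

open LaxAlgebra
open scoped MonObj

/-! ## Lax algebras and commutative algebras in ind-objects -/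

section Additive

variable {C : Type u} [Category.{v} C] [Abelian C]

instance : (Ind.yoneda (C := C)).Additive :=
  Functor.additive_of_preserves_binary_products _

/-- Natural maps from an ind-object to an additive presheaf are additive. -/
theorem add_of_natural {M : Ind C} {Q : C → Type*} [∀ X, Add (Q X)]
    (r : ∀ {X Y : C}, (X ⟶ Y) → Q Y → Q X)
    (hr : ∀ {X Y : C} (f g : X ⟶ Y) (q : Q Y), r (f + g) q = r f q + r g q)
    (t : ∀ {X : C}, (Ind.yoneda.obj X ⟶ M) → Q X)
    (ht : ∀ {X Y : C} (f : X ⟶ Y) (x : Ind.yoneda.obj Y ⟶ M),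
      t (Ind.yoneda.map f ≫ x) = r f (t x)) {X : C} (x x' : Ind.yoneda.obj X ⟶ M) :
    t (x + x') = t x + t x' := by
  -- The universal pair: `x`, `x'` and `x + x'` are its restrictions along `biprod.inl`,
  -- `biprod.inr` and their sum, so additivity of the target in morphisms suffices.
  let w : Ind.yoneda.obj (X ⊞ X) ⟶ M :=
    Ind.yoneda.map biprod.fst ≫ x + Ind.yoneda.map biprod.snd ≫ x'
  have h₁ : Ind.yoneda.map biprod.inl ≫ w = x := by
    simp [w, Preadditive.comp_add, ← Functor.map_comp_assoc]
  have h₂ : Ind.yoneda.map biprod.inr ≫ w = x' := by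
    simp [w, Preadditive.comp_add, ← Functor.map_comp_assoc]
  have h₃ : Ind.yoneda.map (biprod.inl + biprod.inr) ≫ w = x + x' := by
    rw [Functor.map_add, Preadditive.add_comp, h₁, h₂]
  rw [← h₃, ht, hr, ← ht, ← ht, h₁, h₂]

end Additive

section OfMon

variable {C : Type u} [Category.{v} C] [EssentiallySmall.{v} C] [Abelian C] [MonoidalCategory C]
  [SymmetricCategory C] [MonoidalPreadditive C]

theorem box_add_left {X Y : C} {M N : Ind C} (x x' : Ind.yoneda.obj X ⟶ M)
    (y : Ind.yoneda.obj Y ⟶ N) : box (x + x') y = box x y + box x' y :=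
  add_of_natural (Q := fun X => Ind.yoneda.obj (X ⊗ Y) ⟶ M ⊗ N)
    (fun f q => Ind.yoneda.map (f ▷ Y) ≫ q)
    (fun f g q => by rw [MonoidalPreadditive.add_whiskerRight, Functor.map_add,
      Preadditive.add_comp]) (fun x => box x y) (fun f x => by
        rw [← tensorHom_id, map_comp_box, CategoryTheory.Functor.map_id, Category.id_comp]) x x'

theorem box_add_right {X Y : C} {M N : Ind C} (x : Ind.yoneda.obj X ⟶ M)
    (y y' : Ind.yoneda.obj Y ⟶ N) : box x (y + y') = box x y + box x y' :=
  add_of_natural (Q := fun Y => Ind.yoneda.obj (X ⊗ Y) ⟶ M ⊗ N)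
    (fun f q => Ind.yoneda.map (X ◁ f) ≫ q)
    (fun f g q => by rw [MonoidalPreadditive.whiskerLeft_add, Functor.map_add,
      Preadditive.add_comp]) (fun y => box x y) (fun f x => by
        rw [← id_tensorHom, map_comp_box, CategoryTheory.Functor.map_id, Category.id_comp]) y y'

/-- The lax algebra of elements of a commutative algebra in ind-objects. -/
def ofMon (A : CommMon (Ind C)) : LaxAlgebra.{v} C where
  obj X := Ind.yoneda.obj X ⟶ A.X
  map f := Preadditive.leftComp _ (Ind.yoneda.map f)
  map_id X x := by
    change Ind.yoneda.map (𝟙 X) ≫ x = x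
    rw [CategoryTheory.Functor.map_id, Category.id_comp]
  map_comp f g x := by
    change Ind.yoneda.map (f ≫ g) ≫ x = Ind.yoneda.map f ≫ Ind.yoneda.map g ≫ x
    rw [Functor.map_comp, Category.assoc]
  map_add_hom f g x := by
    change Ind.yoneda.map (f + g) ≫ x = Ind.yoneda.map f ≫ x + Ind.yoneda.map g ≫ x
    rw [Functor.map_add, Preadditive.add_comp]
  mul {X Y} := AddMonoidHom.mk' (fun x => AddMonoidHom.mk' (fun y => box x y ≫ μ[A.X])
      fun y y' => by rw [box_add_right, Preadditive.add_comp]) fun x x' => by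
        ext y
        change box (x + x') y ≫ μ[A.X] = box x y ≫ μ[A.X] + box x' y ≫ μ[A.X]
        rw [box_add_left, Preadditive.add_comp]
  map_mul f g x y := by
    change Ind.yoneda.map (f ⊗ₘ g) ≫ box x y ≫ μ[A.X] =
      box (Ind.yoneda.map f ≫ x) (Ind.yoneda.map g ≫ y) ≫ μ[A.X]
    rw [← map_comp_box, Category.assoc]
  one := unitEl C ≫ η[A.X]
  one_mul {X} x := by
    change box (unitEl C ≫ η[A.X]) x ≫ μ[A.X] = Ind.yoneda.map (λ_ X).hom ≫ x
    rw [← Category.comp_id x, ← box_comp, tensorHom_id, Category.assoc, MonObj.one_mul, box_unitEl,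
      Category.comp_id]
  mul_assoc {X Y Z} x y z := by
    change box (box x y ≫ μ[A.X]) z ≫ μ[A.X] =
      Ind.yoneda.map (α_ X Y Z).hom ≫ box x (box y z ≫ μ[A.X]) ≫ μ[A.X]
    have h₁ : box (box x y ≫ μ[A.X]) z = box (box x y) z ≫ (μ[A.X] ▷ A.X) := by
      rw [← tensorHom_id, box_comp, Category.comp_id]
    have h₂ : box x (box y z ≫ μ[A.X]) = box x (box y z) ≫ (A.X ◁ μ[A.X]) := by
      rw [← id_tensorHom, box_comp, Category.comp_id]
    rw [h₁, h₂, Category.assoc, MonObj.mul_assoc, reassoc_of% (box_assoc x y z), Category.assoc]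
  mul_comm {X Y} x y := by
    change box x y ≫ μ[A.X] = Ind.yoneda.map (β_ X Y).hom ≫ box y x ≫ μ[A.X]
    rw [← reassoc_of% (box_braiding x y), IsCommMonObj.mul_comm]

/-- Epimorphisms remain regular epimorphisms in ind-objects. -/
theorem exists_desc_of_epi {Z X : C} (p : Z ⟶ X) [Epi p] {M : Ind C} (z : Ind.yoneda.obj Z ⟶ M)
    (h : Ind.yoneda.map (kernel.ι p) ≫ z = 0) :
    ∃ x : Ind.yoneda.obj X ⟶ M, Ind.yoneda.map p ≫ x = z :=
  (CokernelCofork.IsColimit.desc' (CokernelCofork.mapIsColimit _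
    (Abelian.epiIsCokernelOfKernel _ (limit.isLimit (parallelPair p 0))) Ind.yoneda)
      z h).exists_of_subtype

/-- Membership in a subobject of an ind-object descends along epimorphisms of `C`, since these
remain cokernels in `Ind C`. Ideals of algebras thereby satisfy `mem_of_epi`. -/
theorem exists_comp_eq_of_epi {Z X : C} (p : Z ⟶ X) [Epi p] {I M : Ind C} (i : I ⟶ M) [Mono i]
    (x : Ind.yoneda.obj X ⟶ M) (z : Ind.yoneda.obj Z ⟶ I) (h : Ind.yoneda.map p ≫ x = z ≫ i) :
    ∃ x' : Ind.yoneda.obj X ⟶ I, x' ≫ i = x := by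
  obtain ⟨x', hx'⟩ := exists_desc_of_epi p z (by
    rw [← cancel_mono i, Category.assoc, ← h, ← Functor.map_comp_assoc, kernel.condition,
      Functor.map_zero, zero_comp, zero_comp])
  refine ⟨x', ?_⟩
  rw [← cancel_epi (Ind.yoneda.map p), ← Category.assoc, hx', h]

/-- Morphisms of lax algebras of elements come from morphisms of algebras. -/
theorem exists_hom_of_hom {A S : CommMon (Ind C)} (θ : Hom (ofMon A) (ofMon S)) :
    ∃ f : A ⟶ S, ∀ (X : C) (x : Ind.yoneda.obj X ⟶ A.X), x ≫ f.hom.hom = θ.app X x := by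
  obtain ⟨φ, hφ⟩ := exists_ind_hom (M := A.X) (N := S.X) (fun {X} x => θ.app X x)
    (fun f x => θ.naturality f x)
  have : IsMonHom φ :=
    { one_hom := by
        rw [← cancel_epi (unitEl C), ← Category.assoc, hφ]
        exact θ.map_one
      mul_hom := by
        refine box_hom_ext fun x y => ?_
        rw [← Category.assoc, hφ, ← Category.assoc, box_comp, hφ, hφ]
        exact θ.map_mul x y }
  exact ⟨CommMon.homMk { hom := φ, isMonHom_hom := this }, hφ⟩

end OfMon

end TensorCat

end
noncomputable section

namespace TensorCat

open LaxAlgebra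
open scoped MonObj

/-! ## Left exact lax algebras -/

namespace LaxAlgebra

section Presheaf

variable {C : Type u} [Category.{v} C] [Abelian C] [MonoidalCategory C]
  [SymmetricCategory C]

/-- The lax algebra sends cokernels to kernels, up to injectivity. -/
def IsLeftExact (B : LaxAlgebra.{w} C) : Prop :=
  ∀ ⦃X Y : C⦄ (f : X ⟶ Y) (y : B.obj Y), B.map f y = 0 →
    ∃ z : B.obj (cokernel f), B.map (cokernel.π f) z = y

/-- The presheaf of sets underlying a lax algebra. -/
def presheaf (B : LaxAlgebra.{v} C) : Cᵒᵖ ⥤ Type v where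
  obj X := B.obj X.unop
  map f := TypeCat.ofHom (B.map f.unop)
  map_id X := by
    ext x
    exact B.map_id _ x
  map_comp f g := by
    ext x
    exact B.map_comp g.unop f.unop x

variable {B : LaxAlgebra.{v} C}

/-- An object of the category of elements of a lax algebra. -/
def el {X : C} (x : B.obj X) : CostructuredArrow yoneda B.presheaf :=
  CostructuredArrow.mk (Y := X) (yonedaEquiv.symm (show B.presheaf.obj (op X) from x))

/-- A morphism of the category of elements of a lax algebra. -/
def elHom {X Y : C} {x : B.obj X} {y : B.obj Y} (f : X ⟶ Y) (h : B.map f y = x) :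
    el x ⟶ el y :=
  CostructuredArrow.homMk f ((yonedaEquiv_symm_naturality_left f B.presheaf y).trans
    (congrArg (fun x : B.presheaf.obj (op X) => yonedaEquiv.symm x) h))

theorem el_surjective (c : CostructuredArrow yoneda B.presheaf) :
    ∃ (X : C) (x : B.obj X), el x = c := by
  refine ⟨c.left, yonedaEquiv c.hom, ?_⟩
  rw [CostructuredArrow.eq_mk c]
  exact congrArg CostructuredArrow.mk (Equiv.symm_apply_apply _ _)

theorem elHom_condition {X Y : C} {x : B.obj X} {y : B.obj Y} (f : el x ⟶ el y) :
    B.map f.left y = x := by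
  have h := CostructuredArrow.w f
  have h' := (yonedaEquiv_symm_naturality_left f.left B.presheaf y).symm.trans h
  exact yonedaEquiv.symm.injective h'

/-- The category of elements is filtered: direct sums dominate two elements, and left exactness lets
an element descend to the cokernel of `f - g`, which equalises two parallel morphisms. It is also
essentially small. -/
theorem isIndObject_presheaf [EssentiallySmall.{v} C] (hB : B.IsLeftExact) :
    IsIndObject B.presheaf := by
  have : IsFiltered (CostructuredArrow yoneda B.presheaf) :=
    { nonempty := ⟨el (0 : B.obj (𝟙_ C))⟩
      cocone_objs c d := by
        obtain ⟨X, x, rfl⟩ := el_surjective c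
        obtain ⟨Y, y, rfl⟩ := el_surjective d
        refine ⟨el (B.map biprod.fst x + B.map biprod.snd y : B.obj (X ⊞ Y)),
          elHom biprod.inl ?_, elHom biprod.inr ?_, trivial⟩ <;>
        simp [← B.map_comp, B.map_id, B.map_zero_hom]
      cocone_maps c d f g := by
        obtain ⟨X, x, rfl⟩ := el_surjective c
        obtain ⟨Y, y, rfl⟩ := el_surjective d
        let f' : X ⟶ Y := f.left
        let g' : X ⟶ Y := g.left
        obtain ⟨z, hz⟩ := hB (f' - g') y (by
          rw [B.map_sub_hom]
          exact sub_eq_zero.2 ((elHom_condition f).trans (elHom_condition g).symm))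
        refine ⟨el z, elHom (cokernel.π (f' - g')) hz, ?_⟩
        apply CostructuredArrow.hom_ext
        have := cokernel.condition (f' - g')
        rw [Preadditive.sub_comp] at this
        exact sub_eq_zero.1 this }
  have : EssentiallySmall.{v} (CostructuredArrow yoneda B.presheaf) :=
    (essentiallySmall_congr
      (CategoryOfElements.costructuredArrowYonedaEquivalence B.presheaf)).1 inferInstance
  have := finallySmall_of_essentiallySmall (J := CostructuredArrow yoneda B.presheaf)
  exact isIndObject_of_isFiltered_of_finallySmall _

end Presheaf

end LaxAlgebra

section ToMon

variable {C : Type u} [Category.{v} C] [EssentiallySmall.{v} C] [Abelian C] [MonoidalCategory C]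
  [SymmetricCategory C] [MonoidalPreadditive C]

/-- Left exact lax algebras are the lax algebras of elements of commutative algebras. -/
theorem exists_ofMon_bijective {B : LaxAlgebra.{v} C} (hB : B.IsLeftExact) :
    ∃ (S : CommMon (Ind C)) (e : Hom (ofMon S) B), ∀ X, Function.Bijective (e.app X) := by
  obtain ⟨M, ⟨i⟩⟩ := essImage_inclusion (isIndObject_presheaf hB)
  let j : (incl C).obj M ≅ B.presheaf := i
  let e {X : C} : (Ind.yoneda.obj X ⟶ M) ≃ B.obj X :=
    elEquiv.trans (j.app (op X)).toEquiv
  have he {X Y : C} (f : X ⟶ Y) (x : Ind.yoneda.obj Y ⟶ M) :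
      e (Ind.yoneda.map f ≫ x) = B.map f (e x) := by
    change j.hom.app _ (elEquiv (Ind.yoneda.map f ≫ x)) = B.presheaf.map f.op (j.hom.app _ (elEquiv x))
    rw [elEquiv_map_comp]
    exact NatTrans.naturality_apply j.hom f.op (elEquiv x)
  have hes {X Y : C} (f : X ⟶ Y) (b : B.obj Y) :
      e.symm (B.map f b) = Ind.yoneda.map f ≫ e.symm b := by
    rw [Equiv.symm_apply_eq, he, Equiv.apply_symm_apply]
  obtain ⟨m, hm⟩ := box_desc (M := M) (N := M) (H := M) (fun x y => e.symm (B.mul (e x) (e y)))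
    (fun f g x y => by rw [he, he, ← B.map_mul, hes])
  obtain ⟨o, ho⟩ := exists_unit_desc (e.symm B.one)
  have hm' {X Y : C} (x : Ind.yoneda.obj X ⟶ M) (y : Ind.yoneda.obj Y ⟶ M) :
      e (box x y ≫ m) = B.mul (e x) (e y) := by rw [hm, Equiv.apply_symm_apply]
  have ho' : e (unitEl C ≫ o) = B.one := by rw [ho, Equiv.apply_symm_apply]
  have hcomm : (β_ M M).hom ≫ m = m := box_hom_ext fun x y => by
    apply e.injective
    rw [← Category.assoc, box_braiding, Category.assoc, he, hm', hm', ← B.mul_comm]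
  have hone : o ▷ M ≫ m = (λ_ M).hom := by
    have h (X : C) (x : Ind.yoneda.obj X ⟶ M) :
        box (unitEl C) x ≫ o ▷ M ≫ m = box (unitEl C) x ≫ (λ_ M).hom := by
      apply e.injective
      rw [← tensorHom_id, ← Category.assoc, box_comp, Category.comp_id, hm', ho', B.one_mul,
        box_unitEl, he]
    refine box_hom_ext fun {X Y} x y => ?_
    -- Every element of the unit is a restriction of `unitEl`, since the unit object is
    -- representable. So the unit law need only be checked on that one element.
    obtain ⟨f, hf⟩ := Ind.yoneda.map_surjective (x ≫ inv (unitEl C))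
    have hx : x = Ind.yoneda.map f ≫ unitEl C := by rw [hf, Category.assoc, IsIso.inv_hom_id,
      Category.comp_id]
    have hb : box x y = Ind.yoneda.map (f ▷ Y) ≫ box (unitEl C) y := by
      rw [← tensorHom_id, map_comp_box, CategoryTheory.Functor.map_id, Category.id_comp, hx]
    rw [hb, Category.assoc, Category.assoc, h]
  let mon : MonObj M :=
    { one := o
      mul := m
      one_mul := hone
      mul_one := by
        rw [← hcomm, BraidedCategory.braiding_naturality_right_assoc, hone,
          braiding_leftUnitor]
      mul_assoc := by
        refine box_hom_ext₃ fun x y z => ?_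
        have h₁ := (box (box x y) z ≫= tensorHom_id m M).symm
        have h₂ := box_comp (box x y) z m (𝟙 M)
        apply e.injective
        rw [reassoc_of% (box_assoc x y z), ← tensorHom_id, ← id_tensorHom, ← Category.assoc,
          box_comp, hm', hm', he, ← Category.assoc, box_comp, Category.comp_id, Category.comp_id, hm',
          hm', B.mul_assoc] }
  let comm : IsCommMonObj M := ⟨hcomm⟩
  let θ : Hom (ofMon { X := M }) B :=
    { app X := AddMonoidHom.mk' e fun x y =>
        add_of_natural (fun f => B.map f) B.map_add_hom e he x y
      naturality := he
      map_mul := hm'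
      map_one := ho' }
  exact ⟨{ X := M }, θ, fun X => e.bijective⟩

end ToMon

section Restrict

variable {k : Type*} [Field k] {C : Type u₁} [Category.{v} C] [Abelian C] [MonoidalCategory C]
  [SymmetricCategory C]
  {D : Type u₂} [Category.{v} D] [Abelian D] [Linear k D] [MonoidalCategory D]
  [SymmetricCategory D] [MonoidalPreadditive D] [MonoidalLinear k D]
  (F : C ⥤ D) [F.Braided] [F.Additive] [PreservesFiniteColimits F] (K : Type v) [Field K]
  [Algebra k K]

theorem LaxAlgebra.IsLeftExact.restrict {B : LaxAlgebra.{w} D} (hB : B.IsLeftExact) :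
    (B.restrict F).IsLeftExact := by
  intro X Y f y hy
  obtain ⟨z, hz⟩ := hB (F.map f) y hy
  refine ⟨B.map (PreservesCokernel.iso F f).hom z, ?_⟩
  change B.map (F.map (cokernel.π f)) _ = _
  rw [← B.map_comp, PreservesCokernel.π_iso_hom, hz]

/-- Left exactness is exactness at the middle term, which the flat module `K` preserves. -/
theorem LaxAlgebra.IsLeftExact.baseChange {B : LaxAlgebra.{w} D} (hB : B.IsLeftExact) :
    (B.baseChange k K).IsLeftExact := by
  intro X Y f y hy
  have h : Function.Exact (B.mapₗ k (cokernel.π f)) (B.mapₗ k f) := by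
    intro y
    refine ⟨hB f y, ?_⟩
    rintro ⟨z, rfl⟩
    rw [mapₗ_apply, mapₗ_apply, ← B.map_comp, cokernel.condition, B.map_zero_hom]
  exact (Module.Flat.rTensor_exact K h y).1 hy

theorem isLeftExact_unitAlgebra : (unitAlgebra D).IsLeftExact :=
  fun _ _ f y hy => ⟨cokernel.desc f y hy, cokernel.π_desc f y hy⟩

end Restrict

end TensorCat

end
noncomputable section

namespace TensorCat

open LaxAlgebra

/-! ## Ideals and their elements -/

section Ideals

open scoped MonObj

variable {C : Type u} [Category.{v} C] [EssentiallySmall.{v} C] [Abelian C] [MonoidalCategory C]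

/-- Subobjects of ind-objects are compared through their elements. -/
theorem subobject_le_of_elements {M : Ind C} {I J : Subobject M}
    (h : ∀ (X : C) (x : Ind.yoneda.obj X ⟶ M), I.Factors x → J.Factors x) : I ≤ J := by
  obtain ⟨φ, hφ⟩ := exists_ind_hom (M := (I : Ind C)) (N := (J : Ind C))
    (fun {X} x => J.factorThru (x ≫ I.arrow) (h X _ (Subobject.factors_comp_arrow x)))
    (fun f x => by rw [← cancel_mono J.arrow]; simp)
  refine Subobject.le_of_comm φ (ind_hom_ext fun X x => ?_)
  rw [← Category.assoc, hφ, Subobject.factorThru_arrow]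

theorem kernelSubobject_eq_of_elements {M N : Ind C} (φ : M ⟶ N) (I : Subobject M)
    (h : ∀ (X : C) (x : Ind.yoneda.obj X ⟶ M), x ≫ φ = 0 ↔ I.Factors x) :
    kernelSubobject φ = I := by
  apply le_antisymm <;> refine subobject_le_of_elements fun X x hx => ?_
  · rwa [kernelSubobject_factors_iff, h] at hx
  · rwa [kernelSubobject_factors_iff, h]

variable [SymmetricCategory C] [MonoidalPreadditive C]

variable {A : CommMon (Ind C)} {I : Subobject A.X}

theorem IsIdeal.factors_box (hI : IsIdeal A I) {X Y : C} {x : Ind.yoneda.obj X ⟶ A.X}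
    (y : Ind.yoneda.obj Y ⟶ A.X) (hx : I.Factors x) : I.Factors (box x y ≫ μ[A.X]) := by
  have h : box x y = box (I.factorThru x hx) y ≫ (I.arrow ▷ A.X) := by
    rw [← tensorHom_id, box_comp, Subobject.factorThru_arrow, Category.comp_id]
  rw [h, Category.assoc]
  exact Subobject.factors_of_factors_right _ hI

/-- The elements of an ideal. -/
def idealOf (hI : IsIdeal A I) : (ofMon A).Ideal where
  carrier X :=
    { carrier := {x : Ind.yoneda.obj X ⟶ A.X | I.Factors x}
      add_mem' {x y} hx hy := Subobject.factors_add (P := I) x y hx hy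
      zero_mem' := Subobject.factors_zero (P := I)
      neg_mem' {x} hx := by
        have := Subobject.factors_of_factors_right (P := I) (-𝟙 (Ind.yoneda.obj X))
          (g := (show Ind.yoneda.obj X ⟶ A.X from x)) hx
        rw [Preadditive.neg_comp, Category.id_comp] at this
        exact this }
  map_mem f x hx := Subobject.factors_of_factors_right (P := I) (Ind.yoneda.map f)
    (g := (show Ind.yoneda.obj _ ⟶ A.X from x)) hx
  mul_mem {X Y x} y hx := hI.factors_box (x := x) y hx
  mem_of_epi {X Y} f _ x hx := by
    obtain ⟨x', hx'⟩ := exists_comp_eq_of_epi f I.arrow x (I.factorThru _ hx)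
      (Subobject.factorThru_arrow _ _ _).symm
    exact (congrArg I.Factors hx').mp (Subobject.factors_comp_arrow x')

theorem mem_idealOf (hI : IsIdeal A I) {X : C} (x : Ind.yoneda.obj X ⟶ A.X) :
    x ∈ (idealOf hI).carrier X ↔ I.Factors x := Iff.rfl

theorem eq_top_of_one_mem (hI : IsIdeal A I) (h : (ofMon A).one ∈ (idealOf hI).carrier (𝟙_ C)) :
    I = ⊤ := by
  refine top_le_iff.1 (subobject_le_of_elements fun X x _ => ?_)
  refine (mem_idealOf hI x).1 ((idealOf hI).mem_of_isIso (λ_ X).hom ?_)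
  rw [← (ofMon A).one_mul x]
  exact (idealOf hI).mul_mem x h

/-- The image of an element of an algebra in ind-objects. -/
theorem exists_mono_element [HasDuals C] [∀ X : C, IsNoetherianObject X] {X : C} (x : Ind.yoneda.obj X ⟶ A.X) :
    ∃ (Y : C) (p : X ⟶ Y) (y : Ind.yoneda.obj Y ⟶ A.X), Epi p ∧ Mono y ∧
      Ind.yoneda.map p ≫ y = x := by
  have hA : (ofMon A).IsSeparated := fun X Y f _ x hx =>
    (cancel_epi (Ind.yoneda.map f)).1 (hx.trans comp_zero.symm)
  obtain ⟨Y, p, hp, h₁, h₂⟩ := exists_coimage hA x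
  obtain ⟨y, hy⟩ := exists_desc_of_epi p x (h₁ _ (kernel.condition p))
  refine ⟨Y, p, y, hp, Preadditive.mono_of_cancel_zero _ fun {M} φ hφ => ?_, hy⟩
  refine ind_hom_ext fun V v => ?_
  -- Monomorphy is tested on elements of the source. Each gives a morphism `g` to the coimage, and
  -- pulling back along `p` moves it to `X`, where everything that kills `x` is killed by `p`.
  obtain ⟨g, hg⟩ := Ind.yoneda.map_surjective (v ≫ φ)
  have h := h₂ (pullback.snd g p) (by
    change Ind.yoneda.map (pullback.snd g p) ≫ x = 0
    rw [← hy, ← Functor.map_comp_assoc, ← pullback.condition, Functor.map_comp_assoc, hg,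
      Category.assoc, hφ, comp_zero, comp_zero])
  rw [← pullback.condition] at h
  have hg₀ : g = 0 := by rw [← cancel_epi (pullback.fst g p), h, comp_zero]
  rw [← hg, hg₀, Functor.map_zero, comp_zero]

/-- Primality of `I` speaks only of subobjects that belong to `C`. Arbitrary elements are replaced
by their images, and membership of the product descends along `p ⊗ q`. -/
theorem isPrime_idealOf [HasDuals C] [∀ X : C, IsNoetherianObject X] (hI : IsPrimeIdeal A I) :
    (idealOf hI.isIdeal).IsPrime where
  one_notMem h := hI.ne_top (eq_top_of_one_mem hI.isIdeal h)
  mem_or_mem {X Y} x y h := by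
    obtain ⟨X', p, x', _, _, hx⟩ := exists_mono_element x
    obtain ⟨Y', q, y', _, _, hy⟩ := exists_mono_element y
    have h₁ : Ind.yoneda.map (p ⊗ₘ q) ≫ box x' y' = box x y := by rw [map_comp_box, hx, hy]
    have h₂ : box x' y' ≫ μ[A.X] ∈ (idealOf hI.isIdeal).carrier (X' ⊗ Y') := by
      refine (idealOf hI.isIdeal).mem_of_epi (p ⊗ₘ q) ?_
      change I.Factors (Ind.yoneda.map (p ⊗ₘ q) ≫ box x' y' ≫ μ[A.X])
      rw [reassoc_of% h₁]
      exact h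
    have h₃ : box x' y' = box (𝟙 _) (𝟙 _) ≫ (x' ⊗ₘ y') := by
      rw [box_comp, Category.id_comp, Category.id_comp]
    rw [mem_idealOf, h₃, Category.assoc] at h₂
    have h₄ := Subobject.factors_of_factors_right (inv (box (𝟙 _) (𝟙 _))) h₂
    rw [IsIso.inv_hom_id_assoc] at h₄
    refine (hI.factors_or_factors X' Y' x' y' ‹_› ‹_› h₄).imp (fun h => ?_) (fun h => ?_)
    · exact (congrArg I.Factors hx).mp (Subobject.factors_of_factors_right _ h)
    · exact (congrArg I.Factors hy).mp (Subobject.factors_of_factors_right _ h)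

/-- An algebra is simple if each of its nonzero elements locally generates the unit ideal. -/
theorem isSimpleAlgebra_of_elements (h₀ : (ofMon A).one ≠ 0)
    (h : ∀ {X : C} (x : (ofMon A).obj X), x ≠ 0 → ∃ (Y : C) (y : (ofMon A).obj Y) (Z : C)
      (p : Z ⟶ 𝟙_ C) (_ : Epi p) (q : Z ⟶ X ⊗ Y),
      (ofMon A).map q ((ofMon A).mul x y) = (ofMon A).map p (ofMon A).one) :
    IsSimpleAlgebra A where
  bot_ne_top h' := h₀ (by
    have := (Subobject.top_factors (unitEl C ≫ η[A.X]))
    rw [← h', Subobject.bot_factors_iff_zero] at this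
    exact this)
  eq_bot_or_eq_top I hI := by
    refine or_iff_not_imp_left.2 fun hne => ?_
    by_contra hne'
    refine hne (bot_unique (subobject_le_of_elements fun X x hx => ?_))
    rw [Subobject.bot_factors_iff_zero]
    by_contra hx₀
    obtain ⟨Y, y, Z, p, _, q, hpq⟩ := h x hx₀
    refine hne' (eq_top_of_one_mem hI ((idealOf hI).mem_of_epi p ?_))
    rw [← hpq]
    exact (idealOf hI).map_mem q ((idealOf hI).mul_mem y hx)

end Ideals

/-! ## Visibility -/

section Visible

theorem LaxAlgebra.Hom.exists_lift {C : Type u} [Category.{v} C] [Preadditive C]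
    [MonoidalCategory C] [SymmetricCategory C] {A : LaxAlgebra.{w} C} {B : LaxAlgebra.{w'} C}
    {S : LaxAlgebra.{w''} C} (θ : Hom A B) (e : Hom S B)
    (he : ∀ X, Function.Bijective (e.app X)) :
    ∃ θ' : Hom A S, ∀ X x, e.app X (θ'.app X x) = θ.app X x := by
  choose t ht using fun X (x : A.obj X) => (he X).2 (θ.app X x)
  refine ⟨{ app X := AddMonoidHom.mk' (t X) fun x y => (he X).1 ?_
            naturality f x := (he _).1 ?_
            map_mul x y := (he _).1 ?_
            map_one := (he _).1 ?_ }, ht⟩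
  · rw [ht, map_add, map_add, ht, ht]
  · exact (ht _ _).trans ((θ.naturality f x).trans
      ((congrArg _ (ht _ x)).symm.trans (e.naturality f _).symm))
  · exact (ht _ _).trans ((θ.map_mul x y).trans ((e.map_mul _ _).trans
      (congrArg₂ (fun a b => B.mul a b) (ht _ x) (ht _ y))).symm)
  · exact (ht _ _).trans (θ.map_one.trans e.map_one.symm)

variable {k : Type*} [Field k] {C : Type u₁} [Category.{v} C] [EssentiallySmall.{v} C] [Abelian C]
  [MonoidalCategory C] [SymmetricCategory C] [MonoidalPreadditive C] [HasDuals C]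
  [∀ X : C, IsNoetherianObject X]
  {D : Type u₂} [Category.{v} D] [EssentiallySmall.{v} D] [Abelian D] [Linear k D]
  [MonoidalCategory D] [SymmetricCategory D] [MonoidalPreadditive D] [MonoidalLinear k D]
  [HasDuals D] [Simple (𝟙_ D)] [∀ X : D, IsNoetherianObject X] [∀ X : D, IsArtinianObject X]
  (F : C ⥤ D) [F.Braided] [F.Additive] [PreservesFiniteLimits F] [PreservesFiniteColimits F]

open Functor.OplaxMonoidal in
/-- Prime ideals are visible in the presence of a tensor functor to a maximally nilpotent category
for which epimorphisms to the unit can be dominated by epimorphisms to the unit in the source. -/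
theorem allPrimesVisible_of_tensorFunctor (hF : ∀ {X Y : C} (f : X ⟶ Y), Epi (F.map f) → Epi f)
    (hk : ∀ f : 𝟙_ D ⟶ 𝟙_ D, ∃ a : k, f = a • 𝟙 _) (hD : IsMN D)
    (hE : ∀ {Y : D} (g : Y ⟶ 𝟙_ D), Epi g → ∃ (Z : C) (p : Z ⟶ 𝟙_ C) (_ : Epi p)
      (ψ : F.obj Z ⟶ Y), ψ ≫ g = F.map p ≫ η F) :
    AllPrimesVisible C := by
  intro A I hI
  have hP := isPrime_idealOf hI
  have := hP.isIntegral_quotient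
  obtain ⟨K, _, _, θ, hθ⟩ := exists_isInjective_hom_restrict F (idealOf hI.isIdeal).quotient
    (idealOf hI.isIdeal).isSeparated_quotient hF hk hD
  -- The target presheaf is left exact, because `F` is right exact and `K` is flat over `k`; hence
  -- it comes from an algebra.
  obtain ⟨S, e, he⟩ := exists_ofMon_bijective
    (((isLeftExact_unitAlgebra (D := D)).baseChange (k := k) K).restrict F)
  obtain ⟨θ', hθ'⟩ := Hom.exists_lift ((idealOf hI.isIdeal).proj.comp θ) e he
  have hθ₀ {X : C} (x : (ofMon A).obj X) :
      θ'.app X x = 0 ↔ x ∈ (idealOf hI.isIdeal).carrier X := by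
    rw [← map_eq_zero_iff _ (he X).1, hθ', ← Ideal.proj_eq_zero_iff]
    exact map_eq_zero_iff (θ.app X) ((injective_iff_map_eq_zero _).2 (hθ X))
  obtain ⟨f, hf⟩ := exists_hom_of_hom θ'
  refine ⟨S, isSimpleAlgebra_of_elements ?_ ?_, f, ?_⟩
  · rw [← θ'.map_one, Ne, hθ₀]
    exact hP.one_notMem
  · intro X x hx
    obtain ⟨Y, y, Z, p, hp, q, h⟩ := exists_map_mul_eq_map_one F K hk hE (e.app X x)
      ((map_ne_zero_iff _ (he X).1).2 hx)
    obtain ⟨y, rfl⟩ := (he Y).2 y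
    refine ⟨Y, y, Z, p, hp, q, (he Z).1 ?_⟩
    rw [e.naturality, e.map_mul, h, e.naturality, e.map_one]
  · exact kernelSubobject_eq_of_elements f.hom.hom I fun X x =>
      ((hf X x).congr_left).trans (hθ₀ x)

end Visible

end TensorCat

end
noncomputable section

namespace TensorCat

/-! ## Epimorphisms of ind-objects -/

section Epi

variable {C : Type u} [Category.{v} C] [EssentiallySmall.{v} C] [Abelian C] [MonoidalCategory C]

/-- Elements of an ind-object are a functor of the ind-object that preserves filtered colimits. -/
def coyonedaIso (X : C) : coyoneda.obj (op (Ind.yoneda.obj X)) ≅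
    Ind.inclusion C ⋙ (evaluation Cᵒᵖ (Type v)).obj (op X) :=
  NatIso.ofComponents (fun _ => elEquiv.toIso) fun φ => by
    ext x
    exact elEquiv_comp x φ

instance (X : C) (I : Type v) [SmallCategory I] [IsFiltered I] :
    PreservesColimitsOfShape I (coyoneda.obj (op (Ind.yoneda.obj X))) :=
  preservesColimitsOfShape_of_natIso (coyonedaIso X).symm

variable {I : Type v} [SmallCategory I] [IsFiltered I]

/-- The leg of the colimit defining an ind-object. -/
def limι (G : I ⥤ C) (i : I) : Ind.yoneda.obj (G.obj i) ⟶ (Ind.lim I).obj G :=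
  colimit.ι (G ⋙ Ind.yoneda) i

theorem map_comp_limι (G : I ⥤ C) {i j : I} (f : i ⟶ j) :
    Ind.yoneda.map (G.map f) ≫ limι G j = limι G i :=
  colimit.w (G ⋙ Ind.yoneda) f

theorem limι_comp_map {G H : I ⥤ C} (τ : G ⟶ H) (i : I) :
    limι G i ≫ (Ind.lim I).map τ = Ind.yoneda.map (τ.app i) ≫ limι H i :=
  ι_colimMap (Functor.whiskerRight τ Ind.yoneda) i

/-- Objects of `C` are compact in `Ind C`: a morphism to a filtered colimit factors through some
stage. -/
theorem exists_comp_limι {X : C} {G : I ⥤ C} (u : Ind.yoneda.obj X ⟶ (Ind.lim I).obj G) :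
    ∃ (i : I) (s : X ⟶ G.obj i), Ind.yoneda.map s ≫ limι G i = u := by
  obtain ⟨i, s, hs⟩ := Types.jointly_surjective _ (isColimitOfPreserves
    (coyoneda.obj (op (Ind.yoneda.obj X))) (colimit.isColimit (G ⋙ Ind.yoneda))) u
  obtain ⟨s, rfl⟩ := Ind.yoneda.map_surjective (show Ind.yoneda.obj X ⟶ Ind.yoneda.obj (G.obj i) from s)
  exact ⟨i, s, hs⟩

theorem exists_comp_map_eq_zero {X : C} {G : I ⥤ C} {i : I} (s : X ⟶ G.obj i)
    (h : Ind.yoneda.map s ≫ limι G i = 0) : ∃ (j : I) (f : i ⟶ j), s ≫ G.map f = 0 := by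
  have h' : Ind.yoneda.map s ≫ limι G i = Ind.yoneda.map 0 ≫ limι G i := by
    rw [h, Functor.map_zero, zero_comp]
  obtain ⟨j, f, hf⟩ := (Types.FilteredColimit.isColimit_eq_iff' (isColimitOfPreserves
    (coyoneda.obj (op (Ind.yoneda.obj X))) (colimit.isColimit (G ⋙ Ind.yoneda)))
      (Ind.yoneda.map s) (Ind.yoneda.map 0)).1 h'
  refine ⟨j, f, Ind.yoneda.map_injective ?_⟩
  have hf' : Ind.yoneda.map s ≫ Ind.yoneda.map (G.map f) =
    Ind.yoneda.map 0 ≫ Ind.yoneda.map (G.map f) := hf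
  rw [Functor.map_comp, hf', Functor.map_zero, Functor.map_zero, zero_comp]

/-- The cokernel of `τ`, computed stagewise, becomes zero in the colimit as a quotient map of it is
zero. By compactness the class of `u` in it already dies at a finite stage `j`, where exactness in
`C` gives a lift after a cover. -/
theorem exists_local_lift_lim {G H : I ⥤ C} (τ : G ⟶ H) [Epi ((Ind.lim I).map τ)] {X : C}
    (u : Ind.yoneda.obj X ⟶ (Ind.lim I).obj H) :
    ∃ (Z : C) (p : Z ⟶ X) (_ : Epi p) (v : Ind.yoneda.obj Z ⟶ (Ind.lim I).obj G),
      v ≫ (Ind.lim I).map τ = Ind.yoneda.map p ≫ u := by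
  have h₀ : (Ind.lim I).map (cokernel.π τ) = 0 := by
    rw [← cancel_epi ((Ind.lim I).map τ), ← Functor.map_comp, cokernel.condition, comp_zero]
    refine colimit.hom_ext fun i => ?_
    refine (limι_comp_map (0 : G ⟶ cokernel τ) i).trans ?_
    rw [NatTrans.app_zero, Functor.map_zero, zero_comp]
    exact comp_zero.symm
  obtain ⟨i, s, rfl⟩ := exists_comp_limι u
  have h₁ : Ind.yoneda.map (s ≫ (cokernel.π τ).app i) ≫ limι (cokernel τ) i = 0 := by
    rw [Functor.map_comp, Category.assoc, ← limι_comp_map, h₀, comp_zero, comp_zero]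
  obtain ⟨j, f, hf⟩ := exists_comp_map_eq_zero _ h₁
  rw [Category.assoc, ← (cokernel.π τ).naturality, ← Category.assoc] at hf
  obtain ⟨Z, p, hp, v, hv⟩ : ∃ (Z : C) (p : Z ⟶ X) (_ : Epi p) (v : Z ⟶ G.obj j),
      p ≫ s ≫ H.map f = v ≫ τ.app j :=
    ((ShortComplex.exact_cokernel τ).map
      ((evaluation I C).obj j)).exact_up_to_refinements (s ≫ H.map f) hf
  refine ⟨Z, p, hp, Ind.yoneda.map v ≫ limι G j, ?_⟩
  rw [Category.assoc, limι_comp_map, ← Functor.map_comp_assoc, ← hv, Functor.map_comp,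
    Functor.map_comp, Category.assoc, Category.assoc, map_comp_limι]

/-- Epimorphisms of ind-objects are locally surjective on elements. -/
theorem exists_local_lift {M N : Ind C} (φ : M ⟶ N) [Epi φ] {X : C}
    (u : Ind.yoneda.obj X ⟶ N) :
    ∃ (Z : C) (p : Z ⟶ X) (_ : Epi p) (v : Ind.yoneda.obj Z ⟶ M),
      v ≫ φ = Ind.yoneda.map p ≫ u := by
  -- Up to isomorphism every morphism of ind-objects is a filtered colimit of morphisms of `C` over
  -- a common index category.
  obtain ⟨I, _, _, G, H, τ, ⟨e⟩⟩ := Ind.exists_nonempty_arrow_mk_iso_ind_lim (f := φ)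
  have he : e.hom.left ≫ (Ind.lim I).map τ = φ ≫ e.hom.right := e.hom.w
  have he' : e.inv.left ≫ φ = (Ind.lim I).map τ ≫ e.inv.right := e.inv.w
  have hr : e.hom.right ≫ e.inv.right = 𝟙 N := by
    have := congrArg CommaMorphism.right e.hom_inv_id
    exact this
  have hl : e.inv.left ≫ e.hom.left = 𝟙 _ := congrArg CommaMorphism.left e.inv_hom_id
  have h : (Ind.lim I).map τ = e.inv.left ≫ φ ≫ e.hom.right := by
    rw [← he, reassoc_of% hl]
  have : IsIso e.inv.left := ⟨e.hom.left, hl, congrArg CommaMorphism.left e.hom_inv_id⟩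
  have : IsIso e.hom.right := ⟨e.inv.right, hr, congrArg CommaMorphism.right e.inv_hom_id⟩
  have : Epi ((Ind.lim I).map τ) := by
    rw [h]
    infer_instance
  obtain ⟨Z, p, hp, v, hv⟩ := exists_local_lift_lim τ (u ≫ e.hom.right)
  refine ⟨Z, p, hp, v ≫ e.inv.left, ?_⟩
  rw [Category.assoc, he', reassoc_of% hv, hr, Category.comp_id]

end Epi

/-! ## Tensor functors with right exact right adjoints on ind-objects -/

section RightAdjoint

variable {C : Type u₁} [Category.{v} C] [EssentiallySmall.{v} C] [Abelian C] [MonoidalCategory C]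
  {D : Type u₂} [Category.{v} D] [EssentiallySmall.{v} D] [Abelian D] [MonoidalCategory D]
  (F : C ⥤ D)

/-- The extension of a functor to ind-objects restricts to the functor. -/
def yonedaCompIndMap : F ⋙ Ind.yoneda ≅ Ind.yoneda ⋙ indMap F :=
  @asIso _ _ _ _ (Ind.yoneda.pointwiseLeftKanExtensionUnit (F ⋙ Ind.yoneda))
    (Ind.yoneda.pointwiseLeftKanExtensionIsPointwiseLeftKanExtension (F ⋙ Ind.yoneda)).isIso_hom

open Functor.OplaxMonoidal in
-- As `F_star` is right exact, it keeps `g` epimorphic. The element of `F_star 𝟙` adjoint to `F 𝟙 ≅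
-- 𝟙` therefore lifts to `F_star Y` after a cover `p` of the unit, and the adjoint of the lift is
-- `ψ`.
theorem exists_epi_of_preservesFiniteColimits [F.Monoidal] {F_star : Ind D ⥤ Ind C}
    (adj : indMap F ⊣ F_star) [PreservesFiniteColimits F_star] {Y : D} (g : Y ⟶ 𝟙_ D) [Epi g] :
    ∃ (Z : C) (p : Z ⟶ 𝟙_ C) (_ : Epi p) (ψ : F.obj Z ⟶ Y), ψ ≫ g = F.map p ≫ η F := by
  let i := yonedaCompIndMap F
  obtain ⟨Z, p, hp, v, hv⟩ := exists_local_lift (F_star.map (Ind.yoneda.map g))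
    (adj.homEquiv _ _ (i.inv.app (𝟙_ C) ≫ Ind.yoneda.map (η F)))
  obtain ⟨v, rfl⟩ := (adj.homEquiv _ _).surjective v
  rw [← adj.homEquiv_naturality_right, ← adj.homEquiv_naturality_left] at hv
  have hv' := (adj.homEquiv _ _).injective hv
  obtain ⟨ψ, hψ⟩ := Ind.yoneda.map_surjective
    (show Ind.yoneda.obj (F.obj Z) ⟶ Ind.yoneda.obj Y from i.hom.app Z ≫ v)
  refine ⟨Z, p, hp, ψ, Ind.yoneda.map_injective ?_⟩
  have hn : i.hom.app Z ≫ (indMap F).map (Ind.yoneda.map p) ≫ i.inv.app (𝟙_ C) =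
      Ind.yoneda.map (F.map p) := by
    have := i.hom.naturality_assoc p (i.inv.app (𝟙_ C))
    rw [Iso.hom_inv_id_app] at this
    exact this.symm.trans (Category.comp_id _)
  rw [Functor.map_comp, Functor.map_comp, hψ, ← hn]
  exact (Category.assoc _ _ _).trans ((i.hom.app Z ≫= hv').trans (by simp only [Category.assoc]))

end RightAdjoint

end TensorCat

end
noncomputable section

namespace TensorCat

open LaxAlgebra

/-! ## Pretannakian categories -/

section Pretannakian

namespace IsPretannakian

section

variable {k : Type w} [Field k] {C : Type u} [Category.{v} C] [Abelian C] [Linear k C]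
  [MonoidalCategory C] [SymmetricCategory C]

theorem hasDuals (hC : IsPretannakian k C) : HasDuals C := ⟨hC.exists_dual⟩

theorem exists_eq_smul (hC : IsPretannakian k C) (f : 𝟙_ C ⟶ 𝟙_ C) : ∃ a : k, f = a • 𝟙 _ :=
  (hC.bijective_smul_id.2 f).imp fun _ h => h.symm

theorem not_isZero_unit (hC : IsPretannakian k C) : ¬ IsZero (𝟙_ C) := fun h =>
  one_ne_zero (hC.bijective_smul_id.1 (h.eq_of_src _ _) : (1 : k) = 0)

theorem simple_unit (hC : IsPretannakian k C) : Simple (𝟙_ C) := by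
  have := hC.monoidalPreadditive
  have := hC.artinian (𝟙_ C)
  have := hC.hasDuals
  refine TensorCat.simple_unit hC.not_isZero_unit fun f hf => ?_
  obtain ⟨a, rfl⟩ := hC.exists_eq_smul f
  have ha : a ≠ 0 := by
    rintro rfl
    exact hf (zero_smul _ _)
  refine ⟨a⁻¹ • 𝟙 _, ?_, ?_⟩ <;>
    simp [Linear.comp_smul, smul_smul, ha]

end

variable {k : Type w} [Field k] {C : Type u₁} [Category.{v} C] [EssentiallySmall.{v} C] [Abelian C]
  [Linear k C] [MonoidalCategory C] [SymmetricCategory C]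
  {D : Type u₂} [Category.{v} D] [EssentiallySmall.{v} D] [Abelian D] [Linear k D]
  [MonoidalCategory D] [SymmetricCategory D]
  (F : C ⥤ D) [F.Braided] [F.Additive] [PreservesFiniteLimits F] [PreservesFiniteColimits F]

open Functor.OplaxMonoidal in
theorem allPrimesVisible (hC : IsPretannakian k C) (hD : IsPretannakian k D) (h : IsMN D)
    (hE : ∀ {Y : D} (g : Y ⟶ 𝟙_ D), Epi g → ∃ (Z : C) (p : Z ⟶ 𝟙_ C) (_ : Epi p)
      (ψ : F.obj Z ⟶ Y), ψ ≫ g = F.map p ≫ η F) :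
    AllPrimesVisible C := by
  have := hC.monoidalPreadditive
  have := hD.monoidalPreadditive
  have := hD.monoidalLinear
  have := hC.noetherian
  have := hD.noetherian
  have := hD.artinian
  have := hC.hasDuals
  have := hD.hasDuals
  have := hC.simple_unit
  have := hD.simple_unit
  exact allPrimesVisible_of_tensorFunctor F (fun f _ => epi_of_epi_map F hD.not_isZero_unit f)
    hD.exists_eq_smul h hE

end IsPretannakian

end Pretannakian

/-! ## Semisimple categories -/

section Semisimple

attribute [local instance] Abelian.hasFiniteBiproducts

/-- Some simple summand of `Y` maps nontrivially to `U`, hence isomorphically by Schur's lemma. -/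
theorem IsSemisimple.exists_section {D : Type u} [Category.{v} D] [Abelian D] (h : IsSemisimple D)
    {Y U : D} [Simple U] (g : Y ⟶ U) [Epi g] : ∃ s : U ⟶ Y, s ≫ g = 𝟙 U := by
  obtain ⟨n, S, hS, ⟨e⟩⟩ := h Y
  obtain ⟨i, hi⟩ : ∃ i, biproduct.ι S i ≫ e.inv ≫ g ≠ 0 := by
    by_contra! hne
    have h₀ : e.inv ≫ g = 0 := biproduct.hom_ext' _ _ fun i => by rw [hne, comp_zero]
    have : g = 0 := by rw [← cancel_epi e.inv, h₀, comp_zero]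
    exact id_nonzero U (by rw [← cancel_epi g, this, zero_comp, zero_comp])
  have := hS i
  have := isIso_of_hom_simple hi
  exact ⟨inv (biproduct.ι S i ≫ e.inv ≫ g) ≫ biproduct.ι S i ≫ e.inv, by simp⟩

end Semisimple

end TensorCat

end

theorem mainTheorem4 {k : Type w} [Field k]
    {C : Type u₁} [Category.{v} C] [EssentiallySmall.{v} C] [Abelian C] [Linear k C]
    [MonoidalCategory C] [SymmetricCategory C] [TensorCat.IsPretannakian k C] :
    (TensorCat.IsMN C → TensorCat.AllPrimesVisible C) ∧
    (∀ (D : Type u₂) [Category.{v} D] [EssentiallySmall.{v} D] [Abelian D] [Linear k D]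
        [MonoidalCategory D] [SymmetricCategory D] [TensorCat.IsPretannakian k D]
        (F : C ⥤ D) [F.Braided] [F.Additive] [F.Linear k]
        [PreservesFiniteLimits F] [PreservesFiniteColimits F],
      TensorCat.IsSemisimple D → TensorCat.IsMN D → TensorCat.AllPrimesVisible C) ∧
    (∀ (D : Type u₂) [Category.{v} D] [EssentiallySmall.{v} D] [Abelian D] [Linear k D]
        [MonoidalCategory D] [SymmetricCategory D] [TensorCat.IsPretannakian k D]
        (F : C ⥤ D) [F.Braided] [F.Additive] [F.Linear k]
        [PreservesFiniteLimits F] [PreservesFiniteColimits F]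
        (F_star : Ind D ⥤ Ind C) (_ : TensorCat.indMap F ⊣ F_star),
      TensorCat.IsMN D → F_star.Faithful → PreservesFiniteLimits F_star →
      PreservesFiniteColimits F_star → TensorCat.AllPrimesVisible C) := by
  refine ⟨fun h => ?_, ?_, ?_⟩
  -- For the identity functor each epimorphism onto the unit dominates itself.
  · refine TensorCat.IsPretannakian.allPrimesVisible (k := k) (𝟭 C) inferInstance inferInstance h
      fun {Y} g hg => ⟨Y, g, hg, 𝟙 Y, ?_⟩
    exact (Category.id_comp g).trans (Category.comp_id g).symm
  · intro D _ _ _ _ _ _ hD F _ _ _ _ _ hs h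
    have := hD.simple_unit
    refine TensorCat.IsPretannakian.allPrimesVisible (k := k) F inferInstance hD h fun {Y} g _ => ?_
    obtain ⟨s, hs⟩ := hs.exists_section g
    -- A section of `g` shows that it is dominated by the identity of the unit.
    refine ⟨𝟙_ C, 𝟙 _, inferInstance, Functor.OplaxMonoidal.η F ≫ s, ?_⟩
    rw [Category.assoc, hs, Category.comp_id, F.map_id, Category.id_comp]
  · intro D _ _ _ _ _ _ hD F _ _ _ _ _ F_star adj h _ _ _
    exact TensorCat.IsPretannakian.allPrimesVisible (k := k) F inferInstance hD h fun {Y} g _ =>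
      TensorCat.exists_epi_of_preservesFiniteColimits F adj g
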